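/- Let $(M,g)$ be a connected compact smooth Riemannian manifold (without boundary) with Riemannian distance $d$, and let $V:M\to\mathbb R$ be smooth. For $t\in\mathbb R$ let $H_t(x,\xi)=\tfrac12|\xi|_g^2+t^2V(x)$ on $T^*M$. For $x,y\in M$ and $\mu\in\mathbb R$ let $\Gamma^{H_t}_{1,x,y}(\mu)$ be the set of solutions $(q(s),p(s)):[0,1]\to T^*M$ of Hamilton's equations for $H_t$ with $q(0)=y$, $q(1)=x$ and $|p(0)|_g<\mu$. Call $(t_0,N,\mu)$ admissible if $t_0>0$, $N\subset M\times M$ is an open neighbourhood of the diagonal, and for all $t\in(-t_0,t_0)$ and $(x,y)\in N$ the set $\Gamma^{H_t}_{1,x,y}(\mu)$ has exactly one element, written $(q^t_s(x,y),p^t_s(x,y))$; in that case define the scaled action $$\Phi(t,x,y)=\int_0^1\Big(\tfrac12\Big|\tfrac{d}{ds}q^t_s(x,y)\Big|_g^2-t^2V(q^t_s(x,y))\Big)\,ds .$$ 1. There exists an admissible $(t_0,N,\mu)$ such that $\Phi$ is smooth on $(-t_0,t_0)\times N$. 2. For every admissible $(t_0,N,\mu)$ such that $\Phi$ is smooth on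 $(-t_0,t_0)\times N$, the function $$\phi(t,x,y)=\int_0^1(1-s)\,(\partial_t^2\Phi)(st,x,y)\,ds$$ is smooth on $(-t_0,t_0)\times N$, and for all $(t,x,y)\in(-t_0,t_0)\times N$ $$\Phi(t,x,y)=\tfrac12 d(x,y)^2+t^2\phi(t,x,y).$$ -/

import Mathlib

open Set Bundle MeasureTheory
open scoped Manifold ContDiff

noncomputable section

section Mechanics

variable {E : Type*} [NormedAddCommGroup E] [NormedSpace ℝ E]
  {M : Type*} [TopologicalSpace M] [ChartedSpace E M] [IsManifold 𝓘(ℝ, E) ∞ M]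

variable (E M) in
/-- The cotangent bundle `T*M`: pairs `(x, ξ)` with `ξ` a linear form on `T_x M`. -/
abbrev CotangentBundle : Type _ :=
  TotalSpace (E →L[ℝ] ℝ) (fun x : M ↦ TangentSpace 𝓘(ℝ, E) x →L[ℝ] ℝ)

/-- The position coordinates of `z = (x, ξ)` in the chart of `M` around `c`. -/
def posCoord (c : M) (z : CotangentBundle E M) : E :=
  extChartAt 𝓘(ℝ, E) c z.proj

/-- The momentum coordinates of `z = (x, ξ)` in the chart of `M` around `c`: the form `ξ`
composed with the inverse of the derivative of the chart at `x`. (The trivialization of `TM` at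
`c` is, over the chart domain, the derivative of the chart.) With `posCoord c` these are the
canonical coordinates of `T*M` over the chart. -/
def momCoord (c : M) (z : CotangentBundle E M) : E →L[ℝ] ℝ :=
  z.2 ∘L (trivializationAt E (TangentSpace 𝓘(ℝ, E)) c).symmL ℝ z.proj

/-- The point of `T*M` with canonical coordinates `(u, α)` over the chart of `M` around `c`. -/
def ofCoord (c : M) (u : E) (α : E →L[ℝ] ℝ) : CotangentBundle E M :=
  ⟨(extChartAt 𝓘(ℝ, E) c).symm u,
    α ∘L (trivializationAt E (TangentSpace 𝓘(ℝ, E)) c).continuousLinearMapAt ℝ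
      ((extChartAt 𝓘(ℝ, E) c).symm u)⟩

/-- `γ : [0, T] → T*M` is a classical path of the Hamiltonian `H` (an integral curve of the Hamilton
vector field of `H`): its base curve is continuous, and in the canonical coordinates `(u, α)` over
each chart that it meets it satisfies Hamilton's equations `u' = ∂H/∂α`, `α' = -∂H/∂u`. The first
one is an equation in the bidual of `E`, so it is stated after pairing with linear forms `β`.
Only the values of `γ` on `[0, T]` matter. -/
structure IsClassicalPath (H : CotangentBundle E M → ℝ) (T : ℝ)
    (γ : ℝ → CotangentBundle E M) : Prop where
  continuousOn : ContinuousOn (fun s ↦ (γ s).proj) (Icc 0 T)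
  deriv_pos : ∀ c : M, ∀ s ∈ Icc (0 : ℝ) T, (γ s).proj ∈ (chartAt E c).source →
    ∀ β : E →L[ℝ] ℝ,
      HasDerivWithinAt (fun σ ↦ β (posCoord c (γ σ)))
        (fderiv ℝ (fun α ↦ H (ofCoord c (posCoord c (γ s)) α)) (momCoord c (γ s)) β)
        (Icc 0 T) s
  deriv_mom : ∀ c : M, ∀ s ∈ Icc (0 : ℝ) T, (γ s).proj ∈ (chartAt E c).source →
    HasDerivWithinAt (fun σ ↦ momCoord c (γ σ))
      (-fderiv ℝ (fun u ↦ H (ofCoord c u (momCoord c (γ s)))) (posCoord c (γ s)))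
      (Icc 0 T) s

variable [RiemannianBundle (fun x : M ↦ TangentSpace 𝓘(ℝ, E) x)]

/-- The Hamiltonian `H(x, ξ) = |ξ|²/2 + V(x)`, where `|ξ|` is the dual norm of the Riemannian norm
of `T_x M`. -/
def hamiltonian (V : M → ℝ) (z : CotangentBundle E M) : ℝ :=
  ‖z.2‖ ^ 2 / 2 + V z.proj

variable (E) in
/-- The scaled Hamiltonian `H_t(x, ξ) = |ξ|²/2 + t² V(x)`, for every real `t`. For `t ≠ 0` it is
`t² H(x, t⁻¹ ξ)`. -/
def scaledHamiltonian (V : M → ℝ) (t : ℝ) : CotangentBundle E M → ℝ :=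
  hamiltonian (fun x ↦ t ^ 2 * V x)

/-- The set `Γ^H_{T,x,y}(μ)` of the classical paths of `H` on `[0, T]` from `y` to `x` with initial
momentum of norm less than `μ`. Elements that agree on `[0, T]` are the same path. -/
def lowEnergyPaths (H : CotangentBundle E M → ℝ) (T : ℝ) (x y : M) (μ : ℝ) :
    Set (ℝ → CotangentBundle E M) :=
  {γ | IsClassicalPath H T γ ∧ (γ 0).proj = y ∧ (γ T).proj = x ∧ ‖(γ 0).2‖ < μ}

/-- `Γ^H_{T,x,y}(μ)` has a unique element, as a set of paths on `[0, T]`. -/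
def HasUniqueLowEnergyPath (H : CotangentBundle E M → ℝ) (T : ℝ) (x y : M) (μ : ℝ) : Prop :=
  ∃ γ ∈ lowEnergyPaths H T x y μ,
    ∀ γ' ∈ lowEnergyPaths H T x y μ, EqOn γ' γ (Icc 0 T)

variable (E) in
/-- The pair `(t₀, N)` with the energy bound `μ` is admissible: `N` is an open neighbourhood of the
diagonal and for `|t| < t₀`, `(x, y) ∈ N` there is a unique lowest energy classical path of `H_t`
from `y` to `x` in the time `1`. -/
structure IsLowEnergyDomain (V : M → ℝ) (t₀ : ℝ) (N : Set (M × M)) (μ : ℝ) : Prop where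
  pos : 0 < t₀
  isOpen : IsOpen N
  diagonal_subset : diagonal M ⊆ N
  unique : ∀ t ∈ Ioo (-t₀) t₀, ∀ x y : M, (x, y) ∈ N →
    HasUniqueLowEnergyPath (scaledHamiltonian E V t) 1 x y μ

/-- The action `∫₀ᵀ (|q'(s)|²/2 - V(q(s))) ds` of the base curve `q` of `γ`. -/
def action (V : M → ℝ) (T : ℝ) (γ : ℝ → CotangentBundle E M) : ℝ :=
  ∫ s in (0 : ℝ)..T,
    (‖mfderivWithin 𝓘(ℝ, ℝ) 𝓘(ℝ, E) (fun σ ↦ (γ σ).proj) (Icc 0 T) s (1 : ℝ)‖ ^ 2 / 2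
      - V (γ s).proj)

open scoped Classical in
variable (E) in
/-- The scaled action `Φ(t, x, y)`: the action, with the potential `t² V`, of the lowest energy
path in `Γ^{H_t}_{1,x,y}(μ)` (and `0` if there is no such path). -/
def scaledAction (V : M → ℝ) (μ t : ℝ) (x y : M) : ℝ :=
  if h : (lowEnergyPaths (scaledHamiltonian E V t) 1 x y μ).Nonempty then
    action (fun x ↦ t ^ 2 * V x) 1 h.some
  else 0

variable (E) in
/-- `φ(t, x, y) = ∫₀¹ (1 - s) (∂ₜ²Φ)(s t, x, y) ds`. -/
def scaledActionRemainder (V : M → ℝ) (μ t : ℝ) (x y : M) : ℝ :=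
  ∫ s in (0 : ℝ)..1, (1 - s) * iteratedDeriv 2 (fun τ ↦ scaledAction E V μ τ x y) (s * t)

end Mechanics

end

/-! The first assertion is the implicit function theorem. In canonical coordinates over a chart,
Hamilton's equations with q(0) = y and q(1) = x, written in integral form, are the zeros of a map on
a Banach space of pairs of continuous curves (`boundaryValueMap`). This map is smooth because
superposition operators are (`contDiffOn_superpos`). At t = 0 and x = y the constant curve is a
solution, and the linearized problem there is q' = gp, p' = 0 with q prescribed at both ends, which
is uniquely solvable (`isInvertible_boundaryValueLinear`). Hence there is a smooth family ψ(t, x, y)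
of solutions, unique among curves uniformly close to the constant one. Conservation of energy and
the boundedness of V keep every path with small initial momentum in that range
(`exists_isLocalSolutionFamily`), so ψ describes exactly the low energy path, and Φ is a smooth
function of ψ. Compactness of M makes the momentum bound uniform, and the tube lemma yields t₀ and N
(`exists_tube_isRegularPoint`).

The second assertion is Taylor's formula in t. Φ depends on t only through t², so it is even and its
first derivative at t = 0 vanishes. What remains is Φ(0, x, y) = d(x, y)²/2, for every admissible
triple, where N and μ need not be small. At t = 0 paths have constant speed, Φ = |p(0)|²/2, and
|p(0)| ≥ d(x, y). If y and x are joined by a minimal geodesic, its initial momentum has norm d(x, y)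
< μ, so by uniqueness it is the low energy path
(`HasUniqueLowEnergyPath.scaledAction_zero_eq_dist`).

Minimal geodesics (`exists_minimal_motion`) come from the same local family. The first variation
formula (`hasFDerivAt_curveAction`) identifies d_xΦ with p(1) and -d_yΦ with p(0). At t = 0 this
gives |d_xΦ|² = 2Φ, so √(2Φ) grows along a curve by at most its length, and short geodesics are
minimal (`norm_eq_dist_of_mem_lowEnergyPaths`). Distant points are joined by short geodesics through
intermediate points. A joint minimizes the sum of the squared distances to its neighbours, so by the
first variation formula the two momenta agree there and no corner occurs (`eq_of_two_mul_le_dist`).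
-/

noncomputable section

set_option linter.unusedSectionVars false

/-! ### Smoothness of superposition operators on spaces of continuous curves. -/

section Superposition

open Filter Topology

variable {K : Type*} [TopologicalSpace K] [CompactSpace K]

/-- The superposition operator `γ ↦ f ∘ γ` on continuous functions. It has the value `0` where
`f ∘ γ` is not continuous. -/
def superpos {A B : Type*} [TopologicalSpace A] [TopologicalSpace B] [Zero B]
    (f : A → B) (γ : C(K, A)) : C(K, B) :=
  open scoped Classical in if h : Continuous (f ∘ γ) then ⟨f ∘ γ, h⟩ else 0


theorem superpos_apply {A B : Type*} [TopologicalSpace A] [TopologicalSpace B] [Zero B]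
    {f : A → B} {γ : C(K, A)} (h : Continuous (f ∘ γ)) (s : K) : superpos f γ s = f (γ s) := by
  simp [superpos, h]

theorem superpos_apply_of_continuousOn {A B : Type*} [TopologicalSpace A] [TopologicalSpace B]
    [Zero B] {f : A → B} {U : Set A} (hf : ContinuousOn f U) {γ : C(K, A)} (h : ∀ s, γ s ∈ U)
    (s : K) : superpos f γ s = f (γ s) :=
  superpos_apply (hf.comp_continuous γ.continuous h) s

theorem isOpen_curves_mem {A : Type*} [TopologicalSpace A] {U : Set A} (hU : IsOpen U) :
    IsOpen {γ : C(K, A) | ∀ s, γ s ∈ U} := by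
  simpa [MapsTo] using ContinuousMap.isOpen_setOfPred_mapsTo (isCompact_univ (X := K)) hU

section

variable {A B : Type*} [NormedAddCommGroup A] [NormedSpace ℝ A]
  [NormedAddCommGroup B] [NormedSpace ℝ B]

instance normedAddCommGroupCurvesClm : NormedAddCommGroup C(K, A →L[ℝ] B) :=
  ContinuousMap.instNormedAddCommGroup

variable (K A B) in
/-- Pointwise application of a curve of operators to a curve of vectors. -/
def curveApply : C(K, A →L[ℝ] B) →L[ℝ] C(K, A) →L[ℝ] C(K, B) :=
  LinearMap.mkContinuous₂
    (LinearMap.mk₂ ℝ (fun (L : C(K, A →L[ℝ] B)) (γ : C(K, A)) ↦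
        (⟨fun s ↦ L s (γ s), L.continuous.clm_apply γ.continuous⟩ : C(K, B)))
      (fun _ _ _ ↦ by ext; simp) (fun _ _ _ ↦ by ext; simp)
      (fun _ _ _ ↦ by ext; simp) (fun _ _ _ ↦ by ext; simp)) 1
    (fun L γ ↦ by
      rw [one_mul, ContinuousMap.norm_le _ (by positivity)]
      intro s
      exact ((L s).le_opNorm (γ s)).trans
        (mul_le_mul (L.norm_coe_le_norm s) (γ.norm_coe_le_norm s) (norm_nonneg _) (norm_nonneg _)))

@[simp] theorem curveApply_apply (L : C(K, A →L[ℝ] B)) (γ : C(K, A)) (s : K) :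
    curveApply K A B L γ s = L s (γ s) := rfl

/-- The first order estimate must be uniform in `s`. Strict differentiability at `γ s`, together
with continuity of `fderiv ℝ f`, gives it locally uniformly near each `s`, and compactness of `K`
makes it uniform. -/
theorem hasFDerivAt_superpos {f : A → B} {U : Set A} (hU : IsOpen U) (hf : ContDiffOn ℝ 1 f U)
    {γ : C(K, A)} (hγ : ∀ s, γ s ∈ U) :
    HasFDerivAt (superpos (K := K) f) (curveApply K A B (superpos (fderiv ℝ f) γ)) γ := by
  have hfd : ContinuousOn (fderiv ℝ f) U := hf.continuousOn_fderiv_of_isOpen hU le_rfl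
  rw [hasFDerivAt_iff_isLittleO_nhds_zero, Asymptotics.isLittleO_iff]
  intro ε hε
  have key : ∀ s ∈ (univ : Set K), ∀ᶠ z : A × K in 𝓝 (0, s),
      ‖f (γ z.2 + z.1) - f (γ z.2) - fderiv ℝ f (γ z.2) z.1‖ ≤ ε * ‖z.1‖ := by
    intro s _
    have hs : HasStrictFDerivAt f (fderiv ℝ f (γ s)) (γ s) :=
      ((hf.contDiffAt (hU.mem_nhds (hγ s))).hasStrictFDerivAt one_ne_zero)
    have h1 := hs.isLittleO.def (half_pos hε)
    have t1 : Tendsto (fun z : A × K ↦ (γ z.2 + z.1, γ z.2)) (𝓝 (0, s)) (𝓝 (γ s, γ s)) := by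
      have : Continuous (fun z : A × K ↦ (γ z.2 + z.1, γ z.2)) := by fun_prop
      simpa using this.tendsto (0, s)
    have h2 : ∀ᶠ a in 𝓝 (γ s), ‖fderiv ℝ f a - fderiv ℝ f (γ s)‖ < ε / 2 := by
      have := (hfd.continuousAt (hU.mem_nhds (hγ s)))
      have := Metric.tendsto_nhds.1 this (ε / 2) (half_pos hε)
      simpa [dist_eq_norm] using this
    have t2 : Tendsto (fun z : A × K ↦ γ z.2) (𝓝 (0, s)) (𝓝 (γ s)) :=
      (γ.continuous.comp continuous_snd).tendsto _
    filter_upwards [t1.eventually h1, t2.eventually h2] with z hz1 hz2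
    simp only [add_sub_cancel_left] at hz1
    have e : f (γ z.2 + z.1) - f (γ z.2) - fderiv ℝ f (γ z.2) z.1
        = (f (γ z.2 + z.1) - f (γ z.2) - fderiv ℝ f (γ s) z.1)
          - (fderiv ℝ f (γ z.2) - fderiv ℝ f (γ s)) z.1 := by
      simp
    rw [e]
    refine (norm_sub_le _ _).trans ?_
    have := (fderiv ℝ f (γ z.2) - fderiv ℝ f (γ s)).le_of_opNorm_le hz2.le z.1
    linarith
  have := isCompact_univ.eventually_forall_of_forall_eventually
    (P := fun a s ↦ ‖f (γ s + a) - f (γ s) - fderiv ℝ f (γ s) a‖ ≤ ε * ‖a‖) key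
  obtain ⟨r, hr, hball⟩ := Metric.eventually_nhds_iff.1 this
  have hopen : ∀ᶠ δ : C(K, A) in 𝓝 0, ∀ s, (γ + δ) s ∈ U := by
    have : Tendsto (fun δ : C(K, A) ↦ γ + δ) (𝓝 0) (𝓝 γ) := by
      have : Continuous (fun δ : C(K, A) ↦ γ + δ) := by fun_prop
      simpa using this.tendsto 0
    exact this.eventually ((isOpen_curves_mem hU).mem_nhds hγ)
  filter_upwards [hopen, Metric.ball_mem_nhds (0 : C(K, A)) hr] with δ h1 h2
  rw [ContinuousMap.norm_le _ (by positivity)]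
  intro s
  have hs : dist (δ s) 0 < r := by
    rw [dist_zero_right]
    exact (δ.norm_coe_le_norm s).trans_lt (by simpa using h2)
  have := hball hs s (mem_univ s)
  simp only [ContinuousMap.sub_apply, curveApply_apply,
    superpos_apply_of_continuousOn hf.continuousOn h1,
    superpos_apply_of_continuousOn hf.continuousOn hγ, superpos_apply_of_continuousOn hfd hγ,
    ContinuousMap.add_apply]
  exact this.trans (mul_le_mul_of_nonneg_left (δ.norm_coe_le_norm s) hε.le)

/-- Used to move the target to another universe. The junk value is respected, since `f ∘ γ` and `e ∘
f ∘ γ` are continuous together. -/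
theorem superpos_clm_comp {C : Type*} [NormedAddCommGroup C] [NormedSpace ℝ C]
    (e : B ≃L[ℝ] C) (f : A → B) (γ : C(K, A)) :
    superpos f γ = (e.symm : C →L[ℝ] B).compLeftContinuous ℝ K (superpos (e ∘ f) γ) := by
  by_cases h : Continuous (f ∘ γ)
  · have h' : Continuous ((e ∘ f) ∘ γ) := e.continuous.comp h
    ext s
    simp [superpos_apply h, superpos_apply h']
  · have h' : ¬ Continuous ((e ∘ f) ∘ γ) := fun h' ↦ h (by
      convert e.symm.continuous.comp h' using 1
      ext; simp)
    simp only [superpos, h, h', dite_false]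
    ext; simp

end

universe u v w

/-- Induction on the order: the derivative of a superposition operator is the superposition operator
of `fderiv ℝ f` followed by the bounded linear map `curveApply`. The induction replaces `B` by `A
→L[ℝ] B`, so `B` must live in a universe closed under this step. -/
theorem contDiffOn_superpos_nat {K : Type w} [TopologicalSpace K] [CompactSpace K]
    {A : Type u} [NormedAddCommGroup A] [NormedSpace ℝ A] {U : Set A}
    (hU : IsOpen U) (n : ℕ) : ∀ {B : Type max u v} [NormedAddCommGroup B] [NormedSpace ℝ B]
    {f : A → B}, ContDiffOn ℝ n f U →
      ContDiffOn ℝ n (superpos (K := K) f) {γ | ∀ s, γ s ∈ U} := by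
  induction n with
  | zero =>
    intro B _ _ f hf
    rw [Nat.cast_zero, contDiffOn_zero] at *
    intro γ hγ
    refine ContinuousAt.continuousWithinAt ?_
    rw [ContinuousAt, ContinuousMap.tendsto_iff_tendstoUniformly, Metric.tendstoUniformly_iff]
    intro ε hε
    have key : ∀ s ∈ (univ : Set K), ∀ᶠ z : C(K, A) × K in 𝓝 (γ, s),
        dist (f (γ z.2)) (f (z.1 z.2)) < ε := by
      intro s _
      have hc := hf.continuousAt (hU.mem_nhds (hγ s))
      have t1 : Tendsto (fun z : C(K, A) × K ↦ f (z.1 z.2)) (𝓝 (γ, s)) (𝓝 (f (γ s))) :=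
        hc.tendsto.comp ((continuous_eval (F := C(K, A))).tendsto (γ, s))
      have t2 : Tendsto (fun z : C(K, A) × K ↦ f (γ z.2)) (𝓝 (γ, s)) (𝓝 (f (γ s))) :=
        hc.tendsto.comp ((γ.continuous.comp continuous_snd).tendsto (γ, s))
      have := t2.dist t1
      rw [dist_self] at this
      exact this.eventually (gt_mem_nhds hε)
    have := isCompact_univ.eventually_forall_of_forall_eventually
      (P := fun (γ' : C(K, A)) s ↦ dist (f (γ s)) (f (γ' s)) < ε) key
    filter_upwards [this, (isOpen_curves_mem hU).mem_nhds hγ] with γ' h1 h2 s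
    rw [superpos_apply_of_continuousOn hf hγ, superpos_apply_of_continuousOn hf h2]
    exact h1 s (mem_univ s)
  | succ n ih =>
    intro B _ _ f hf
    have hf1 : ContDiffOn ℝ 1 f U := hf.of_le (by exact_mod_cast Nat.le_add_left 1 n)
    have hO : IsOpen {γ : C(K, A) | ∀ s, γ s ∈ U} := isOpen_curves_mem hU
    rw [Nat.cast_add, Nat.cast_one, contDiffOn_succ_iff_hasFDerivWithinAt_of_uniqueDiffOn
      hO.uniqueDiffOn]
    refine ⟨by simp, fun γ ↦ curveApply K A B (superpos (fderiv ℝ f) γ), ?_, fun γ hγ ↦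
      (hasFDerivAt_superpos hU hf1 hγ).hasFDerivWithinAt⟩
    refine (curveApply K A B).contDiff.comp_contDiffOn (ih ?_)
    exact ((contDiffOn_succ_iff_fderiv_of_isOpen hU).1 (by exact_mod_cast hf)).2.2

/-- The superposition operator of a smooth function is smooth. -/
theorem contDiffOn_superpos {K : Type w} [TopologicalSpace K] [CompactSpace K]
    {A : Type u} [NormedAddCommGroup A] [NormedSpace ℝ A]
    {B : Type v} [NormedAddCommGroup B] [NormedSpace ℝ B] {f : A → B} {U : Set A}
    (hU : IsOpen U) (hf : ContDiffOn ℝ ∞ f U) :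
    ContDiffOn ℝ ∞ (superpos (K := K) f) {γ | ∀ s, γ s ∈ U} := by
  -- Lifting `B` reaches the universe in which the induction was carried out.
  let e : B ≃L[ℝ] ULift.{u} B := (ContinuousLinearEquiv.ulift (R₁ := ℝ) (M₁ := B)).symm
  have h1 : superpos (K := K) f
      = (fun γ ↦ (e.symm : _ →L[ℝ] B).compLeftContinuous ℝ K γ) ∘ superpos (e ∘ f) :=
    funext fun γ ↦ superpos_clm_comp e f γ
  rw [h1]
  refine ContDiff.comp_contDiffOn (ContinuousLinearMap.contDiff _) ?_
  rw [contDiffOn_infty]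
  intro n
  exact contDiffOn_superpos_nat.{u, v, w} hU n
    (e.contDiff.comp_contDiffOn (contDiffOn_infty.1 hf n))

end Superposition

/-! ### Implicit functions that are smooth near the base point. -/

section Implicit

open Filter Topology

/-- The implicit function theorem, with smoothness on a neighbourhood. -/
theorem exists_smooth_implicitFunction
    {E₁ : Type*} [NormedAddCommGroup E₁] [NormedSpace ℝ E₁] [CompleteSpace E₁]
    {E₂ : Type*} [NormedAddCommGroup E₂] [NormedSpace ℝ E₂] [CompleteSpace E₂]
    {F : Type*} [NormedAddCommGroup F] [NormedSpace ℝ F] [CompleteSpace F]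
    {f : E₁ × E₂ → F} {S : Set (E₁ × E₂)} (hS : IsOpen S) (hf : ContDiffOn ℝ ∞ f S)
    {u : E₁ × E₂} (hu : u ∈ S) (h0 : f u = 0)
    (hinv : (fderiv ℝ f u ∘L .inr ℝ E₁ E₂).IsInvertible) :
    ∃ ψ : E₁ → E₂, ψ u.1 = u.2 ∧ (∀ᶠ x in 𝓝 u.1, ContDiffAt ℝ ∞ ψ x) ∧
      ∀ᶠ v in 𝓝 u, f v = 0 ↔ ψ v.1 = v.2 := by
  have cd : ∀ v ∈ S, ContDiffAt ℝ ∞ f v := fun v hv ↦ hf.contDiffAt (hS.mem_nhds hv)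
  have hinf : (∞ : WithTop ℕ∞) ≠ 0 := by simp
  set ψ := (cd u hu).implicitFunction hinf hinv with hψ
  have hiff : ∀ᶠ v in 𝓝 u, f v = 0 ↔ ψ v.1 = v.2 := by
    have := (cd u hu).eventually_apply_eq_iff_implicitFunction hinf hinv
    rwa [h0] at this
  have hψu : ψ u.1 = u.2 := (cd u hu).implicitFunction_apply_self hinf hinv
  have hψc : ∀ᶠ x in 𝓝 u.1, ContinuousAt ψ x := by
    have := ((cd u hu).contDiffAt_implicitFunction hinf hinv).of_le (m := 1) (by simp)
    exact (this.eventually (by simp)).mono fun x hx ↦ hx.continuousAt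
  have hI : ∀ᶠ v in 𝓝 u, (fderiv ℝ f v ∘L .inr ℝ E₁ E₂).IsInvertible := by
    have hc : ContinuousAt (fun v ↦ fderiv ℝ f v ∘L .inr ℝ E₁ E₂) u :=
      (((hf.continuousOn_fderiv_of_isOpen hS (by simp)).continuousAt (hS.mem_nhds hu))).clm_comp
        continuousAt_const
    exact hc.eventually (ContinuousLinearEquiv.isOpen.mem_nhds hinv)
  have hgood : ∀ᶠ v in 𝓝 u, v ∈ S ∧ (fderiv ℝ f v ∘L .inr ℝ E₁ E₂).IsInvertible ∧
      ∀ᶠ w in 𝓝 v, (f w = 0 ↔ ψ w.1 = w.2) :=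
    (hS.eventually_mem hu).and (hI.and hiff.eventually_nhds)
  have hpair : Tendsto (fun x ↦ (x, ψ x)) (𝓝 u.1) (𝓝 u) := by
    have : ContinuousAt (fun x ↦ (x, ψ x)) u.1 := continuousAt_id.prodMk hψc.self_of_nhds
    have h := this.tendsto
    rwa [hψu] at h
  refine ⟨ψ, hψu, ?_, hiff⟩
  filter_upwards [hpair.eventually hgood, hψc] with x ⟨hxS, hxI, hxe⟩ hxc
  set v : E₁ × E₂ := (x, ψ x) with hv
  have hfv : f v = 0 := hxe.self_of_nhds.2 rfl
  -- At a nearby zero `v` of `f` the theorem applies afresh. Its implicit function coincides with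
  -- `ψ` near `x`, because both parametrize the same zero set, and it is smooth at `x`.
  set ψ' := (cd v hxS).implicitFunction hinf hxI
  have h' : ContDiffAt ℝ ∞ ψ' x := (cd v hxS).contDiffAt_implicitFunction hinf hxI
  have hiff' := (cd v hxS).eventually_apply_eq_iff_implicitFunction hinf hxI
  rw [hfv] at hiff'
  have hp : Tendsto (fun x' ↦ (x', ψ x')) (𝓝 x) (𝓝 v) := (continuousAt_id.prodMk hxc).tendsto
  refine h'.congr_of_eventuallyEq ?_
  filter_upwards [hp.eventually (hxe.and hiff')] with x' ⟨h1, h2⟩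
  exact (h2.1 (h1.2 rfl)).symm

end Implicit

end

noncomputable section

set_option linter.unusedSectionVars false

/-! ### The boundary value problem as an equation between Banach spaces. -/

section BoundaryValue

open Filter Topology unitInterval

section

variable {X : Type*} [NormedAddCommGroup X] [NormedSpace ℝ X]

/-- The extension of a curve on `[0, 1]` to `ℝ` by constants. -/
def extendCurve {X : Type*} [TopologicalSpace X] (f : C(I, X)) (s : ℝ) : X :=
  f (projIcc 0 1 zero_le_one s)

theorem continuous_extendCurve {X : Type*} [TopologicalSpace X] (f : C(I, X)) :
    Continuous (extendCurve f) := f.continuous.comp continuous_projIcc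

theorem extendCurve_coe {X : Type*} [TopologicalSpace X] (f : C(I, X)) (s : I) :
    extendCurve f s = f s := by simp [extendCurve]

theorem extendCurve_of_mem {X : Type*} [TopologicalSpace X] (f : C(I, X)) {s : ℝ}
    (hs : s ∈ Icc (0 : ℝ) 1) : extendCurve f s = f ⟨s, hs⟩ := by
  simp [extendCurve, projIcc_of_mem zero_le_one hs]

theorem norm_extendCurve_le (f : C(I, X)) (s : ℝ) : ‖extendCurve f s‖ ≤ ‖f‖ :=
  f.norm_coe_le_norm _

variable (X) in
/-- Integration of curves on `[0, 1]` from the time `0`. -/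
def curvePrimitive : C(I, X) →L[ℝ] C(I, X) :=
  LinearMap.mkContinuous
    { toFun := fun f ↦ ⟨fun s : I ↦ ∫ r in (0 : ℝ)..s, extendCurve f r,
        (intervalIntegral.continuous_primitive
          (fun a b ↦ (continuous_extendCurve f).intervalIntegrable a b) 0).comp
          continuous_subtype_val⟩
      map_add' := fun f g ↦ by
        ext s
        exact intervalIntegral.integral_add ((continuous_extendCurve f).intervalIntegrable _ _)
          ((continuous_extendCurve g).intervalIntegrable _ _)
      map_smul' := fun c f ↦ by
        ext s
        exact intervalIntegral.integral_smul c (extendCurve f) } 1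
    (fun f ↦ by
      rw [one_mul, ContinuousMap.norm_le _ (norm_nonneg _)]
      intro s
      have := intervalIntegral.norm_integral_le_of_norm_le_const (a := 0) (b := (s : ℝ))
        (f := extendCurve f) (C := ‖f‖) (fun r _ ↦ norm_extendCurve_le f r)
      refine this.trans ?_
      rw [sub_zero, abs_of_nonneg s.2.1]
      exact mul_le_of_le_one_right (norm_nonneg _) s.2.2)

theorem curvePrimitive_apply (f : C(I, X)) (s : I) :
    curvePrimitive X f s = ∫ r in (0 : ℝ)..s, extendCurve f r := rfl

@[simp] theorem curvePrimitive_zero_time (f : C(I, X)) : curvePrimitive X f 0 = 0 := by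
  simp [curvePrimitive_apply]

theorem hasDerivWithinAt_curvePrimitive [CompleteSpace X] (f : C(I, X)) {s : ℝ}
    (hs : s ∈ Icc (0 : ℝ) 1) :
    HasDerivWithinAt (extendCurve (curvePrimitive X f)) (extendCurve f s) (Icc 0 1) s := by
  have h := (intervalIntegral.integral_hasDerivAt_right
    ((continuous_extendCurve f).intervalIntegrable 0 s)
    (continuous_extendCurve f).stronglyMeasurable.stronglyMeasurableAtFilter
    (continuous_extendCurve f).continuousAt).hasDerivWithinAt (s := Icc 0 1)
  refine h.congr (fun r hr ↦ ?_) ?_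
  · rw [extendCurve_of_mem _ hr, curvePrimitive_apply]
  · rw [extendCurve_of_mem _ hs, curvePrimitive_apply]

theorem curvePrimitive_eq_of_hasDerivWithinAt [CompleteSpace X] {q : ℝ → X} {f : C(I, X)}
    (h : ∀ s ∈ Icc (0 : ℝ) 1, HasDerivWithinAt q (extendCurve f s) (Icc 0 1) s) (s : I) :
    curvePrimitive X f s = q s - q 0 := by
  rw [curvePrimitive_apply]
  have hcont : ContinuousOn q (Icc 0 s) := fun r hr ↦
    ((h r ⟨hr.1, hr.2.trans s.2.2⟩).continuousWithinAt).mono (Icc_subset_Icc_right s.2.2)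
  refine intervalIntegral.integral_eq_sub_of_hasDerivAt_of_le s.2.1 hcont (fun r hr ↦ ?_)
    ((continuous_extendCurve f).intervalIntegrable _ _)
  exact (h r ⟨hr.1.le, hr.2.le.trans s.2.2⟩).hasDerivAt
    (Icc_mem_nhds hr.1 (hr.2.trans_le s.2.2))

@[simp] theorem curvePrimitive_const [CompleteSpace X] (x : X) (s : I) :
    curvePrimitive X (ContinuousMap.const I x) s = (s : ℝ) • x := by
  simp [curvePrimitive_apply, extendCurve]

theorem curvePrimitive_clm {Y : Type*} [NormedAddCommGroup Y] [NormedSpace ℝ Y]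
    [CompleteSpace X] [CompleteSpace Y] (g : X →L[ℝ] Y) (f : C(I, X)) :
    curvePrimitive Y (g.compLeftContinuous ℝ I f)
      = g.compLeftContinuous ℝ I (curvePrimitive X f) := by
  ext s
  simp only [curvePrimitive_apply, ContinuousLinearMap.compLeftContinuous_apply]
  exact g.intervalIntegral_comp_comm ((continuous_extendCurve f).intervalIntegrable _ _)

end

variable {E F : Type*} [NormedAddCommGroup E] [NormedSpace ℝ E]
  [NormedAddCommGroup F] [NormedSpace ℝ F]

variable (X : Type*) [NormedAddCommGroup X] [NormedSpace ℝ X] in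
/-- The constant curves. -/
def constCurve : X →L[ℝ] C(I, X) :=
  LinearMap.mkContinuous
    { toFun := ContinuousMap.const I
      map_add' := fun _ _ ↦ rfl
      map_smul' := fun _ _ ↦ rfl } 1
    (fun x ↦ by rw [one_mul, ContinuousMap.norm_le _ (norm_nonneg _)]; exact fun _ ↦ le_rfl)

@[simp] theorem constCurve_apply {X : Type*} [NormedAddCommGroup X] [NormedSpace ℝ X]
    (x : X) (s : I) : constCurve X x s = x := rfl

variable (X : Type*) [NormedAddCommGroup X] [NormedSpace ℝ X] in
/-- Evaluation of curves at a time. -/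
def evalCurve (s : I) : C(I, X) →L[ℝ] X := ContinuousMap.evalCLM ℝ s

@[simp] theorem evalCurve_apply {X : Type*} [NormedAddCommGroup X] [NormedSpace ℝ X]
    (s : I) (f : C(I, X)) : evalCurve X s f = f s := rfl

variable (E F) in
/-- The curve `s ↦ (t, q(s), p(s))`. -/
def tripleCurve : ℝ × C(I, E) × C(I, F) →L[ℝ] C(I, ℝ × E × F) :=
  (ContinuousLinearMap.inl ℝ ℝ (E × F)).compLeftContinuous ℝ I ∘L constCurve ℝ ∘L .fst ℝ _ _
  + ((ContinuousLinearMap.inr ℝ ℝ (E × F)) ∘L .inl ℝ E F).compLeftContinuous ℝ I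
      ∘L .fst ℝ _ _ ∘L .snd ℝ ℝ (C(I, E) × C(I, F))
  + ((ContinuousLinearMap.inr ℝ ℝ (E × F)) ∘L .inr ℝ E F).compLeftContinuous ℝ I
      ∘L .snd ℝ _ _ ∘L .snd ℝ ℝ (C(I, E) × C(I, F))

@[simp] theorem tripleCurve_apply (z : ℝ × C(I, E) × C(I, F)) (s : I) :
    tripleCurve E F z s = (z.1, z.2.1 s, z.2.2 s) := by
  simp [tripleCurve]

/-- The map whose zeros `((t, x, y), (q, p))` are the solutions of `q' = A(t, q, p)`,
`p' = B(t, q, p)`, `q(0) = y`, `q(1) = x`. -/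
def boundaryValueMap (A : ℝ × E × F → E) (B : ℝ × E × F → F) (k : E →L[ℝ] F)
    (w : (ℝ × E × E) × C(I, E) × C(I, F)) : C(I, E) × C(I, F) :=
  (w.2.1 - constCurve E w.1.2.2
      - curvePrimitive E (superpos A (tripleCurve E F (w.1.1, w.2))),
    w.2.2 - constCurve F (evalCurve F 0 w.2.2)
      - curvePrimitive F (superpos B (tripleCurve E F (w.1.1, w.2)))
      + constCurve F (k (evalCurve E 1 w.2.1 - w.1.2.1)))

/-- The second component at time 0 is just `k (q 1 - x)`. Thus the free constant of the momentum
equation carries the end condition `q 1 = x`, and the target is the same space as the space of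
unknowns. -/
theorem boundaryValueMap_eq_zero_iff {A : ℝ × E × F → E} {B : ℝ × E × F → F} (k : E ≃L[ℝ] F)
    (t : ℝ) (x y : E) (q : C(I, E)) (p : C(I, F)) :
    boundaryValueMap A B (k : E →L[ℝ] F) ((t, x, y), (q, p)) = 0 ↔
      q 1 = x ∧ (∀ s, q s = y + curvePrimitive E (superpos A (tripleCurve E F (t, q, p))) s) ∧
        ∀ s, p s = p 0 + curvePrimitive F (superpos B (tripleCurve E F (t, q, p))) s := by
  simp only [boundaryValueMap, Prod.mk_eq_zero, ContinuousMap.ext_iff]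
  constructor
  · rintro ⟨h1, h2⟩
    have h3 : q 1 = x := by
      have := h2 0
      simp only [ContinuousMap.add_apply, ContinuousMap.sub_apply, constCurve_apply,
        evalCurve_apply, curvePrimitive_zero_time, sub_self, zero_add,
        ContinuousMap.zero_apply] at this
      have := (ContinuousLinearEquiv.map_eq_zero_iff k).1 this
      rwa [sub_eq_zero] at this
    refine ⟨h3, fun s ↦ ?_, fun s ↦ ?_⟩
    · have := h1 s
      simp only [ContinuousMap.sub_apply, constCurve_apply, ContinuousMap.zero_apply] at this
      rw [← sub_eq_zero, ← this]; abel
    · have := h2 s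
      simp only [ContinuousMap.sub_apply, constCurve_apply,
        evalCurve_apply, h3, sub_self, map_zero, add_zero, ContinuousMap.zero_apply] at this
      rw [← sub_eq_zero, ← this]; abel
  · rintro ⟨h3, h1, h2⟩
    refine ⟨fun s ↦ ?_, fun s ↦ ?_⟩
    · simp only [ContinuousMap.sub_apply, constCurve_apply, ContinuousMap.zero_apply]
      rw [h1 s]; abel
    · simp only [ContinuousMap.sub_apply, constCurve_apply,
        evalCurve_apply, h3, sub_self, map_zero, add_zero, ContinuousMap.zero_apply]
      nth_rewrite 1 [h2 s]; abel

section Smooth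

variable {A : ℝ × E × F → E} {B : ℝ × E × F → F} {D : Set (ℝ × E × F)}

/-- The pairs of parameters and curves on which the boundary value map is smooth. -/
def boundaryValueDomain (D : Set (ℝ × E × F)) : Set ((ℝ × E × E) × C(I, E) × C(I, F)) :=
  {w | ∀ s, tripleCurve E F (w.1.1, w.2) s ∈ D}

theorem isOpen_boundaryValueDomain (hD : IsOpen D) : IsOpen (boundaryValueDomain D) :=
  (isOpen_curves_mem hD).preimage (f := fun w : (ℝ × E × E) × C(I, E) × C(I, F) ↦
    tripleCurve E F (w.1.1, w.2)) (by fun_prop)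

theorem contDiffOn_superpos_tripleCurve {X : Type*} [NormedAddCommGroup X] [NormedSpace ℝ X]
    {f : ℝ × E × F → X} (hD : IsOpen D) (hf : ContDiffOn ℝ ∞ f D) :
    ContDiffOn ℝ ∞ (fun w : (ℝ × E × E) × C(I, E) × C(I, F) ↦
      superpos f (tripleCurve E F (w.1.1, w.2))) (boundaryValueDomain D) := by
  have h : ContDiff ℝ ∞ (fun w : (ℝ × E × E) × C(I, E) × C(I, F) ↦
    tripleCurve E F (w.1.1, w.2)) := by fun_prop
  exact (contDiffOn_superpos (K := I) hD hf).comp h.contDiffOn fun w hw ↦ hw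

theorem contDiffOn_boundaryValueMap (hD : IsOpen D) (hA : ContDiffOn ℝ ∞ A D)
    (hB : ContDiffOn ℝ ∞ B D) (k : E →L[ℝ] F) :
    ContDiffOn ℝ ∞ (boundaryValueMap A B k) (boundaryValueDomain D) := by
  have hA' := (curvePrimitive E).contDiff.comp_contDiffOn
    (contDiffOn_superpos_tripleCurve hD hA)
  have hB' := (curvePrimitive F).contDiff.comp_contDiffOn
    (contDiffOn_superpos_tripleCurve hD hB)
  refine ContDiffOn.prodMk (ContDiffOn.sub ?_ hA') (ContDiffOn.add (ContDiffOn.sub ?_ hB') ?_)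
  all_goals exact ContDiff.contDiffOn (by fun_prop)

theorem hasFDerivAt_superpos_tripleCurve {X : Type*} [NormedAddCommGroup X] [NormedSpace ℝ X]
    {f : ℝ × E × F → X} (hD : IsOpen D) (hf : ContDiffOn ℝ 1 f D)
    {w : ℝ × C(I, E) × C(I, F)} (hw : ∀ s, tripleCurve E F w s ∈ D) :
    HasFDerivAt (fun w ↦ superpos f (tripleCurve E F w))
      (curveApply I _ X (superpos (fderiv ℝ f) (tripleCurve E F w)) ∘L tripleCurve E F) w :=
  (hasFDerivAt_superpos hD hf hw).comp w (tripleCurve E F).hasFDerivAt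

/-- The linearization of the boundary value problem at a rest point. -/
def boundaryValueLinear (g : F ≃L[ℝ] E) : C(I, E) × C(I, F) →L[ℝ] C(I, E) × C(I, F) :=
  ContinuousLinearMap.prod
    (.fst ℝ _ _ - curvePrimitive E ∘L (g : F →L[ℝ] E).compLeftContinuous ℝ I ∘L .snd ℝ _ _)
    (.snd ℝ _ _ - constCurve F ∘L evalCurve F 0 ∘L .snd ℝ _ _
      + constCurve F ∘L (g.symm : E →L[ℝ] F) ∘L evalCurve E 1 ∘L .fst ℝ _ _)

theorem boundaryValueLinear_apply (g : F ≃L[ℝ] E) (Z : C(I, E) × C(I, F)) :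
    boundaryValueLinear g Z
      = (Z.1 - curvePrimitive E ((g : F →L[ℝ] E).compLeftContinuous ℝ I Z.2),
        Z.2 - constCurve F (Z.2 0) + constCurve F (g.symm (Z.1 1))) := rfl

/-- In the kernel, `p` is constant and `q 1 = 0`, while `q 1 = g (p 0)`; so `p` and then `q` vanish.
For surjectivity the equations are solved explicitly, and the open mapping theorem bounds the
inverse. -/
theorem isInvertible_boundaryValueLinear [CompleteSpace E] [CompleteSpace F] (g : F ≃L[ℝ] E) :
    (boundaryValueLinear g).IsInvertible := by
  have hinj : LinearMap.ker (boundaryValueLinear g).toLinearMap = ⊥ := by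
    rw [LinearMap.ker_eq_bot']
    rintro ⟨q, p⟩ h
    replace h : boundaryValueLinear g (q, p) = 0 := h
    rw [boundaryValueLinear_apply] at h
    obtain ⟨h1, h2⟩ := Prod.mk.inj h
    rw [curvePrimitive_clm] at h1
    have e1 : ∀ s, q s = g (curvePrimitive F p s) := fun s ↦ by
      have := DFunLike.congr_fun h1 s
      simpa [sub_eq_zero] using this
    have e2 : ∀ s, p s - p 0 + g.symm (q 1) = 0 := fun s ↦ by
      simpa using DFunLike.congr_fun h2 s
    have e3 : g.symm (q 1) = 0 := by simpa using e2 0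
    have e4 : p = ContinuousMap.const I (p 0) := by
      ext s
      have := e2 s
      rw [e3, add_zero, sub_eq_zero] at this
      simpa using this
    have e5 : p 0 = 0 := by
      have := e1 1
      rw [e4, curvePrimitive_const] at this
      have h0 : q 1 = 0 := by simpa using e3
      rw [h0] at this
      simpa using this.symm
    have e6 : p = 0 := by rw [e4, e5]; rfl
    refine Prod.ext ?_ e6
    ext s
    simp [e1 s, e6]
  have hsurj : LinearMap.range (boundaryValueLinear g).toLinearMap = ⊤ := by
    rw [LinearMap.range_eq_top]
    rintro ⟨a, b⟩
    -- `c` is the initial momentum. With `p = b - b 0 + c` and `q` the corresponding primitive plus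
    -- `a`, the second equation reduces to `g.symm (q 1) = b 0`, which is solved for `c`.
    set c : F := b 0 - g.symm (a 1) - curvePrimitive F b 1 + b 0 with hc
    refine ⟨(a + curvePrimitive E ((g : F →L[ℝ] E).compLeftContinuous ℝ I
        (b - constCurve F (b 0) + constCurve F c)),
      b - constCurve F (b 0) + constCurve F c), ?_⟩
    have hconst : ∀ x : F, constCurve F x = ContinuousMap.const I x := fun _ ↦ rfl
    change boundaryValueLinear g _ = _
    rw [curvePrimitive_clm, boundaryValueLinear_apply, curvePrimitive_clm]
    refine Prod.ext ?_ ?_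
    · ext s
      simp
    · ext s
      simp [hconst, hc]
  exact ⟨ContinuousLinearEquiv.ofBijective _ hinj hsurj,
    ContinuousLinearEquiv.coe_ofBijective _ hinj hsurj⟩

/-- Along a constant curve the derivative of `f` does not depend on the time, so the linearization
acts pointwise by one fixed linear map. -/
theorem hasFDerivAt_superpos_rest {X : Type*} [NormedAddCommGroup X] [NormedSpace ℝ X]
    {f : ℝ × E × F → X} (hD : IsOpen D) (hf : ContDiffOn ℝ ∞ f D) {u : E} (hu : (0, u, 0) ∈ D)
    {L : C(I, E) × C(I, F) →L[ℝ] C(I, X)}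
    (hL : ∀ Z s, L Z s = fderiv ℝ f (0, u, 0) (0, Z.1 s, Z.2 s)) :
    HasFDerivAt (fun Z : C(I, E) × C(I, F) ↦ superpos f (tripleCurve E F (0, Z))) L
      (constCurve E u, 0) := by
  have htriple : ∀ s, tripleCurve E F (0, constCurve E u, 0) s = (0, u, 0) := fun s ↦ by simp
  have hmem : ∀ s, tripleCurve E F (0, constCurve E u, 0) s ∈ D := fun s ↦ by
    rwa [htriple]
  refine ((hasFDerivAt_superpos_tripleCurve hD (hf.of_le (by simp)) hmem).comp
    (constCurve E u, (0 : C(I, F))) (hasFDerivAt_prodMk_right _ _)).congr_fderiv ?_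
  have cf : ContinuousOn (fderiv ℝ f) D := hf.continuousOn_fderiv_of_isOpen hD (by simp)
  refine ContinuousLinearMap.ext fun Z ↦ ContinuousMap.ext fun s ↦ ?_
  rw [hL]
  change superpos (fderiv ℝ f) (tripleCurve E F (0, constCurve E u, 0)) s
    (tripleCurve E F (0, Z) s) = _
  rw [superpos_apply_of_continuousOn cf hmem, htriple, tripleCurve_apply]

theorem hasFDerivAt_boundaryValueMap_rest
    (hD : IsOpen D) (hA : ContDiffOn ℝ ∞ A D) (hB : ContDiffOn ℝ ∞ B D) (g : F ≃L[ℝ] E) {u : E}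
    (hu : (0, u, 0) ∈ D)
    (hA' : ∀ v : E × F, fderiv ℝ A (0, u, 0) (0, v) = g v.2)
    (hB' : ∀ v : E × F, fderiv ℝ B (0, u, 0) (0, v) = 0) :
    HasFDerivAt (fun Z : C(I, E) × C(I, F) ↦
        boundaryValueMap A B (g.symm : E →L[ℝ] F) ((0, u, u), Z))
      (boundaryValueLinear g) (constCurve E u, 0) := by
  have dA := (curvePrimitive E).hasFDerivAt.comp (constCurve E u, 0)
    (hasFDerivAt_superpos_rest hD hA hu
      (L := (g : F →L[ℝ] E).compLeftContinuous ℝ I ∘L .snd ℝ _ _) fun Z s ↦ (hA' (Z.1 s, Z.2 s)).symm)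
  have dB := (curvePrimitive F).hasFDerivAt.comp (constCurve E u, 0)
    (hasFDerivAt_superpos_rest hD hB hu (L := 0) fun Z s ↦ (hB' (Z.1 s, Z.2 s)).symm)
  have d1 : HasFDerivAt (fun Z : C(I, E) × C(I, F) ↦ Z.1 - constCurve E u)
      (.fst ℝ _ _) (constCurve E u, 0) := hasFDerivAt_fst.sub_const _
  have d2 : HasFDerivAt (fun Z : C(I, E) × C(I, F) ↦ Z.2 - constCurve F (evalCurve F 0 Z.2))
      (.snd ℝ _ _ - constCurve F ∘L evalCurve F 0 ∘L .snd ℝ _ _) (constCurve E u, 0) :=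
    (ContinuousLinearMap.snd ℝ C(I, E) C(I, F)
      - constCurve F ∘L evalCurve F 0 ∘L .snd ℝ _ _).hasFDerivAt
  have d3 : HasFDerivAt (fun Z : C(I, E) × C(I, F) ↦
      constCurve F ((g.symm : E →L[ℝ] F) (evalCurve E 1 Z.1 - u)))
      (constCurve F ∘L (g.symm : E →L[ℝ] F) ∘L evalCurve E 1 ∘L .fst ℝ _ _)
      (constCurve E u, 0) :=
    ((constCurve F) ∘L (g.symm : E →L[ℝ] F)).hasFDerivAt.comp (constCurve E u, (0 : C(I, F)))
      (((evalCurve E 1 ∘L .fst ℝ _ (C(I, F))).hasFDerivAt).sub_const u)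
  refine ((d1.sub dA).prodMk ((d2.sub dB).add d3)).congr_fderiv ?_
  rw [ContinuousLinearMap.comp_zero, sub_zero]
  rfl

/-- Near a rest point with nondegenerate `∂A/∂p`, the boundary value problem has a unique small
solution, which depends smoothly on the data. -/
theorem exists_smooth_boundaryValue_solution [CompleteSpace E] [CompleteSpace F]
    (hD : IsOpen D) (hA : ContDiffOn ℝ ∞ A D) (hB : ContDiffOn ℝ ∞ B D) (g : F ≃L[ℝ] E) {u : E}
    (hu : (0, u, 0) ∈ D) (hA0 : A (0, u, 0) = 0) (hB0 : B (0, u, 0) = 0)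
    (hA' : ∀ v : E × F, fderiv ℝ A (0, u, 0) (0, v) = g v.2)
    (hB' : ∀ v : E × F, fderiv ℝ B (0, u, 0) (0, v) = 0) :
    ∃ ψ : ℝ × E × E → C(I, E) × C(I, F), ψ (0, u, u) = (constCurve E u, 0) ∧
      (∀ᶠ z in 𝓝 (0, u, u), ContDiffAt ℝ ∞ ψ z) ∧
      ∀ᶠ w in 𝓝 (((0, u, u), (constCurve E u, 0)) : (ℝ × E × E) × C(I, E) × C(I, F)),
        boundaryValueMap A B (g.symm : E →L[ℝ] F) w = 0 ↔ ψ w.1 = w.2 := by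
  set w₀ : (ℝ × E × E) × C(I, E) × C(I, F) := ((0, u, u), (constCurve E u, 0)) with hw₀
  have htriple : ∀ s, tripleCurve E F (0, constCurve E u, 0) s = (0, u, 0) := fun s ↦ by simp
  have hmem : ∀ s, tripleCurve E F (0, constCurve E u, 0) s ∈ D := fun s ↦ by
    rwa [htriple]
  have hw : w₀ ∈ boundaryValueDomain D := hmem
  have hcd := contDiffOn_boundaryValueMap hD hA hB (g.symm : E →L[ℝ] F)
  have hsA : superpos A (tripleCurve E F (0, constCurve E u, 0)) = 0 := by
    ext s
    rw [superpos_apply_of_continuousOn hA.continuousOn hmem, htriple, hA0]; rfl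
  have hsB : superpos B (tripleCurve E F (0, constCurve E u, 0)) = 0 := by
    ext s
    rw [superpos_apply_of_continuousOn hB.continuousOn hmem, htriple, hB0]; rfl
  have h0 : boundaryValueMap A B (g.symm : E →L[ℝ] F) w₀ = 0 := by
    simp [boundaryValueMap, hw₀, hsA, hsB]
  have hlin := hasFDerivAt_boundaryValueMap_rest hD hA hB g hu hA' hB'
  have hS := isOpen_boundaryValueDomain (E := E) (F := F) hD
  generalize boundaryValueMap A B (g.symm : E →L[ℝ] F) = f at hcd h0 hlin ⊢
  refine exists_smooth_implicitFunction hS hcd hw h0 ?_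
  have hd : HasFDerivAt f (fderiv ℝ f w₀) w₀ :=
    ((hcd.contDiffAt (hS.mem_nhds hw)).differentiableAt (by simp)).hasFDerivAt
  rw [(HasFDerivAt.comp (constCurve E u, (0 : C(I, F))) hd (hasFDerivAt_prodMk_right _ _)).unique
    hlin]
  exact isInvertible_boundaryValueLinear g

end Smooth

end BoundaryValue

end

noncomputable section

set_option linter.unusedSectionVars false

/-! ### The action in coordinates and the first variation formula. -/

section CoordinateAction

open Filter Topology unitInterval

variable {E F : Type*} [NormedAddCommGroup E] [NormedSpace ℝ E]
  [NormedAddCommGroup F] [NormedSpace ℝ F]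

theorem hasDerivWithinAt_of_eq_primitive {X : Type*} [NormedAddCommGroup X] [NormedSpace ℝ X]
    [CompleteSpace X] {q f : C(I, X)} {y : X} (h : ∀ s, q s = y + curvePrimitive X f s) {s : ℝ}
    (hs : s ∈ Icc (0 : ℝ) 1) :
    HasDerivWithinAt (extendCurve q) (extendCurve f s) (Icc 0 1) s :=
  ((hasDerivWithinAt_curvePrimitive f hs).const_add y).congr_of_eventuallyEq
    (.of_forall fun _ ↦ h _) (h _)

theorem extendCurve_superpos {X : Type*} [NormedAddCommGroup X] [NormedSpace ℝ X]
    {A : ℝ × E × F → X} {D : Set (ℝ × E × F)} (hA : ContinuousOn A D)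
    {t : ℝ} {Z : C(I, E) × C(I, F)} (hZ : ∀ s, tripleCurve E F (t, Z) s ∈ D) (s : ℝ) :
    extendCurve (superpos A (tripleCurve E F (t, Z))) s
      = A (t, extendCurve Z.1 s, extendCurve Z.2 s) := by
  simp only [extendCurve, superpos_apply_of_continuousOn hA hZ, tripleCurve_apply]

/-- The restriction to `[0, 1]` of a function that is continuous there. -/
def restrictCurve {X : Type*} [TopologicalSpace X] (Q : ℝ → X) (hQ : ContinuousOn Q (Icc 0 1)) :
    C(I, X) := ⟨fun s ↦ Q s, continuousOn_iff_continuous_domRestrict.1 hQ⟩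

theorem extendCurve_restrictCurve {X : Type*} [TopologicalSpace X] {Q : ℝ → X}
    (hQ : ContinuousOn Q (Icc 0 1)) {s : ℝ} (hs : s ∈ Icc (0 : ℝ) 1) :
    extendCurve (restrictCurve Q hQ) s = Q s := by
  rw [extendCurve_of_mem _ hs]; rfl

/-- Solutions of the differential equations are zeros of the boundary value map. -/
theorem boundaryValueMap_restrictCurve [CompleteSpace E] [CompleteSpace F]
    {A : ℝ × E × F → E} {B : ℝ × E × F → F} {D : Set (ℝ × E × F)}
    (hA : ContinuousOn A D) (hB : ContinuousOn B D) (k : E ≃L[ℝ] F) {t : ℝ} {Q : ℝ → E}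
    {P : ℝ → F} (hQ : ContinuousOn Q (Icc 0 1)) (hP : ContinuousOn P (Icc 0 1))
    (hD : ∀ s ∈ Icc (0 : ℝ) 1, (t, Q s, P s) ∈ D)
    (hQ' : ∀ s ∈ Icc (0 : ℝ) 1, HasDerivWithinAt Q (A (t, Q s, P s)) (Icc 0 1) s)
    (hP' : ∀ s ∈ Icc (0 : ℝ) 1, HasDerivWithinAt P (B (t, Q s, P s)) (Icc 0 1) s) :
    boundaryValueMap A B (k : E →L[ℝ] F)
      ((t, Q 1, Q 0), (restrictCurve Q hQ, restrictCurve P hP)) = 0 := by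
  rw [boundaryValueMap_eq_zero_iff]
  have hZ : ∀ s, tripleCurve E F (t, restrictCurve Q hQ, restrictCurve P hP) s ∈ D := fun s ↦ by
    rw [tripleCurve_apply]; exact hD s s.2
  refine ⟨rfl, fun s ↦ ?_, fun s ↦ ?_⟩
  · rw [curvePrimitive_eq_of_hasDerivWithinAt (q := Q) fun r hr ↦ ?_]
    · exact (add_sub_cancel _ _).symm
    · simp only [extendCurve, superpos_apply_of_continuousOn hA hZ, tripleCurve_apply]
      rw [projIcc_of_mem zero_le_one hr]
      exact hQ' r hr
  · rw [curvePrimitive_eq_of_hasDerivWithinAt (q := P) fun r hr ↦ ?_]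
    · exact (add_sub_cancel _ _).symm
    · simp only [extendCurve, superpos_apply_of_continuousOn hB hZ, tripleCurve_apply]
      rw [projIcc_of_mem zero_le_one hr]
      exact hP' r hr

/-- The integral over `[0, 1]` of a function along a curve `s ↦ (t, q(s), p(s))`. -/
def curveAction (L : ℝ × E × F → ℝ) (w : ℝ × C(I, E) × C(I, F)) : ℝ :=
  evalCurve ℝ 1 (curvePrimitive ℝ (superpos L (tripleCurve E F w)))

theorem curveAction_eq_integral {L : ℝ × E × F → ℝ} {D : Set (ℝ × E × F)}
    (hL : ContinuousOn L D) {t : ℝ} {Z : C(I, E) × C(I, F)}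
    (hZ : ∀ s, tripleCurve E F (t, Z) s ∈ D) :
    curveAction L (t, Z) = ∫ s in (0 : ℝ)..1, L (t, extendCurve Z.1 s, extendCurve Z.2 s) := by
  simp only [curveAction, evalCurve_apply, curvePrimitive_apply, extendCurve,
    superpos_apply_of_continuousOn hL hZ, tripleCurve_apply]
  rfl

theorem contDiffOn_curveAction {L : ℝ × E × F → ℝ} {D : Set (ℝ × E × F)} (hD : IsOpen D)
    (hL : ContDiffOn ℝ ∞ L D) :
    ContDiffOn ℝ ∞ (curveAction L) {w | ∀ s, tripleCurve E F w s ∈ D} :=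
  (evalCurve ℝ 1 ∘L curvePrimitive ℝ).contDiff.comp_contDiffOn
    ((contDiffOn_superpos (K := I) hD hL).comp (tripleCurve E F).contDiff.contDiffOn
      fun _ hw ↦ hw)

theorem hasFDerivAt_superpos_family {X P : Type*} [NormedAddCommGroup X] [NormedSpace ℝ X]
    [NormedAddCommGroup P] [NormedSpace ℝ P] {f : ℝ × E × F → X} {D : Set (ℝ × E × F)}
    (hD : IsOpen D) (hf : ContDiffOn ℝ 1 f D) {t : ℝ} {ψ : P → C(I, E) × C(I, F)}
    {ψ' : P →L[ℝ] C(I, E) × C(I, F)} {v : P} (hψ : HasFDerivAt ψ ψ' v)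
    (hmem : ∀ s, tripleCurve E F (t, ψ v) s ∈ D) :
    ∃ f' : P →L[ℝ] C(I, X),
      HasFDerivAt (fun v ↦ superpos f (tripleCurve E F (t, ψ v))) f' v ∧
      ∀ δ s, f' δ s = fderiv ℝ f (t, (ψ v).1 s, (ψ v).2 s) (0, (ψ' δ).1 s, (ψ' δ).2 s) := by
  have h1 : HasFDerivAt (fun v ↦ (t, ψ v)) ((0 : P →L[ℝ] ℝ).prod ψ') v :=
    (hasFDerivAt_const t v).prodMk hψ
  have h2 := hasFDerivAt_superpos_tripleCurve hD hf hmem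
  refine ⟨_, HasFDerivAt.comp (f := fun v ↦ (t, ψ v)) v h2 h1, fun δ s ↦ ?_⟩
  have cf : ContinuousOn (fderiv ℝ f) D := hf.continuousOn_fderiv_of_isOpen hD (by simp)
  change superpos (fderiv ℝ f) (tripleCurve E F (t, ψ v)) s
    (tripleCurve E F (0, ψ' δ) s) = _
  rw [superpos_apply_of_continuousOn cf hmem, tripleCurve_apply, tripleCurve_apply]

theorem hasFDerivAt_curve_fst {P : Type*} [NormedAddCommGroup P] [NormedSpace ℝ P]
    {ψ : P → C(I, E) × C(I, F)} {ψ' : P →L[ℝ] C(I, E) × C(I, F)} {v : P}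
    (hψ : HasFDerivAt ψ ψ' v) :
    HasFDerivAt (fun v ↦ (ψ v).1) ((ContinuousLinearMap.fst ℝ C(I, E) C(I, F)) ∘L ψ') v :=
  hψ.fst

/-- The first variation formula: the derivative of the action of the solution of Hamilton's
equations with respect to its end points is given by the momenta at the end points. -/
theorem hasFDerivAt_curveAction [CompleteSpace E] {h : ℝ × E × (E →L[ℝ] ℝ) → ℝ}
    {A : ℝ × E × (E →L[ℝ] ℝ) → E}
    {B : ℝ × E × (E →L[ℝ] ℝ) → E →L[ℝ] ℝ} {D : Set (ℝ × E × (E →L[ℝ] ℝ))} (hD : IsOpen D)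
    (hA : ContDiffOn ℝ ∞ A D) (hB : ContDiffOn ℝ ∞ B D) (hh : ContDiffOn ℝ ∞ h D)
    (hh' : ∀ z ∈ D, ∀ a β, fderiv ℝ h z (0, a, β) = β (A z) - B z a) (k : E ≃L[ℝ] (E →L[ℝ] ℝ))
    {t : ℝ} {ψ : E × E → C(I, E) × C(I, E →L[ℝ] ℝ)} {v : E × E} (hψ : DifferentiableAt ℝ ψ v)
    (hmem : ∀ s, tripleCurve E _ (t, ψ v) s ∈ D)
    (hsol : ∀ᶠ v' in 𝓝 v,
      boundaryValueMap A B (k : E →L[ℝ] E →L[ℝ] ℝ) ((t, v'.1, v'.2), ψ v') = 0) :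
    HasFDerivAt (fun v' ↦ curveAction (fun z : ℝ × E × (E →L[ℝ] ℝ) ↦ z.2.2 (A z) - h z) (t, ψ v'))
      (((ψ v).2 1).comp (.fst ℝ E E) - ((ψ v).2 0).comp (.snd ℝ E E)) v := by
  set L : ℝ × E × (E →L[ℝ] ℝ) → ℝ := fun z ↦ z.2.2 (A z) - h z with hLdef
  have hL : ContDiffOn ℝ ∞ L D := by
    refine ContDiffOn.sub (ContDiffOn.clm_apply ?_ hA) hh
    exact (contDiff_snd.comp contDiff_snd).contDiffOn
  obtain ⟨ψ', hψ'⟩ := hψ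
  obtain ⟨A', hA', hA'e⟩ := hasFDerivAt_superpos_family hD (hA.of_le (by simp)) hψ' hmem
  obtain ⟨L', hL', hL'e⟩ := hasFDerivAt_superpos_family hD (hL.of_le (by simp)) hψ' hmem
  have hsol' := hsol.mono fun v' hv' ↦ (boundaryValueMap_eq_zero_iff k t v'.1 v'.2 _ _).1 hv'
  have e1 : ∀ δ, (ψ' δ).1 1 = δ.1 := by
    have a1 := (evalCurve E 1).hasFDerivAt.comp v (hasFDerivAt_curve_fst hψ')
    have a2 : HasFDerivAt (fun v' ↦ evalCurve E 1 (ψ v').1) (.fst ℝ E E) v :=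
      hasFDerivAt_fst.congr_of_eventuallyEq (hsol'.mono fun v' hv' ↦ hv'.1)
    exact fun δ ↦ DFunLike.congr_fun (a1.unique a2) δ
  -- Differentiating the integral equation for `q` in the end points gives the equation satisfied by
  -- the variation of `q`.
  have e2 : ∀ δ, (ψ' δ).1 = constCurve E δ.2 + curvePrimitive E (A' δ) := by
    have a1 := hasFDerivAt_curve_fst hψ'
    have a2 : HasFDerivAt (fun v' ↦ (ψ v').1)
        (constCurve E ∘L .snd ℝ E E + curvePrimitive E ∘L A') v := by
      refine ((constCurve E ∘L .snd ℝ E E).hasFDerivAt.add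
        ((curvePrimitive E).hasFDerivAt.comp v hA')).congr_of_eventuallyEq ?_
      filter_upwards [hsol'] with v' hv'
      ext s
      exact hv'.2.1 s
    exact fun δ ↦ DFunLike.congr_fun (a1.unique a2) δ
  have hact : HasFDerivAt (fun v' ↦ curveAction L (t, ψ v'))
      (evalCurve ℝ 1 ∘L curvePrimitive ℝ ∘L L') v :=
    (evalCurve ℝ 1 ∘L curvePrimitive ℝ).hasFDerivAt.comp v hL'
  refine hact.congr_fderiv (ContinuousLinearMap.ext fun δ ↦ ?_)
  -- For `L = p·A - h`, the term `δp·A` cancels against the momentum part of `dh`, by Hamilton's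
  -- equations `hh'`. The variation of `p` drops out.
  have hLd : ∀ s, L' δ s = (ψ v).2 s (A' δ s)
      + B (t, (ψ v).1 s, (ψ v).2 s) ((ψ' δ).1 s) := fun s ↦ by
    have hz : (t, (ψ v).1 s, (ψ v).2 s) ∈ D := by simpa using hmem s
    rw [hL'e, hA'e]
    set z : ℝ × E × (E →L[ℝ] ℝ) := (t, (ψ v).1 s, (ψ v).2 s)
    have dA : HasFDerivAt A (fderiv ℝ A z) z :=
      ((hA.contDiffAt (hD.mem_nhds hz)).differentiableAt (by simp)).hasFDerivAt
    have dh : HasFDerivAt h (fderiv ℝ h z) z :=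
      ((hh.contDiffAt (hD.mem_nhds hz)).differentiableAt (by simp)).hasFDerivAt
    have d2 : HasFDerivAt (fun z : ℝ × E × (E →L[ℝ] ℝ) ↦ z.2.2) (.snd ℝ _ _ ∘L .snd ℝ _ _) z :=
      (ContinuousLinearMap.snd ℝ E (E →L[ℝ] ℝ) ∘L .snd ℝ ℝ _).hasFDerivAt
    have dL : HasFDerivAt L _ z := (d2.clm_apply dA).sub dh
    rw [dL.fderiv]
    simp only [sub_apply, add_apply,
      ContinuousLinearMap.comp_apply, ContinuousLinearMap.flip_apply,
      ContinuousLinearMap.coe_snd', hh' z hz]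
    ring
  have hq0 : (ψ' δ).1 0 = δ.2 := by rw [e2]; simp
  obtain ⟨-, -, hp⟩ := hsol'.self_of_nhds
  -- As `p' = B` and the variation of `q` has derivative `A' δ`, the varied integrand is the total
  -- derivative of the pairing of `p` with the variation of `q`. Only boundary terms survive.
  have hder : ∀ s ∈ Icc (0 : ℝ) 1, HasDerivWithinAt
      (fun s ↦ extendCurve (ψ v).2 s (extendCurve (ψ' δ).1 s)) (extendCurve (L' δ) s)
      (Icc 0 1) s := fun s hs ↦ by
    have b1 := hasDerivWithinAt_of_eq_primitive hp hs
    have b2 := hasDerivWithinAt_of_eq_primitive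
      (fun s ↦ DFunLike.congr_fun (e2 δ) s) hs
    refine (b1.clm_apply b2).congr_deriv ?_
    have : extendCurve (superpos B (tripleCurve E (E →L[ℝ] ℝ) (t, ψ v))) s
        = B (t, extendCurve (ψ v).1 s, extendCurve (ψ v).2 s) := by
      simp only [extendCurve, superpos_apply_of_continuousOn hB.continuousOn hmem,
        tripleCurve_apply]
    change extendCurve (superpos B (tripleCurve E (E →L[ℝ] ℝ) (t, ψ v))) s _ + _ = _
    rw [this, add_comm]
    exact (hLd _).symm
  have := curvePrimitive_eq_of_hasDerivWithinAt hder 1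
  change curvePrimitive ℝ (L' δ) 1 = (ψ v).2 1 δ.1 - (ψ v).2 0 δ.2
  rw [this, ← e1, ← hq0]
  simp [extendCurve]

end CoordinateAction

end

noncomputable section

set_option linter.unusedSectionVars false

/-! ### Canonical coordinates on the cotangent bundle and the metric in them. -/

section CotangentCoordinates

open Filter Topology

variable {E : Type*} [NormedAddCommGroup E] [NormedSpace ℝ E]
  {M : Type*} [TopologicalSpace M] [ChartedSpace E M] [IsManifold 𝓘(ℝ, E) ∞ M]

theorem continuousLinearMapAt_tangent_symmL {c x : M} (hx : x ∈ (chartAt E c).source) (a : E) :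
    (trivializationAt E (TangentSpace 𝓘(ℝ, E)) c).continuousLinearMapAt ℝ x
      ((trivializationAt E (TangentSpace 𝓘(ℝ, E)) c).symmL ℝ x a) = a :=
  Trivialization.continuousLinearMapAt_symmL _ hx a

theorem tangent_symmL_continuousLinearMapAt {c x : M} (hx : x ∈ (chartAt E c).source)
    (v : TangentSpace 𝓘(ℝ, E) x) :
    (trivializationAt E (TangentSpace 𝓘(ℝ, E)) c).symmL ℝ x
      ((trivializationAt E (TangentSpace 𝓘(ℝ, E)) c).continuousLinearMapAt ℝ x v) = v :=
  Trivialization.symmL_continuousLinearMapAt _ hx v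

theorem posCoord_ofCoord {c : M} {u : E} (hu : u ∈ (extChartAt 𝓘(ℝ, E) c).target)
    (α : E →L[ℝ] ℝ) : posCoord c (ofCoord c u α) = u :=
  (extChartAt 𝓘(ℝ, E) c).right_inv hu

theorem symm_mem_chart_source {c : M} {u : E} (hu : u ∈ (extChartAt 𝓘(ℝ, E) c).target) :
    (extChartAt 𝓘(ℝ, E) c).symm u ∈ (chartAt E c).source := by
  rw [← extChartAt_source 𝓘(ℝ, E)]
  exact (extChartAt 𝓘(ℝ, E) c).map_target hu

theorem extChartAt_symm_apply {c x : M} (hx : x ∈ (chartAt E c).source) :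
    (extChartAt 𝓘(ℝ, E) c).symm (extChartAt 𝓘(ℝ, E) c x) = x :=
  (extChartAt 𝓘(ℝ, E) c).left_inv (by rwa [extChartAt_source])

theorem extChartAt_mem_target {c x : M} (hx : x ∈ (chartAt E c).source) :
    extChartAt 𝓘(ℝ, E) c x ∈ (extChartAt 𝓘(ℝ, E) c).target :=
  (extChartAt 𝓘(ℝ, E) c).map_source (by rwa [extChartAt_source])

theorem momCoord_ofCoord {c : M} {u : E} (hu : u ∈ (extChartAt 𝓘(ℝ, E) c).target)
    (α : E →L[ℝ] ℝ) : momCoord c (ofCoord c u α) = α := by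
  ext a
  exact congrArg α (continuousLinearMapAt_tangent_symmL (symm_mem_chart_source hu) a)

/-- All tangent spaces are copies of the model space `E`, so covectors at points only
propositionally equal can be compared on vectors of `E`. -/
theorem cotangent_ext {x y : M} {ξ : TangentSpace 𝓘(ℝ, E) x →L[ℝ] ℝ}
    {η : TangentSpace 𝓘(ℝ, E) y →L[ℝ] ℝ} (h : x = y) (h' : ∀ v : E, ξ v = η v) :
    (⟨x, ξ⟩ : CotangentBundle E M) = ⟨y, η⟩ := by
  subst h
  exact congrArg _ (ContinuousLinearMap.ext h')

theorem ofCoord_coords {c : M} {z : CotangentBundle E M} (hz : z.proj ∈ (chartAt E c).source) :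
    ofCoord c (posCoord c z) (momCoord c z) = z := by
  obtain ⟨x, ξ⟩ := z
  have hx : (extChartAt 𝓘(ℝ, E) c).symm (extChartAt 𝓘(ℝ, E) c x) = x := extChartAt_symm_apply hz
  refine cotangent_ext hx fun v ↦ ?_
  change ξ ((trivializationAt E (TangentSpace 𝓘(ℝ, E)) c).symmL ℝ x
    ((trivializationAt E (TangentSpace 𝓘(ℝ, E)) c).continuousLinearMapAt ℝ
      ((extChartAt 𝓘(ℝ, E) c).symm (extChartAt 𝓘(ℝ, E) c x)) v)) = ξ v
  rw [hx]
  exact congrArg ξ (tangent_symmL_continuousLinearMapAt hz v)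

theorem posCoord_mem_target {c : M} {z : CotangentBundle E M}
    (hz : z.proj ∈ (chartAt E c).source) : posCoord c z ∈ (extChartAt 𝓘(ℝ, E) c).target :=
  extChartAt_mem_target hz

theorem coords_injOn {c : M} {z z' : CotangentBundle E M} (hz : z.proj ∈ (chartAt E c).source)
    (hz' : z'.proj ∈ (chartAt E c).source) (h : posCoord c z = posCoord c z')
    (h' : momCoord c z = momCoord c z') : z = z' := by
  rw [← ofCoord_coords hz, ← ofCoord_coords hz', h, h']

theorem contMDiffOn_tangent_symmL (c : M) (a : E) :
    ContMDiffOn 𝓘(ℝ, E) (𝓘(ℝ, E).prod 𝓘(ℝ, E)) ∞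
      (fun x ↦ (⟨x, (trivializationAt E (TangentSpace 𝓘(ℝ, E)) c).symmL ℝ x a⟩ :
        TangentBundle 𝓘(ℝ, E) M)) (chartAt E c).source := by
  have h := (trivializationAt E (TangentSpace 𝓘(ℝ, E) : M → Type _) c).contMDiffOn_symm
    (IB := 𝓘(ℝ, E)) (n := ∞)
  have h2 : ContMDiff 𝓘(ℝ, E) (𝓘(ℝ, E).prod 𝓘(ℝ, E)) ∞ (fun x : M ↦ (x, a)) :=
    contMDiff_id.prodMk contMDiff_const
  refine (h.comp h2.contMDiffOn (s := (chartAt E c).source) ?_).congr ?_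
  · intro x hx
    rw [mem_preimage, Trivialization.mem_target]
    exact hx
  · intro x hx
    rw [Trivialization.symmL_apply _ hx]
    exact (trivializationAt E (TangentSpace 𝓘(ℝ, E) : M → Type _) c).mk_symm hx a

variable [RiemannianBundle (fun x : M ↦ TangentSpace 𝓘(ℝ, E) x)]

variable (E) in
/-- The Riemannian inner product at `x`, in the coordinates of the chart at `c`. -/
def metricAt (c x : M) : E →L[ℝ] E →L[ℝ] ℝ :=
  (innerSL ℝ (E := TangentSpace 𝓘(ℝ, E) x)).bilinearComp
    ((trivializationAt E (TangentSpace 𝓘(ℝ, E)) c).symmL ℝ x)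
    ((trivializationAt E (TangentSpace 𝓘(ℝ, E)) c).symmL ℝ x)

theorem metricAt_apply (c x : M) (a b : E) : metricAt E c x a b =
   inner ℝ ((trivializationAt E (TangentSpace 𝓘(ℝ, E)) c).symmL ℝ x a)
     ((trivializationAt E (TangentSpace 𝓘(ℝ, E)) c).symmL ℝ x b) := rfl

theorem norm_eq_of_eq_inner {x : M} {ξ : TangentSpace 𝓘(ℝ, E) x →L[ℝ] ℝ}
    {v : TangentSpace 𝓘(ℝ, E) x} (h : ∀ w, ξ w = inner ℝ v w) : ‖ξ‖ = ‖v‖ := by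
  have : ξ = innerSL ℝ v := by ext w; exact h w
  rw [this, innerSL_apply_norm]

theorem metricAt_comm (c x : M) (a b : E) : metricAt E c x a b = metricAt E c x b a := by
  rw [metricAt_apply, metricAt_apply, real_inner_comm]

theorem metricAt_injective {c x : M} (hx : x ∈ (chartAt E c).source) :
    Function.Injective (metricAt E c x) := by
  rw [injective_iff_map_eq_zero]
  intro a ha
  have h0 : metricAt E c x a a = 0 := by rw [ha]; rfl
  rw [metricAt_apply, inner_self_eq_zero] at h0
  rw [← continuousLinearMapAt_tangent_symmL hx a, h0, map_zero]

variable [FiniteDimensional ℝ E]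

/-- Positive definiteness gives injectivity, and a space and its dual have the same finite
dimension. -/
theorem metricAt_isInvertible {c x : M} (hx : x ∈ (chartAt E c).source) :
    (metricAt E c x).IsInvertible := by
  have hinj : Function.Injective (metricAt E c x : E →ₗ[ℝ] E →L[ℝ] ℝ) := metricAt_injective hx
  have hfin : Module.finrank ℝ E = Module.finrank ℝ (E →L[ℝ] ℝ) := by
    rw [← (LinearMap.toContinuousLinearMap (𝕜 := ℝ) (E := E) (F' := ℝ)).finrank_eq]
    exact (Subspace.dual_finrank_eq (K := ℝ) (V := E)).symm
  refine ⟨(LinearEquiv.ofInjectiveOfFinrankEq _ hinj hfin).toContinuousLinearEquiv, ?_⟩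
  ext a b
  rfl

/-- The inverse of the Riemannian metric in coordinates: the vector dual to a form. -/
def sharpCoord (c : M) (u : E) : (E →L[ℝ] ℝ) →L[ℝ] E :=
  (metricAt E c ((extChartAt 𝓘(ℝ, E) c).symm u)).inverse

theorem metricAt_sharpCoord {c : M} {u : E} (hu : u ∈ (extChartAt 𝓘(ℝ, E) c).target)
    (α : E →L[ℝ] ℝ) : metricAt E c ((extChartAt 𝓘(ℝ, E) c).symm u) (sharpCoord c u α) = α :=
  (metricAt_isInvertible (symm_mem_chart_source hu)).self_apply_inverse _

theorem sharpCoord_comm {c : M} {u : E} (hu : u ∈ (extChartAt 𝓘(ℝ, E) c).target)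
    (α β : E →L[ℝ] ℝ) : α (sharpCoord c u β) = β (sharpCoord c u α) := by
  conv_lhs => rw [← metricAt_sharpCoord hu α]
  conv_rhs => rw [← metricAt_sharpCoord hu β]
  rw [metricAt_comm]

theorem sharpCoord_isInvertible {c : M} {u : E} (hu : u ∈ (extChartAt 𝓘(ℝ, E) c).target) :
    (sharpCoord c u).IsInvertible :=
  (metricAt_isInvertible (symm_mem_chart_source hu)).inverse

theorem eq_inner_symmL_sharpCoord {c : M} {z : CotangentBundle E M}
    (hz : z.proj ∈ (chartAt E c).source) (w : TangentSpace 𝓘(ℝ, E) z.proj) :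
    z.2 w = inner ℝ ((trivializationAt E (TangentSpace 𝓘(ℝ, E)) c).symmL ℝ z.proj
      (sharpCoord c (posCoord c z) (momCoord c z))) w := by
  have h := DFunLike.congr_fun (metricAt_sharpCoord (posCoord_mem_target hz) (momCoord c z))
    ((trivializationAt E (TangentSpace 𝓘(ℝ, E)) c).continuousLinearMapAt ℝ z.proj w)
  rw [posCoord, extChartAt_symm_apply hz, metricAt_apply,
    tangent_symmL_continuousLinearMapAt hz] at h
  refine Eq.trans ?_ h.symm
  exact congrArg z.2 (tangent_symmL_continuousLinearMapAt hz w).symm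

theorem norm_symmL_sharpCoord {c : M} {z : CotangentBundle E M}
    (hz : z.proj ∈ (chartAt E c).source) :
    ‖(trivializationAt E (TangentSpace 𝓘(ℝ, E)) c).symmL ℝ z.proj
      (sharpCoord c (posCoord c z) (momCoord c z))‖ = ‖z.2‖ :=
  (norm_eq_of_eq_inner (eq_inner_symmL_sharpCoord hz)).symm

/-- By Riesz representation the squared dual norm is a quadratic form in the momentum coordinates.
This is what makes the Hamiltonian smooth in coordinates. -/
theorem norm_sq_eq_sharpCoord {c : M} {z : CotangentBundle E M}
    (hz : z.proj ∈ (chartAt E c).source) :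
    ‖z.2‖ ^ 2 = momCoord c z (sharpCoord c (posCoord c z) (momCoord c z)) := by
  rw [← norm_symmL_sharpCoord hz, ← real_inner_self_eq_norm_sq, ← eq_inner_symmL_sharpCoord hz]
  rfl

section Smooth

variable [IsContMDiffRiemannianBundle 𝓘(ℝ, E) ∞ E (fun x : M ↦ TangentSpace 𝓘(ℝ, E) x)]

theorem contMDiffOn_metricAt_apply (c : M) (a b : E) :
    ContMDiffOn 𝓘(ℝ, E) 𝓘(ℝ, ℝ) ∞ (fun x : M ↦ metricAt E c x a b) (chartAt E c).source :=
  ContMDiffOn.inner_bundle (E := fun x : M ↦ TangentSpace 𝓘(ℝ, E) x) (F := E) (b := fun x ↦ x)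
    (v := fun x ↦ (trivializationAt E (TangentSpace 𝓘(ℝ, E)) c).symmL ℝ x a)
    (w := fun x ↦ (trivializationAt E (TangentSpace 𝓘(ℝ, E)) c).symmL ℝ x b)
    (contMDiffOn_tangent_symmL c a) (contMDiffOn_tangent_symmL c b)

theorem contDiffOn_comp_extChartAt_symm {c : M} {f : M → ℝ}
    (hf : ContMDiffOn 𝓘(ℝ, E) 𝓘(ℝ, ℝ) ∞ f (chartAt E c).source) :
    ContDiffOn ℝ ∞ (f ∘ (extChartAt 𝓘(ℝ, E) c).symm) (extChartAt 𝓘(ℝ, E) c).target :=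
  (hf.comp (contMDiffOn_extChartAt_symm c) fun _ hu ↦ symm_mem_chart_source hu).contDiffOn

/-- The metric coefficients are inner products of smooth coordinate frame fields, and inversion of
operators is smooth. -/
theorem contDiffOn_sharpCoord (c : M) :
    ContDiffOn ℝ ∞ (sharpCoord c : E → (E →L[ℝ] ℝ) →L[ℝ] E) (extChartAt 𝓘(ℝ, E) c).target := by
  have h : ContDiffOn ℝ ∞ (fun u ↦ metricAt E c ((extChartAt 𝓘(ℝ, E) c).symm u))
      (extChartAt 𝓘(ℝ, E) c).target := by
    rw [contDiffOn_clm_apply]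
    intro a
    rw [contDiffOn_clm_apply]
    intro b
    exact contDiffOn_comp_extChartAt_symm (contMDiffOn_metricAt_apply c a b)
  intro u hu
  exact ((metricAt_isInvertible (symm_mem_chart_source hu)).contDiffAt_map_inverse).comp_contDiffWithinAt
    u (h u hu)

end Smooth

end CotangentCoordinates

end

noncomputable section

set_option linter.unusedSectionVars false

/-! ### The Hamiltonian and its vector field in canonical coordinates. -/

section CoordinateHamiltonian

open Filter Topology

theorem hasFDerivAt_clm_apply_param {X Y : Type*} [NormedAddCommGroup X] [NormedSpace ℝ X]
    [NormedAddCommGroup Y] [NormedSpace ℝ Y] {K : X → Y →L[ℝ] X} {u : X} {K' : X →L[ℝ] Y →L[ℝ] X}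
    (hK : HasFDerivAt K K' u) :
    HasFDerivAt (fun z : ℝ × X × Y ↦ K z.2.1 z.2.2) (K u ∘L .snd ℝ X Y ∘L .snd ℝ ℝ (X × Y))
      (0, u, 0) := by
  have h1 : HasFDerivAt (fun z : ℝ × X × Y ↦ z.2.1) (.fst ℝ _ _ ∘L .snd ℝ _ _)
      (0, u, 0) := (ContinuousLinearMap.fst ℝ X Y ∘L .snd ℝ ℝ _).hasFDerivAt
  have h2 : HasFDerivAt (fun z : ℝ × X × Y ↦ z.2.2) (.snd ℝ _ _ ∘L .snd ℝ _ _)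
      (0, u, 0) := (ContinuousLinearMap.snd ℝ X Y ∘L .snd ℝ ℝ _).hasFDerivAt
  have h3 : HasFDerivAt (fun z : ℝ × X × Y ↦ K z.2.1)
      (K' ∘L (.fst ℝ _ _ ∘L .snd ℝ _ _)) (0, u, 0) :=
    HasFDerivAt.comp (f := fun z : ℝ × X × Y ↦ z.2.1) (0, u, 0) hK h1
  refine (h3.clm_apply h2).congr_fderiv (ContinuousLinearMap.ext fun v ↦ ?_)
  simp

variable {E : Type*} [NormedAddCommGroup E] [NormedSpace ℝ E] [FiniteDimensional ℝ E]
  {M : Type*} [TopologicalSpace M] [ChartedSpace E M] [IsManifold 𝓘(ℝ, E) ∞ M]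
  [RiemannianBundle (fun x : M ↦ TangentSpace 𝓘(ℝ, E) x)]

variable (E) in
/-- The domain of the canonical coordinates over the chart at `c`, with the parameter `t`. -/
def coordDomain (c : M) : Set (ℝ × E × (E →L[ℝ] ℝ)) :=
  {z | z.2.1 ∈ (extChartAt 𝓘(ℝ, E) c).target}

theorem isOpen_coordDomain (c : M) : IsOpen (coordDomain E c) :=
  (isOpen_extChartAt_target c).preimage (continuous_fst.comp continuous_snd)

/-- The scaled Hamiltonian in canonical coordinates. -/
def coordHamiltonian (V : M → ℝ) (c : M) (z : ℝ × E × (E →L[ℝ] ℝ)) : ℝ :=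
  scaledHamiltonian E V z.1 (ofCoord c z.2.1 z.2.2)

/-- The velocity `∂H/∂α` in canonical coordinates. -/
def coordVelocity (c : M) (z : ℝ × E × (E →L[ℝ] ℝ)) : E := sharpCoord c z.2.1 z.2.2

/-- The force `-∂H/∂u` in canonical coordinates. -/
def coordForce (V : M → ℝ) (c : M) (z : ℝ × E × (E →L[ℝ] ℝ)) : E →L[ℝ] ℝ :=
  -(fderiv ℝ (coordHamiltonian V c) z ∘L .inr ℝ ℝ _ ∘L .inl ℝ E _)

theorem coordHamiltonian_eq (V : M → ℝ) {c : M} {z : ℝ × E × (E →L[ℝ] ℝ)}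
    (hz : z ∈ coordDomain E c) :
    coordHamiltonian V c z = z.2.2 (coordVelocity c z) / 2
      + z.1 ^ 2 * (V ∘ (extChartAt 𝓘(ℝ, E) c).symm) z.2.1 := by
  have hs : (ofCoord c z.2.1 z.2.2).proj ∈ (chartAt E c).source := symm_mem_chart_source hz
  have h := norm_sq_eq_sharpCoord hs
  rw [momCoord_ofCoord hz, posCoord_ofCoord hz] at h
  rw [coordHamiltonian, scaledHamiltonian, hamiltonian, h]
  rfl

variable [IsContMDiffRiemannianBundle 𝓘(ℝ, E) ∞ E (fun x : M ↦ TangentSpace 𝓘(ℝ, E) x)]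

theorem contDiffOn_coordVelocity (c : M) :
    ContDiffOn ℝ ∞ (coordVelocity c : ℝ × E × (E →L[ℝ] ℝ) → E) (coordDomain E c) := by
  refine ContDiffOn.clm_apply ((contDiffOn_sharpCoord c).comp
    (ContDiff.contDiffOn (by fun_prop)) fun z hz ↦ hz) (ContDiff.contDiffOn (by fun_prop))

variable {V : M → ℝ} (hV : ContMDiff 𝓘(ℝ, E) 𝓘(ℝ, ℝ) ∞ V)

include hV

theorem contDiffOn_coordHamiltonian (c : M) :
    ContDiffOn ℝ ∞ (coordHamiltonian (E := E) V c) (coordDomain E c) := by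
  refine ContDiffOn.congr ?_ fun z hz ↦ coordHamiltonian_eq V hz
  refine ContDiffOn.add (ContDiffOn.div_const (ContDiffOn.clm_apply
    (ContDiff.contDiffOn (by fun_prop)) (contDiffOn_coordVelocity c)) 2)
    (ContDiffOn.mul (ContDiff.contDiffOn (by fun_prop)) ?_)
  exact (contDiffOn_comp_extChartAt_symm hV.contMDiffOn).comp
    (ContDiff.contDiffOn (by fun_prop)) fun z hz ↦ hz

theorem contDiffOn_coordForce (c : M) :
    ContDiffOn ℝ ∞ (coordForce (E := E) V c) (coordDomain E c) := by
  refine ContDiffOn.neg (ContDiffOn.clm_comp ?_ contDiffOn_const)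
  exact ((contDiffOn_infty_iff_fderiv_of_isOpen (isOpen_coordDomain c)).1
    (contDiffOn_coordHamiltonian hV c)).2

theorem hasFDerivAt_coordHamiltonian {c : M} {z : ℝ × E × (E →L[ℝ] ℝ)}
    (hz : z ∈ coordDomain E c) :
    HasFDerivAt (coordHamiltonian V c) (fderiv ℝ (coordHamiltonian V c) z) z :=
  (((contDiffOn_coordHamiltonian hV c).contDiffAt
    ((isOpen_coordDomain c).mem_nhds hz)).differentiableAt (by simp)).hasFDerivAt

theorem hasFDerivAt_coordHamiltonian_pos {c : M} {t : ℝ} {u : E} {α : E →L[ℝ] ℝ}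
    (hu : u ∈ (extChartAt 𝓘(ℝ, E) c).target) :
    HasFDerivAt (fun u ↦ coordHamiltonian V c (t, u, α)) (-coordForce V c (t, u, α)) u := by
  have h := hasFDerivAt_coordHamiltonian hV (z := (t, u, α)) hu
  have h2 : HasFDerivAt (fun u : E ↦ (t, u, α)) (.inr ℝ ℝ _ ∘L .inl ℝ E (E →L[ℝ] ℝ)) u :=
    (hasFDerivAt_prodMk_right t (u, α)).comp u (hasFDerivAt_prodMk_left u α)
  refine (h.comp u h2).congr_fderiv ?_
  rw [coordForce, neg_neg]

/-- By symmetry of `sharpCoord c u` the two terms of the product rule are equal, which cancels the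
factor 1/2. -/
theorem hasFDerivAt_coordHamiltonian_mom {c : M} {t : ℝ} {u : E} {α : E →L[ℝ] ℝ}
    (hu : u ∈ (extChartAt 𝓘(ℝ, E) c).target) :
    HasFDerivAt (fun α ↦ coordHamiltonian V c (t, u, α))
      (ContinuousLinearMap.apply ℝ ℝ (coordVelocity c (t, u, α))) α := by
  have h1 : HasFDerivAt (fun α : E →L[ℝ] ℝ ↦ α (sharpCoord c u α) / 2
      + t ^ 2 * (V ∘ (extChartAt 𝓘(ℝ, E) c).symm) u) _ α :=
    (((hasFDerivAt_id α).clm_apply (sharpCoord c u).hasFDerivAt).mul_const (2 : ℝ)⁻¹).add_const _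
  have h2 : (fun α ↦ coordHamiltonian V c (t, u, α)) = fun α : E →L[ℝ] ℝ ↦
      α (sharpCoord c u α) / 2 + t ^ 2 * (V ∘ (extChartAt 𝓘(ℝ, E) c).symm) u :=
    funext fun α ↦ coordHamiltonian_eq V hu
  rw [h2]
  refine h1.congr_fderiv (ContinuousLinearMap.ext fun β ↦ ?_)
  have h3 := sharpCoord_comm hu α β
  simp only [smul_apply, add_apply, smul_eq_mul,
    ContinuousLinearMap.comp_apply, ContinuousLinearMap.flip_apply, id_eq,
    ContinuousLinearMap.id_apply, ContinuousLinearMap.apply_apply, coordVelocity, h3]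
  ring

/-- Hamilton's equations in the form required by the first variation formula. -/
theorem fderiv_coordHamiltonian_apply {c : M} {z : ℝ × E × (E →L[ℝ] ℝ)}
    (hz : z ∈ coordDomain E c) (a : E) (β : E →L[ℝ] ℝ) :
    fderiv ℝ (coordHamiltonian V c) z (0, a, β) = β (coordVelocity c z) - coordForce V c z a := by
  obtain ⟨t, u, α⟩ := z
  have h := hasFDerivAt_coordHamiltonian hV hz
  have h2 : HasFDerivAt (fun α : E →L[ℝ] ℝ ↦ (t, u, α)) (.inr ℝ ℝ _ ∘L .inr ℝ E (E →L[ℝ] ℝ)) α :=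
    (hasFDerivAt_prodMk_right t (u, α)).comp α (hasFDerivAt_prodMk_right u α)
  have h2' := HasFDerivAt.comp (f := fun α : E →L[ℝ] ℝ ↦ (t, u, α)) α h h2
  have h3 := DFunLike.congr_fun (h2'.unique (hasFDerivAt_coordHamiltonian_mom hV
    (t := t) (u := u) (α := α) hz)) β
  have h4 : ((0 : ℝ), a, β) = (0, a, 0) + (0, 0, β) := by simp
  rw [h4, map_add]
  change _ + (fderiv ℝ (coordHamiltonian V c) (t, u, α)) (0, 0, β) = _
  have h5 : fderiv ℝ (coordHamiltonian V c) (t, u, α) (0, 0, β)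
    = β (coordVelocity c (t, u, α)) := h3
  have h6 : fderiv ℝ (coordHamiltonian V c) (t, u, α) (0, a, 0)
    = - coordForce V c (t, u, α) a := (neg_neg _).symm
  rw [h5, h6]
  ring

omit hV

theorem coordVelocity_smul (c : M) (t r : ℝ) (u : E) (α : E →L[ℝ] ℝ) :
    coordVelocity c (t, u, r • α) = r • coordVelocity c (t, u, α) :=
  map_smul _ _ _

include hV

/-- The Hamiltonian is homogeneous of degree 2 in `(t, α)` jointly, hence so is its derivative in
the position. This gives the behaviour at rest points and under changes of the speed. -/
theorem coordForce_smul {c : M} (r t : ℝ) {u : E} (hu : u ∈ (extChartAt 𝓘(ℝ, E) c).target)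
    (α : E →L[ℝ] ℝ) :
    coordForce V c (r * t, u, r • α) = r ^ 2 • coordForce V c (t, u, α) := by
  have h1 := hasFDerivAt_coordHamiltonian_pos hV (t := r * t) (α := r • α) hu
  have h2 := (hasFDerivAt_coordHamiltonian_pos hV (t := t) (α := α) hu).const_smul (r ^ 2)
  have h3 := h1.unique (h2.congr_of_eventuallyEq ?_)
  · rw [smul_neg, neg_inj] at h3
    exact h3
  · filter_upwards [(isOpen_extChartAt_target c).mem_nhds hu] with u' hu'
    have e1 := coordHamiltonian_eq V (z := (r * t, u', r • α)) hu'
    have e2 := coordHamiltonian_eq V (z := (t, u', α)) hu'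
    simp only [Pi.smul_apply, smul_eq_mul]
    rw [e1, e2]
    simp only [coordVelocity_smul, smul_apply, map_smul, smul_eq_mul]
    have : coordVelocity c (r * t, u', α) = coordVelocity c (t, u', α) := rfl
    rw [this]
    ring

theorem coordVelocity_rest (c : M) (t : ℝ) (u : E) : coordVelocity c (t, u, 0) = 0 := map_zero _

theorem coordForce_rest {c : M} {u : E} (hu : u ∈ (extChartAt 𝓘(ℝ, E) c).target) :
    coordForce V c (0, u, 0) = 0 := by
  have := coordForce_smul hV 0 0 hu 0
  simpa using this

theorem fderiv_coordVelocity_rest {c : M} {u : E} (hu : u ∈ (extChartAt 𝓘(ℝ, E) c).target)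
    (v : E × (E →L[ℝ] ℝ)) :
    fderiv ℝ (coordVelocity c) (0, u, 0) (0, v) = sharpCoord c u v.2 := by
  have hK : HasFDerivAt (sharpCoord c) (fderiv ℝ (sharpCoord c) u) u :=
    (((contDiffOn_sharpCoord c).contDiffAt
      ((isOpen_extChartAt_target c).mem_nhds hu)).differentiableAt (by simp)).hasFDerivAt
  have h := (hasFDerivAt_clm_apply_param hK).fderiv
  change fderiv ℝ (fun z : ℝ × E × (E →L[ℝ] ℝ) ↦ sharpCoord c z.2.1 z.2.2) (0, u, 0) (0, v) = _
  rw [h]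
  rfl

/-- Along the line `r ↦ (0, u + r • a, r • β)` homogeneity shows that the force is `r ^ 2` times a
differentiable function, so its derivative at `r = 0` vanishes. -/
theorem fderiv_coordForce_rest {c : M} {u : E} (hu : u ∈ (extChartAt 𝓘(ℝ, E) c).target)
    (v : E × (E →L[ℝ] ℝ)) :
    fderiv ℝ (coordForce V c) (0, u, 0) (0, v) = 0 := by
  obtain ⟨a, β⟩ := v
  have hd : ∀ α, DifferentiableAt ℝ (coordForce (E := E) V c) (0, u, α) := fun α ↦
    ((contDiffOn_coordForce hV c).contDiffAt
      ((isOpen_coordDomain c).mem_nhds hu)).differentiableAt (by simp)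
  have hline : ∀ (α₀ β' : E →L[ℝ] ℝ), HasDerivAt
      (fun r : ℝ ↦ ((0 : ℝ), u + r • a, α₀ + r • β')) (0, a, β') 0 := fun α₀ β' ↦ by
    have ha : HasDerivAt (fun r : ℝ ↦ u + r • a) a 0 := by
      simpa using ((hasDerivAt_id (0 : ℝ)).smul_const a).const_add u
    have hb : HasDerivAt (fun r : ℝ ↦ α₀ + r • β') β' 0 := by
      simpa using ((hasDerivAt_id (0 : ℝ)).smul_const β').const_add α₀
    exact (hasDerivAt_const 0 _).prodMk (ha.prodMk hb)
  have h1 : HasDerivAt (fun r : ℝ ↦ coordForce V c (0, u + r • a, (0 : E →L[ℝ] ℝ) + r • β))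
      (fderiv ℝ (coordForce V c) (0, u, 0) (0, a, β)) 0 := by
    have h := (hd 0).hasFDerivAt
    exact HasFDerivAt.comp_hasDerivAt_of_eq 0 h (hline 0 β) (by simp)
  have h2 : HasDerivAt (fun r : ℝ ↦ r ^ 2 • coordForce V c (0, u + r • a, β)) 0 0 := by
    have h3 : HasDerivAt (fun r : ℝ ↦ coordForce V c (0, u + r • a, β + r • (0 : E →L[ℝ] ℝ)))
        (fderiv ℝ (coordForce V c) (0, u, β) (0, a, 0)) 0 :=
      HasFDerivAt.comp_hasDerivAt_of_eq 0 (hd β).hasFDerivAt (hline β 0) (by simp)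
    simp only [smul_zero, add_zero] at h3
    exact ((hasDerivAt_pow 2 (0 : ℝ)).smul h3).congr_deriv (by simp)
  refine h1.unique (h2.congr_of_eventuallyEq ?_)
  have hc : ContinuousAt (fun r : ℝ ↦ u + r • a) 0 := by fun_prop
  have hmem : ∀ᶠ r : ℝ in 𝓝 0, u + r • a ∈ (extChartAt 𝓘(ℝ, E) c).target :=
    hc.eventually ((isOpen_extChartAt_target c).mem_nhds (by simpa using hu))
  filter_upwards [hmem] with r hr
  have := coordForce_smul hV r 0 hr β
  simpa using this

end CoordinateHamiltonian

end

noncomputable section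

set_option linter.unusedSectionVars false

/-! ### Transformation of Hamilton's equations under changes of charts. -/

section ChartInvariance

open Filter Topology

theorem hasDerivWithinAt_of_forall_dual {E : Type*} [NormedAddCommGroup E] [NormedSpace ℝ E]
    [FiniteDimensional ℝ E] {f : ℝ → E} {f' : E} {s : Set ℝ} {x : ℝ}
    (h : ∀ β : E →L[ℝ] ℝ, HasDerivWithinAt (fun σ ↦ β (f σ)) (β f') s x) :
    HasDerivWithinAt f f' s x := by
  let e := (Module.finBasis ℝ E).equivFunL
  have h1 : HasDerivWithinAt (fun σ ↦ e (f σ)) (e f') s x :=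
    hasDerivWithinAt_pi.2 fun i ↦ 
      h ((ContinuousLinearMap.proj i : (Fin (Module.finrank ℝ E) → ℝ) →L[ℝ] ℝ) ∘L
        (e : E →L[ℝ] Fin (Module.finrank ℝ E) → ℝ))
  have h2 := (e.symm : _ →L[ℝ] E).hasFDerivAt.comp_hasDerivWithinAt x h1
  simpa [Function.comp_def] using h2

section Transform

variable {E : Type*} [NormedAddCommGroup E] [NormedSpace ℝ E]

/-- Lifted coordinate changes are canonical: how the Hamilton vector fields `(A, B)` and
`(A', B')` of two coordinate expressions of a Hamiltonian are related. -/
theorem hamilton_field_transform {h h' : E × (E →L[ℝ] ℝ) → ℝ} {ρ : E → E} {u' : E}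
    {α : E →L[ℝ] ℝ} {A A' : E} {B B' : E →L[ℝ] ℝ} (hρ : ContDiffAt ℝ 2 ρ u')
    (hh : HasFDerivAt h ((ContinuousLinearMap.apply ℝ ℝ A) ∘L .snd ℝ _ _ - B ∘L .fst ℝ _ _)
      (ρ u', α))
    (hh' : HasFDerivAt h' ((ContinuousLinearMap.apply ℝ ℝ A') ∘L .snd ℝ _ _ - B' ∘L .fst ℝ _ _)
      (u', α ∘L fderiv ℝ ρ u'))
    (heq : ∀ᶠ v in 𝓝 u', ∀ β, h' (v, β ∘L fderiv ℝ ρ v) = h (ρ v, β)) :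
    fderiv ℝ ρ u' A' = A ∧
      B' = B ∘L fderiv ℝ ρ u' + α ∘L fderiv ℝ (fderiv ℝ ρ) u' A' := by
  have hρ1 : HasFDerivAt ρ (fderiv ℝ ρ u') u' := (hρ.differentiableAt (by simp)).hasFDerivAt
  have hρ2 : HasFDerivAt (fderiv ℝ ρ) (fderiv ℝ (fderiv ℝ ρ) u') u' :=
    ((hρ.fderiv_right (m := 1) (by norm_num)).differentiableAt (by simp)).hasFDerivAt
  have hsymm : IsSymmSndFDerivAt ℝ ρ u' := hρ.isSymmSndFDerivAt (by simp)
  constructor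
  · refine (SeparatingDual.eq_iff_forall_dual_eq (R := ℝ)).2 fun β ↦ ?_
    have hR : HasFDerivAt (fun β : E →L[ℝ] ℝ ↦ β ∘L fderiv ℝ ρ u')
        ((ContinuousLinearMap.compL ℝ E E ℝ).flip (fderiv ℝ ρ u')) α :=
      ((ContinuousLinearMap.compL ℝ E E ℝ).flip (fderiv ℝ ρ u')).hasFDerivAt
    have k1 : HasFDerivAt (fun β : E →L[ℝ] ℝ ↦ h' (u', β ∘L fderiv ℝ ρ u')) _ α :=
      HasFDerivAt.comp (f := fun β : E →L[ℝ] ℝ ↦ (u', β ∘L fderiv ℝ ρ u')) α hh'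
        ((hasFDerivAt_const u' α).prodMk hR)
    have k2 : HasFDerivAt (fun β : E →L[ℝ] ℝ ↦ h (ρ u', β)) _ α :=
      HasFDerivAt.comp (f := fun β : E →L[ℝ] ℝ ↦ (ρ u', β)) α hh
        ((hasFDerivAt_const (ρ u') α).prodMk (hasFDerivAt_id α))
    have k3 := k1.unique (k2.congr_of_eventuallyEq (.of_forall fun β ↦ heq.self_of_nhds β))
    simpa using DFunLike.congr_fun k3 β
  · ext a
    have hR : HasFDerivAt (fun v ↦ α ∘L fderiv ℝ ρ v)
        (ContinuousLinearMap.compL ℝ E E ℝ α ∘L fderiv ℝ (fderiv ℝ ρ) u') u' :=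
      (ContinuousLinearMap.compL ℝ E E ℝ α).hasFDerivAt.comp u' hρ2
    have k1 : HasFDerivAt (fun v ↦ h' (v, α ∘L fderiv ℝ ρ v)) _ u' :=
      HasFDerivAt.comp (f := fun v ↦ (v, α ∘L fderiv ℝ ρ v)) u' hh' ((hasFDerivAt_id u').prodMk hR)
    have k2 : HasFDerivAt (fun v ↦ h (ρ v, α)) _ u' :=
      HasFDerivAt.comp (f := fun v ↦ (ρ v, α)) u' hh (hρ1.prodMk (hasFDerivAt_const α u'))
    have k3 := DFunLike.congr_fun
      (k1.unique (k2.congr_of_eventuallyEq (heq.mono fun v hv ↦ hv α))) a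
    simp at k3
    -- The chain rule yields the second derivative of `ρ` with `a` in the first slot; symmetry
    -- exchanges it with `A'`.
    have k4 := hsymm.eq a A'
    simp only [_root_.add_apply, ContinuousLinearMap.comp_apply]
    rw [← k4]
    linarith

end Transform

variable {E : Type*} [NormedAddCommGroup E] [NormedSpace ℝ E]
  {M : Type*} [TopologicalSpace M] [ChartedSpace E M] [IsManifold 𝓘(ℝ, E) ∞ M]

variable (E) in
/-- The transition map from the chart at `c'` to the chart at `c`. -/
def transitionMap (c c' : M) (u : E) : E :=
  extChartAt 𝓘(ℝ, E) c ((extChartAt 𝓘(ℝ, E) c').symm u)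

theorem transitionMap_apply {c c' x : M} (hx : x ∈ (chartAt E c').source) :
    transitionMap E c c' (extChartAt 𝓘(ℝ, E) c' x) = extChartAt 𝓘(ℝ, E) c x := by
  rw [transitionMap, extChartAt_symm_apply hx]

theorem contDiffAt_transitionMap {c c' x : M} (hx : x ∈ (chartAt E c).source)
    (hx' : x ∈ (chartAt E c').source) :
    ContDiffAt ℝ ∞ (transitionMap E c c') (extChartAt 𝓘(ℝ, E) c' x) := by
  have h := contDiffWithinAt_ext_coord_change (I := 𝓘(ℝ, E)) (n := ∞) c c'
    (y := extChartAt 𝓘(ℝ, E) c' x) (by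
      rw [PartialEquiv.trans_source, mem_inter_iff, mem_preimage, PartialEquiv.symm_source,
        extChartAt_symm_apply hx', extChartAt_source]
      exact ⟨extChartAt_mem_target hx', hx⟩)
  rw [modelWithCornersSelf_coe, range_id, contDiffWithinAt_univ] at h
  exact h

/-- The cocycle identity of the tangent bundle, passed through the chart at `x`: changes of
trivialization are derivatives of transition maps. -/
theorem continuousLinearMapAt_symmL_eq_fderiv {c c' x : M} (hx : x ∈ (chartAt E c).source)
    (hx' : x ∈ (chartAt E c').source) (a : E) :
    (trivializationAt E (TangentSpace 𝓘(ℝ, E)) c).continuousLinearMapAt ℝ x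
      ((trivializationAt E (TangentSpace 𝓘(ℝ, E)) c').symmL ℝ x a)
      = fderiv ℝ (transitionMap E c c') (extChartAt 𝓘(ℝ, E) c' x) a := by
  rw [TangentBundle.continuousLinearMapAt_trivializationAt_eq_core hx,
    TangentBundle.symmL_trivializationAt_eq_core hx']
  have h := (tangentBundleCore 𝓘(ℝ, E) M).coordChange_comp (achart E c') (achart E x) (achart E c)
    x ⟨⟨hx', mem_chart_source E x⟩, hx⟩ a
  refine h.trans ?_
  rw [tangentBundleCore_coordChange_achart, modelWithCornersSelf_coe, range_id, fderivWithin_univ]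
  rfl

theorem symmL_eq_symmL_fderiv {c c' x : M} (hx : x ∈ (chartAt E c).source)
    (hx' : x ∈ (chartAt E c').source) (a : E) :
    (trivializationAt E (TangentSpace 𝓘(ℝ, E)) c').symmL ℝ x a
      = (trivializationAt E (TangentSpace 𝓘(ℝ, E)) c).symmL ℝ x
        (fderiv ℝ (transitionMap E c c') (extChartAt 𝓘(ℝ, E) c' x) a) := by
  rw [← continuousLinearMapAt_symmL_eq_fderiv hx hx', tangent_symmL_continuousLinearMapAt hx]

theorem momCoord_change {c c' : M} {z : CotangentBundle E M} (hz : z.proj ∈ (chartAt E c).source)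
    (hz' : z.proj ∈ (chartAt E c').source) :
    momCoord c' z = momCoord c z ∘L fderiv ℝ (transitionMap E c c') (posCoord c' z) := by
  ext a
  exact congrArg z.2 (symmL_eq_symmL_fderiv hz hz' a)

theorem ofCoord_change {c c' : M} {u : E} (hu : u ∈ (extChartAt 𝓘(ℝ, E) c').target)
    (hu' : (extChartAt 𝓘(ℝ, E) c').symm u ∈ (chartAt E c).source) (α : E →L[ℝ] ℝ) :
    ofCoord c' u (α ∘L fderiv ℝ (transitionMap E c c') u)
      = ofCoord c (transitionMap E c c' u) α := by
  have hc' : (extChartAt 𝓘(ℝ, E) c').symm u ∈ (chartAt E c').source := symm_mem_chart_source hu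
  have ht : transitionMap E c c' u ∈ (extChartAt 𝓘(ℝ, E) c).target := extChartAt_mem_target hu'
  have hp : (ofCoord c (transitionMap E c c' u) α).proj = (extChartAt 𝓘(ℝ, E) c').symm u :=
    extChartAt_symm_apply hu'
  have hpos : posCoord c' (ofCoord c (transitionMap E c c' u) α) = u := by
    rw [posCoord, hp]
    exact (extChartAt 𝓘(ℝ, E) c').right_inv hu
  refine coords_injOn (c := c') hc' (by rwa [hp]) ?_ ?_
  · rw [hpos, posCoord_ofCoord hu]
  · rw [momCoord_ofCoord hu, momCoord_change (c := c) (by rwa [hp]) (by rwa [hp]), hpos,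
      momCoord_ofCoord ht]

end ChartInvariance

end

noncomputable section

set_option linter.unusedSectionVars false

/-! ### Classical paths: independence of the chart, energy, velocity and action. -/

section ClassicalPaths

open Filter Topology

variable {E : Type*} [NormedAddCommGroup E] [NormedSpace ℝ E] [FiniteDimensional ℝ E]
  {M : Type*} [TopologicalSpace M] [ChartedSpace E M] [IsManifold 𝓘(ℝ, E) ∞ M]
  [RiemannianBundle (fun x : M ↦ TangentSpace 𝓘(ℝ, E) x)]

/-- Hamilton's equations for the scaled Hamiltonian at the time `s`, in the chart at `c`. -/
structure IsCoordSolutionAt (V : M → ℝ) (t T : ℝ) (γ : ℝ → CotangentBundle E M) (c : M) (s : ℝ) :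
    Prop where
  pos : HasDerivWithinAt (fun σ ↦ posCoord c (γ σ))
    (coordVelocity c (t, posCoord c (γ s), momCoord c (γ s))) (Icc 0 T) s
  mom : HasDerivWithinAt (fun σ ↦ momCoord c (γ σ))
    (coordForce V c (t, posCoord c (γ s), momCoord c (γ s))) (Icc 0 T) s

variable [IsContMDiffRiemannianBundle 𝓘(ℝ, E) ∞ E (fun x : M ↦ TangentSpace 𝓘(ℝ, E) x)]
  {V : M → ℝ} (hV : ContMDiff 𝓘(ℝ, E) 𝓘(ℝ, ℝ) ∞ V)

include hV

theorem IsClassicalPath.isCoordSolutionAt {t T : ℝ} {γ : ℝ → CotangentBundle E M}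
    (hγ : IsClassicalPath (scaledHamiltonian E V t) T γ) {c : M} {s : ℝ} (hs : s ∈ Icc 0 T)
    (hc : (γ s).proj ∈ (chartAt E c).source) : IsCoordSolutionAt V t T γ c s := by
  have hu := posCoord_mem_target hc
  constructor
  · refine hasDerivWithinAt_of_forall_dual fun β ↦ ?_
    refine (hγ.deriv_pos c s hs hc β).congr_deriv ?_
    exact DFunLike.congr_fun (hasFDerivAt_coordHamiltonian_mom hV (t := t) hu).fderiv β
  · refine (hγ.deriv_mom c s hs hc).congr_deriv ?_
    have := (hasFDerivAt_coordHamiltonian_pos hV (t := t) (α := momCoord c (γ s)) hu).fderiv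
    exact (congrArg Neg.neg this).trans (neg_neg _)

theorem hasFDerivAt_coordHamiltonian_slice {c : M} (t : ℝ) {p : E × (E →L[ℝ] ℝ)}
    (hp : p.1 ∈ (extChartAt 𝓘(ℝ, E) c).target) :
    HasFDerivAt (fun p : E × (E →L[ℝ] ℝ) ↦ coordHamiltonian V c (t, p))
      ((ContinuousLinearMap.apply ℝ ℝ (coordVelocity c (t, p))) ∘L .snd ℝ _ _
        - coordForce V c (t, p) ∘L .fst ℝ _ _) p := by
  have h := HasFDerivAt.comp (f := fun p : E × (E →L[ℝ] ℝ) ↦ (t, p)) p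
    (hasFDerivAt_coordHamiltonian hV (z := (t, p)) hp) (hasFDerivAt_prodMk_right t p)
  refine h.congr_fderiv (ContinuousLinearMap.ext fun v ↦ ?_)
  exact fderiv_coordHamiltonian_apply hV (z := (t, p)) hp v.1 v.2

/-- Both coordinate Hamiltonians express the same function on `T*M`, so `hamilton_field_transform`
applies to the transition map. -/
theorem coordField_transform {c c' : M} (t : ℝ) {z : CotangentBundle E M}
    (hc : z.proj ∈ (chartAt E c).source) (hc' : z.proj ∈ (chartAt E c').source) :
    fderiv ℝ (transitionMap E c c') (posCoord c' z)
        (coordVelocity c' (t, posCoord c' z, momCoord c' z))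
      = coordVelocity c (t, posCoord c z, momCoord c z) ∧
    coordForce V c' (t, posCoord c' z, momCoord c' z)
      = coordForce V c (t, posCoord c z, momCoord c z)
          ∘L fderiv ℝ (transitionMap E c c') (posCoord c' z)
        + momCoord c z ∘L fderiv ℝ (fderiv ℝ (transitionMap E c c')) (posCoord c' z)
          (coordVelocity c' (t, posCoord c' z, momCoord c' z)) := by
  have hu := posCoord_mem_target hc
  have hu' := posCoord_mem_target hc'
  have hρ : transitionMap E c c' (posCoord c' z) = posCoord c z := transitionMap_apply hc'
  have hmom := momCoord_change hc hc'
  refine hamilton_field_transform (h := fun p ↦ coordHamiltonian V c (t, p))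
    (h' := fun p ↦ coordHamiltonian V c' (t, p))
    ((contDiffAt_transitionMap hc hc').of_le ENat.LEInfty.out) ?_ ?_ ?_
  · rw [hρ]
    exact hasFDerivAt_coordHamiltonian_slice hV t (p := (posCoord c z, momCoord c z)) hu
  · have := hasFDerivAt_coordHamiltonian_slice hV t (p := (posCoord c' z, momCoord c' z)) hu'
    rw [hmom] at this ⊢
    exact this
  · have h1 : ∀ᶠ v in 𝓝 (posCoord c' z), v ∈ (extChartAt 𝓘(ℝ, E) c').target :=
      (isOpen_extChartAt_target c').mem_nhds hu'
    have h2 : ∀ᶠ v in 𝓝 (posCoord c' z),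
        (extChartAt 𝓘(ℝ, E) c').symm v ∈ (chartAt E c).source := by
      have hcont := (continuousOn_extChartAt_symm (I := 𝓘(ℝ, E)) c').continuousAt
        ((isOpen_extChartAt_target c').mem_nhds hu')
      refine hcont.eventually ((chartAt E c).open_source.mem_nhds ?_)
      rwa [posCoord, extChartAt_symm_apply hc']
    filter_upwards [h1, h2] with v hv1 hv2 β
    exact congrArg (scaledHamiltonian E V t) (ofCoord_change hv1 hv2 β)

omit hV in
theorem fderiv_transitionMap_comp {c c' x : M} (hc : x ∈ (chartAt E c).source)
    (hc' : x ∈ (chartAt E c').source) (a : E) :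
    fderiv ℝ (transitionMap E c' c) (extChartAt 𝓘(ℝ, E) c x)
      (fderiv ℝ (transitionMap E c c') (extChartAt 𝓘(ℝ, E) c' x) a) = a := by
  rw [← continuousLinearMapAt_symmL_eq_fderiv hc hc', ← continuousLinearMapAt_symmL_eq_fderiv hc' hc,
    tangent_symmL_continuousLinearMapAt hc, continuousLinearMapAt_tangent_symmL hc']

/-- Hamilton's equations do not depend on the chart. -/
theorem IsCoordSolutionAt.change {t T : ℝ} {γ : ℝ → CotangentBundle E M} {c c' : M} {s : ℝ}
    (h : IsCoordSolutionAt V t T γ c s)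
    (hcont : ContinuousWithinAt (fun σ ↦ (γ σ).proj) (Icc 0 T) s)
    (hc : (γ s).proj ∈ (chartAt E c).source) (hc' : (γ s).proj ∈ (chartAt E c').source) :
    IsCoordSolutionAt V t T γ c' s := by
  obtain ⟨hA, hB⟩ := coordField_transform hV t hc hc'
  have e1 : ∀ᶠ σ in 𝓝[Icc 0 T] s, (γ σ).proj ∈ (chartAt E c).source :=
    hcont.eventually ((chartAt E c).open_source.mem_nhds hc)
  have e2 : ∀ᶠ σ in 𝓝[Icc 0 T] s, (γ σ).proj ∈ (chartAt E c').source :=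
    hcont.eventually ((chartAt E c').open_source.mem_nhds hc')
  have hpos : HasDerivWithinAt (fun σ ↦ posCoord c' (γ σ))
      (coordVelocity c' (t, posCoord c' (γ s), momCoord c' (γ s))) (Icc 0 T) s := by
    have hτ : HasFDerivAt (transitionMap E c' c) (fderiv ℝ (transitionMap E c' c)
        (posCoord c (γ s))) (posCoord c (γ s)) :=
      ((contDiffAt_transitionMap hc' hc).differentiableAt (by simp)).hasFDerivAt
    have h1 := hτ.comp_hasDerivWithinAt s h.pos
    rw [← hA] at h1
    have h2 := h1.congr_deriv (fderiv_transitionMap_comp hc hc' _)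
    refine h2.congr_of_eventuallyEq (e1.mono fun σ hσ ↦ ?_) ?_
    · exact (transitionMap_apply hσ).symm
    · exact (transitionMap_apply hc).symm
  refine ⟨hpos, ?_⟩
  have hρ : HasFDerivAt (fderiv ℝ (transitionMap E c c'))
      (fderiv ℝ (fderiv ℝ (transitionMap E c c')) (posCoord c' (γ s))) (posCoord c' (γ s)) :=
    (((contDiffAt_transitionMap hc hc').fderiv_right (m := ∞) (by simp)).differentiableAt
      (by simp)).hasFDerivAt
  have h1 := h.mom.clm_comp (hρ.comp_hasDerivWithinAt s hpos)
  rw [hB]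
  refine h1.congr_of_eventuallyEq ?_ (momCoord_change hc hc')
  filter_upwards [e1, e2] with σ h1 h2 using momCoord_change h1 h2

/-- By chart invariance it suffices to check the equations in a single chart at each time. -/
theorem isClassicalPath_of_isCoordSolutionAt {t T : ℝ} {γ : ℝ → CotangentBundle E M}
    (hcont : ContinuousOn (fun σ ↦ (γ σ).proj) (Icc 0 T))
    (h : ∀ s ∈ Icc 0 T, ∃ c, (γ s).proj ∈ (chartAt E c).source ∧ IsCoordSolutionAt V t T γ c s) :
    IsClassicalPath (scaledHamiltonian E V t) T γ := by
  have h' : ∀ c, ∀ s ∈ Icc 0 T, (γ s).proj ∈ (chartAt E c).source →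
      IsCoordSolutionAt V t T γ c s := fun c s hs hc ↦ by
    obtain ⟨c', hc', hsol⟩ := h s hs
    exact hsol.change hV (hcont s hs) hc' hc
  refine ⟨hcont, fun c s hs hc β ↦ ?_, fun c s hs hc ↦ ?_⟩
  · have h1 := β.hasFDerivAt.comp_hasDerivWithinAt s (h' c s hs hc).pos
    refine h1.congr_deriv ?_
    exact (DFunLike.congr_fun
      (hasFDerivAt_coordHamiltonian_mom hV (t := t) (posCoord_mem_target hc)).fderiv β).symm
  · refine (h' c s hs hc).mom.congr_deriv ?_
    have := (hasFDerivAt_coordHamiltonian_pos hV (t := t) (α := momCoord c (γ s))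
      (posCoord_mem_target hc)).fderiv
    exact ((congrArg Neg.neg this).trans (neg_neg _)).symm

/-- Conservation of energy. -/
theorem IsClassicalPath.hamiltonian_eq {t T : ℝ} {γ : ℝ → CotangentBundle E M}
    (hγ : IsClassicalPath (scaledHamiltonian E V t) T γ) {s : ℝ} (hs : s ∈ Icc 0 T) :
    scaledHamiltonian E V t (γ s) = scaledHamiltonian E V t (γ 0) := by
  have hd : ∀ r ∈ Icc 0 T, HasDerivWithinAt (fun σ ↦ scaledHamiltonian E V t (γ σ)) 0
      (Icc 0 T) r := fun r hr ↦ by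
    set c := (γ r).proj
    have hc : (γ r).proj ∈ (chartAt E c).source := mem_chart_source E _
    have hsol := hγ.isCoordSolutionAt hV hr hc
    have h1 := (hasFDerivAt_coordHamiltonian_slice hV t
      (p := (posCoord c (γ r), momCoord c (γ r))) (posCoord_mem_target hc)).comp_hasDerivWithinAt
      r (hsol.pos.prodMk hsol.mom)
    have h2 := h1.congr_deriv (g' := 0) (by simp)
    have e1 : ∀ᶠ σ in 𝓝[Icc 0 T] r, (γ σ).proj ∈ (chartAt E c).source :=
      (hγ.continuousOn r hr).eventually ((chartAt E c).open_source.mem_nhds hc)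
    refine h2.congr_of_eventuallyEq (e1.mono fun σ hσ ↦ ?_) ?_
    · exact congrArg (scaledHamiltonian E V t) (ofCoord_coords hσ).symm
    · exact congrArg (scaledHamiltonian E V t) (ofCoord_coords hc).symm
  have h0 : (0 : ℝ) ∈ Icc 0 T := ⟨le_rfl, hs.1.trans hs.2⟩
  have := (convex_Icc 0 T).norm_image_sub_le_of_norm_hasDerivWithin_le (C := 0) hd (by simp) h0 hs
  rw [zero_mul, norm_le_zero_iff, sub_eq_zero] at this
  exact this

omit hV in
theorem tangent_symmL_self (x : M) (a : E) :
    (trivializationAt E (TangentSpace 𝓘(ℝ, E)) x).symmL ℝ x a = a := by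
  rw [TangentBundle.symmL_trivializationAt_eq_core (mem_chart_source E x)]
  exact (tangentBundleCore 𝓘(ℝ, E) M).coordChange_self (achart E x) x (mem_chart_source E x) a

omit hV in
/-- The velocity vector dual to a momentum. -/
def cotangentSharp (z : CotangentBundle E M) : TangentSpace 𝓘(ℝ, E) z.proj :=
  sharpCoord (E := E) z.proj (posCoord (E := E) z.proj z) (momCoord z.proj z)

omit hV in
theorem norm_cotangentSharp (z : CotangentBundle E M) : ‖cotangentSharp z‖ = ‖z.2‖ := by
  rw [← norm_symmL_sharpCoord (c := z.proj) (z := z) (mem_chart_source E _), tangent_symmL_self]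
  rfl

/-- The base curve of a classical path is differentiable, and its velocity is dual to the
momentum. -/
theorem IsClassicalPath.hasMFDerivWithinAt {t T : ℝ} {γ : ℝ → CotangentBundle E M}
    (hγ : IsClassicalPath (scaledHamiltonian E V t) T γ) {s : ℝ} (hs : s ∈ Icc 0 T) :
    HasMFDerivWithinAt 𝓘(ℝ, ℝ) 𝓘(ℝ, E) (fun σ ↦ (γ σ).proj) (Icc 0 T) s
      (ContinuousLinearMap.toSpanSingleton ℝ (cotangentSharp (γ s))) := by
  have hsol := hγ.isCoordSolutionAt hV hs (mem_chart_source E (γ s).proj)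
  refine ⟨hγ.continuousOn s hs, ?_⟩
  have h := hsol.pos.hasFDerivWithinAt
  have hset : (extChartAt 𝓘(ℝ, ℝ) s).symm ⁻¹' Icc 0 T ∩ range 𝓘(ℝ, ℝ) = Icc 0 T := by
    simp [chartAt_self_eq]
  rw [hset]
  exact h

theorem IsClassicalPath.norm_mfderivWithin {t T : ℝ} {γ : ℝ → CotangentBundle E M}
    (hγ : IsClassicalPath (scaledHamiltonian E V t) T γ) (hT : 0 < T) {s : ℝ}
    (hs : s ∈ Icc 0 T) :
    ‖mfderivWithin 𝓘(ℝ, ℝ) 𝓘(ℝ, E) (fun σ ↦ (γ σ).proj) (Icc 0 T) s (1 : ℝ)‖ = ‖(γ s).2‖ := by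
  have hu : UniqueMDiffWithinAt 𝓘(ℝ, ℝ) (Icc 0 T) s :=
    (uniqueDiffOn_Icc hT s hs).uniqueMDiffWithinAt
  rw [(hγ.hasMFDerivWithinAt hV hs).mfderivWithin hu, ← norm_cotangentSharp (γ s)]
  congr 1
  exact one_smul ℝ (_ : E)

theorem IsClassicalPath.action_eq {t T : ℝ} {γ : ℝ → CotangentBundle E M}
    (hγ : IsClassicalPath (scaledHamiltonian E V t) T γ) (hT : 0 < T) :
    action (fun x ↦ t ^ 2 * V x) T γ
      = ∫ s in (0 : ℝ)..T, (‖(γ s).2‖ ^ 2 / 2 - t ^ 2 * V (γ s).proj) := by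
  refine intervalIntegral.integral_congr fun s hs ↦ ?_
  rw [uIcc_of_le hT.le] at hs
  simp only [hγ.norm_mfderivWithin hV hT hs]

/-- Conservation of energy solved for the momentum: the initial momentum and the oscillation of `V`
control it at all times. -/
theorem IsClassicalPath.norm_sq_eq {t T : ℝ} {γ : ℝ → CotangentBundle E M}
    (hγ : IsClassicalPath (scaledHamiltonian E V t) T γ) {s : ℝ} (hs : s ∈ Icc 0 T) :
    ‖(γ s).2‖ ^ 2 = ‖(γ 0).2‖ ^ 2 + 2 * t ^ 2 * (V (γ 0).proj - V (γ s).proj) := by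
  have := hγ.hamiltonian_eq hV hs
  simp only [scaledHamiltonian, hamiltonian] at this
  linarith

/-- The base curve of a classical path is continuously differentiable. -/
theorem IsClassicalPath.contMDiffOn {t T : ℝ} {γ : ℝ → CotangentBundle E M}
    (hγ : IsClassicalPath (scaledHamiltonian E V t) T γ) (hT : 0 < T) :
    ContMDiffOn 𝓘(ℝ, ℝ) 𝓘(ℝ, E) 1 (fun σ ↦ (γ σ).proj) (Icc 0 T) := by
  intro s hs
  rw [contMDiffWithinAt_iff_target]
  refine ⟨hγ.continuousOn s hs, ?_⟩
  rw [contMDiffWithinAt_iff_contDiffWithinAt]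
  set c := (γ s).proj
  have hO : ∀ᶠ σ in 𝓝[Icc 0 T] s, (γ σ).proj ∈ (chartAt E c).source :=
    hγ.continuousOn s hs ((chartAt E c).open_source.mem_nhds (mem_chart_source E c))
  obtain ⟨O, hOo, hsO, hO⟩ := mem_nhdsWithin.1 hO
  have hsub : ∀ σ ∈ Icc 0 T ∩ O, (γ σ).proj ∈ (chartAt E c).source := fun σ hσ ↦ hO ⟨hσ.2, hσ.1⟩
  have hsol := fun σ (hσ : σ ∈ Icc 0 T ∩ O) ↦ hγ.isCoordSolutionAt hV hσ.1 (hsub σ hσ)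
  have key : ContDiffOn ℝ 1 (fun σ ↦ posCoord c (γ σ)) (Icc 0 T ∩ O) := by
    have hu : UniqueDiffOn ℝ (Icc 0 T ∩ O) := (uniqueDiffOn_Icc hT).inter hOo
    rw [show (1 : WithTop ℕ∞) = 0 + 1 from (zero_add 1).symm,
      contDiffOn_succ_iff_hasFDerivWithinAt_of_uniqueDiffOn hu]
    refine ⟨by simp, fun σ ↦ ContinuousLinearMap.toSpanSingleton ℝ
      (coordVelocity c (t, posCoord c (γ σ), momCoord c (γ σ))), ?_, fun σ hσ ↦
        ((hsol σ hσ).pos.mono inter_subset_left).hasFDerivWithinAt⟩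
    rw [contDiffOn_zero]
    refine (ContinuousLinearMap.toSpanSingletonCLE (𝕜 := ℝ) (E := E)).continuous.comp_continuousOn ?_
    refine (contDiffOn_coordVelocity c).continuousOn.comp
      (continuousOn_const.prodMk (ContinuousOn.prodMk ?_ ?_)) fun σ hσ ↦
        posCoord_mem_target (hsub σ hσ)
    · exact fun σ hσ ↦ ((hsol σ hσ).pos.mono inter_subset_left).continuousWithinAt
    · exact fun σ hσ ↦ ((hsol σ hσ).mom.mono inter_subset_left).continuousWithinAt
  have := key s ⟨hs, hsO⟩
  rwa [contDiffWithinAt_inter (hOo.mem_nhds hsO)] at this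

end ClassicalPaths

end

noncomputable section

set_option linter.unusedSectionVars false

/-! ### A priori bounds on paths and the local family of solutions. -/

section PathLength

open Filter Topology unitInterval Manifold
open scoped ENNReal

variable {E : Type*} [NormedAddCommGroup E] [NormedSpace ℝ E] [FiniteDimensional ℝ E]
  {M : Type*} [MetricSpace M] [ChartedSpace E M] [IsManifold 𝓘(ℝ, E) ∞ M]
  [RiemannianBundle (fun x : M ↦ TangentSpace 𝓘(ℝ, E) x)]
  [IsContMDiffRiemannianBundle 𝓘(ℝ, E) ∞ E (fun x : M ↦ TangentSpace 𝓘(ℝ, E) x)]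
  {V : M → ℝ} (hV : ContMDiff 𝓘(ℝ, E) 𝓘(ℝ, ℝ) ∞ V)

include hV

/-- The distance travelled by a classical path whose momentum is bounded. -/
theorem IsClassicalPath.dist_le [IsRiemannianManifold 𝓘(ℝ, E) M] {t T K : ℝ}
    {γ : ℝ → CotangentBundle E M}
    (hγ : IsClassicalPath (scaledHamiltonian E V t) T γ) (hT : 0 < T)
    (hK : ∀ s ∈ Icc 0 T, ‖(γ s).2‖ ≤ K) {s : ℝ} (hs : s ∈ Icc 0 T) :
    dist (γ 0).proj (γ s).proj ≤ K * s := by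
  have hK0 : 0 ≤ K := (ContinuousLinearMap.opNorm_nonneg _).trans (hK s hs)
  have h1 : edist (γ 0).proj (γ s).proj ≤ pathELength 𝓘(ℝ, E) (fun r ↦ (γ r).proj) 0 s := by
    rw [‹IsRiemannianManifold 𝓘(ℝ, E) M›.out]
    exact riemannianEDist_le_pathELength
      ((hγ.contMDiffOn hV hT).mono (Icc_subset_Icc_right hs.2)) rfl rfl hs.1
  have h2 : pathELength 𝓘(ℝ, E) (fun r ↦ (γ r).proj) 0 s ≤ ENNReal.ofReal (K * s) := by
    rw [pathELength_eq_lintegral_mfderiv_Ioo]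
    calc _ ≤ ∫⁻ _ in Ioo 0 s, ENNReal.ofReal K := by
          refine setLIntegral_mono measurable_const fun r hr ↦ ?_
          have hr' : r ∈ Icc 0 T := ⟨hr.1.le, hr.2.le.trans hs.2⟩
          have h3 := hγ.norm_mfderivWithin hV hT hr'
          rw [mfderivWithin_of_mem_nhds (Icc_mem_nhds hr.1 (hr.2.trans_le hs.2))] at h3
          rw [← ofReal_norm]
          exact ENNReal.ofReal_le_ofReal (h3.trans_le (hK r hr'))
      _ = ENNReal.ofReal (K * s) := by
          rw [setLIntegral_const, Real.volume_Ioo, sub_zero, ENNReal.ofReal_mul hK0]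
  rw [edist_dist] at h1
  exact (ENNReal.ofReal_le_ofReal_iff (mul_nonneg hK0 hs.1)).1 (h1.trans h2)

/-- By conservation of energy the squared momentum grows by at most `2 t²` times the oscillation of
`V`, which is at most `2 C`. -/
theorem IsClassicalPath.norm_lt {t T κ C K : ℝ} {γ : ℝ → CotangentBundle E M}
    (hγ : IsClassicalPath (scaledHamiltonian E V t) T γ) (hC : ∀ x, |V x| ≤ C)
    (h0 : ‖(γ 0).2‖ < κ) (hK : 0 < K) (ht : κ ^ 2 + 4 * t ^ 2 * C < K ^ 2) {s : ℝ}
    (hs : s ∈ Icc 0 T) : ‖(γ s).2‖ < K := by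
  have h1 := hγ.norm_sq_eq hV hs
  have h2 : V (γ 0).proj - V (γ s).proj ≤ 2 * C := by
    have a1 := (abs_le.1 (hC (γ 0).proj)).2
    have a2 := (abs_le.1 (hC (γ s).proj)).1
    linarith
  have h3 : ‖(γ 0).2‖ ^ 2 ≤ κ ^ 2 := by
    have h00 := norm_nonneg (γ 0).2
    nlinarith
  have h4 : 2 * t ^ 2 * (V (γ 0).proj - V (γ s).proj) ≤ 2 * t ^ 2 * (2 * C) :=
    mul_le_mul_of_nonneg_left h2 (by positivity)
  refine lt_of_pow_lt_pow_left₀ 2 hK.le ?_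
  linarith

omit hV in
theorem norm_momCoord_le (c : M) (z : CotangentBundle E M) :
    ‖momCoord c z‖ ≤
      ‖z.2‖ * ‖(trivializationAt E (TangentSpace 𝓘(ℝ, E)) c).symmL ℝ z.proj‖ :=
  ContinuousLinearMap.opNorm_comp_le _ _

/-- The coordinates of a classical path, as curves. -/
theorem IsClassicalPath.continuousOn_coords {t T : ℝ} {γ : ℝ → CotangentBundle E M}
    (hγ : IsClassicalPath (scaledHamiltonian E V t) T γ) {c : M}
    (hc : ∀ s ∈ Icc 0 T, (γ s).proj ∈ (chartAt E c).source) :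
    ContinuousOn (fun s ↦ posCoord c (γ s)) (Icc 0 T) ∧
      ContinuousOn (fun s ↦ momCoord c (γ s)) (Icc 0 T) :=
  ⟨fun s hs ↦ (hγ.isCoordSolutionAt hV hs (hc s hs)).pos.continuousWithinAt,
    fun s hs ↦ (hγ.isCoordSolutionAt hV hs (hc s hs)).mom.continuousWithinAt⟩

/-- Small solutions of the coordinate equations over the chart at `c` are described by a smooth
family `ψ`, which contains all classical paths with small initial momentum. -/
structure IsLocalSolutionFamily (V : M → ℝ) (c : M)
    (ψ : ℝ × E × E → C(I, E) × C(I, E →L[ℝ] ℝ)) (κ : ℝ) : Prop where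
  pos : 0 < κ
  contDiffAt : ∀ᶠ z in 𝓝 (0, extChartAt 𝓘(ℝ, E) c c, extChartAt 𝓘(ℝ, E) c c), ContDiffAt ℝ ∞ ψ z
  rest : ∀ᶠ u in 𝓝 (extChartAt 𝓘(ℝ, E) c c), ψ (0, u, u) = (constCurve E u, 0)
  mem : ∀ᶠ z in 𝓝 (0, extChartAt 𝓘(ℝ, E) c c, extChartAt 𝓘(ℝ, E) c c),
    ∀ s, tripleCurve E _ (z.1, ψ z) s ∈ coordDomain E c
  solution : ∃ k : E ≃L[ℝ] (E →L[ℝ] ℝ),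
    ∀ᶠ z in 𝓝 (0, extChartAt 𝓘(ℝ, E) c c, extChartAt 𝓘(ℝ, E) c c),
      boundaryValueMap (coordVelocity c) (coordForce V c) (k : E →L[ℝ] E →L[ℝ] ℝ) (z, ψ z) = 0
  unique : ∀ᶠ z in 𝓝 ((0 : ℝ), c), ∀ γ : ℝ → CotangentBundle E M,
    IsClassicalPath (scaledHamiltonian E V z.1) 1 γ → (γ 0).proj = z.2 → ‖(γ 0).2‖ < κ →
      ∀ s ∈ Icc (0 : ℝ) 1, (γ s).proj ∈ (chartAt E c).source ∧
        posCoord c (γ s) = extendCurve (ψ (z.1, posCoord c (γ 1), posCoord c (γ 0))).1 s ∧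
        momCoord c (γ s) = extendCurve (ψ (z.1, posCoord c (γ 1), posCoord c (γ 0))).2 s

/-- The implicit function theorem gives uniqueness only among curves uniformly close to the rest
solution. The bounds on momentum and distance show that every classical path starting near `c` with
small momentum, for small `t`, has coordinates in that neighbourhood, wherever it ends. -/
theorem exists_isLocalSolutionFamily [IsRiemannianManifold 𝓘(ℝ, E) M] {C : ℝ}
    (hC : ∀ x, |V x| ≤ C) (c : M) : ∃ ψ κ, IsLocalSolutionFamily (E := E) V c ψ κ := by
  set u := extChartAt 𝓘(ℝ, E) c c with hu_def
  have hu : u ∈ (extChartAt 𝓘(ℝ, E) c).target := mem_extChartAt_target c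
  obtain ⟨g, hg⟩ := sharpCoord_isInvertible hu
  obtain ⟨ψ, hψ0, hψd, hψ⟩ := exists_smooth_boundaryValue_solution (isOpen_coordDomain c)
    (contDiffOn_coordVelocity c) (contDiffOn_coordForce hV c) g (u := u) hu
    (coordVelocity_rest hV c 0 u) (coordForce_rest hV hu)
    (fun v ↦ by rw [fderiv_coordVelocity_rest hV hu, ← hg]; rfl) (fderiv_coordForce_rest hV hu)
  have hψc : ContinuousAt ψ (0, u, u) := hψd.self_of_nhds.continuousAt
  have hpair : Tendsto (fun z ↦ (z, ψ z)) (𝓝 (0, u, u)) (𝓝 ((0, u, u), (constCurve E u, 0))) := by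
    have : ContinuousAt (fun z ↦ (z, ψ z)) (0, u, u) := continuousAt_id.prodMk hψc
    have h := this.tendsto
    rwa [hψ0] at h
  obtain ⟨ε, hε, hball⟩ := Metric.eventually_nhds_iff.1 hψ
  have : IsContinuousRiemannianBundle E (fun x : M ↦ TangentSpace 𝓘(ℝ, E) x) := by
    obtain ⟨G, hG, hG'⟩ := ‹IsContMDiffRiemannianBundle 𝓘(ℝ, E) ∞ E
      (fun x : M ↦ TangentSpace 𝓘(ℝ, E) x)›.exists_contMDiff
    exact ⟨G, hG.continuous, hG'⟩
  obtain ⟨B, hB, hBn⟩ := eventually_norm_symmL_trivializationAt_lt E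
    (fun x : M ↦ TangentSpace 𝓘(ℝ, E) x) c
  have hnear : ∀ᶠ x in 𝓝 c, x ∈ (chartAt E c).source ∧ dist (extChartAt 𝓘(ℝ, E) c x) u < ε ∧
      ‖(trivializationAt E (TangentSpace 𝓘(ℝ, E)) c).symmL ℝ x‖ < B :=
    Filter.Eventually.and ((chartAt E c).open_source.mem_nhds (mem_chart_source E c))
      (((continuousAt_extChartAt c).eventually (Metric.ball_mem_nhds _ hε)).and hBn)
  obtain ⟨r, hr, hrball⟩ := Metric.eventually_nhds_iff.1 hnear
  -- `K` bounds the momentum on [0, 1]. A path starting within `r / 2` of `c` then stays in the ball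
  -- of radius `r`, and its momentum coordinates stay below `K * B < ε`.
  obtain ⟨K, hK, hK1, hK2⟩ : ∃ K > 0, K < r / 2 ∧ K * B < ε := by
    refine ⟨min (r / 4) (ε / (2 * B)), by positivity, ?_, ?_⟩
    · exact (min_le_left _ _).trans_lt (by linarith)
    · calc _ ≤ ε / (2 * B) * B := by gcongr; exact min_le_right _ _
        _ = ε / 2 := by field_simp
        _ < ε := by linarith
  refine ⟨ψ, K / 2, by positivity, hψd, ?_, ?_, ⟨g.symm, ?_⟩, ?_⟩
  · have hcont : Tendsto (fun v ↦ (((0, v, v), (constCurve E v, 0)) :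
        (ℝ × E × E) × C(I, E) × C(I, E →L[ℝ] ℝ))) (𝓝 u)
        (𝓝 ((0, u, u), (constCurve E u, 0))) := by
      have : Continuous (fun v ↦ (((0, v, v), (constCurve E v, 0)) :
        (ℝ × E × E) × C(I, E) × C(I, E →L[ℝ] ℝ))) := by fun_prop
      exact this.tendsto u
    filter_upwards [hcont.eventually hψ, (isOpen_extChartAt_target c).mem_nhds hu] with v hv hvt
    refine hv.1 ?_
    have hmem : ∀ s, tripleCurve E (E →L[ℝ] ℝ) (0, constCurve E v, 0) s ∈ coordDomain E c :=
      fun s ↦ by rw [tripleCurve_apply]; exact hvt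
    have e1 : superpos (coordVelocity c) (tripleCurve E (E →L[ℝ] ℝ) (0, constCurve E v, 0)) = 0 := by
      ext s
      rw [superpos_apply_of_continuousOn (contDiffOn_coordVelocity c).continuousOn hmem,
        tripleCurve_apply]
      exact coordVelocity_rest hV c 0 v
    have e2 : superpos (coordForce V c) (tripleCurve E (E →L[ℝ] ℝ) (0, constCurve E v, 0)) = 0 := by
      ext1 s
      rw [superpos_apply_of_continuousOn (contDiffOn_coordForce hV c).continuousOn hmem,
        tripleCurve_apply]
      exact coordForce_rest hV hvt
    simp [boundaryValueMap, e1, e2]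
  · have h1 := (isOpen_boundaryValueDomain (E := E) (F := E →L[ℝ] ℝ)
      (isOpen_coordDomain c)).mem_nhds (x := ((0, u, u), (constCurve E u, 0)))
      (fun s ↦ by rw [tripleCurve_apply]; exact hu)
    exact hpair.eventually h1
  · filter_upwards [hpair.eventually hψ] with z hz using hz.2 rfl
  -- Initial momentum below `K / 2` leaves room for the potential to add `4 t² C` without the
  -- momentum reaching `K`.
  · have ht : ∀ᶠ t : ℝ in 𝓝 0, |t| < ε ∧ (K / 2) ^ 2 + 4 * t ^ 2 * C < K ^ 2 := by
      have c1 : ContinuousAt (fun t : ℝ ↦ |t|) 0 := by fun_prop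
      have c2 : ContinuousAt (fun t : ℝ ↦ (K / 2) ^ 2 + 4 * t ^ 2 * C) 0 := by fun_prop
      refine (c1.eventually (gt_mem_nhds (by simpa using hε))).and
        (c2.eventually (gt_mem_nhds ?_))
      have : 0 < K ^ 2 := by positivity
      norm_num
      nlinarith
    have hy : ∀ᶠ y in 𝓝 c, dist y c < r / 2 := Metric.ball_mem_nhds c (by positivity)
    rw [nhds_prod_eq]
    filter_upwards [ht.prod_mk hy] with ⟨t, y⟩ ⟨⟨ht1, ht2⟩, hy⟩ γ hγ hγ0 hγn
    have hn : ∀ s ∈ Icc (0 : ℝ) 1, ‖(γ s).2‖ < K := fun s hs ↦ hγ.norm_lt hV hC hγn hK ht2 hs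
    have hd : ∀ s ∈ Icc (0 : ℝ) 1, dist (γ s).proj c < r := fun s hs ↦ by
      have h1 := hγ.dist_le hV one_pos (fun s hs ↦ (hn s hs).le) hs
      have h2 : K * s ≤ K := mul_le_of_le_one_right hK.le hs.2
      have h3 := dist_triangle_left (γ s).proj c (γ 0).proj
      rw [hγ0] at h1 h3
      simp only at hy h1 h3
      linarith
    have hsrc : ∀ s ∈ Icc (0 : ℝ) 1, (γ s).proj ∈ (chartAt E c).source :=
      fun s hs ↦ (hrball (hd s hs)).1
    obtain ⟨hQ, hP⟩ := hγ.continuousOn_coords hV hsrc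
    have hsol := fun s (hs : s ∈ Icc (0 : ℝ) 1) ↦ hγ.isCoordSolutionAt hV hs (hsrc s hs)
    have h0 := boundaryValueMap_restrictCurve (contDiffOn_coordVelocity c).continuousOn
      (contDiffOn_coordForce hV c).continuousOn g.symm (t := t) hQ hP
      (fun s hs ↦ posCoord_mem_target (hsrc s hs)) (fun s hs ↦ (hsol s hs).pos)
      (fun s hs ↦ (hsol s hs).mom)
    have hpos : ∀ s ∈ Icc (0 : ℝ) 1, dist (posCoord c (γ s)) u < ε :=
      fun s hs ↦ (hrball (hd s hs)).2.1
    have hmom : ∀ s ∈ Icc (0 : ℝ) 1, dist (momCoord c (γ s)) 0 < ε := fun s hs ↦ by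
      rw [dist_zero_right]
      refine (norm_momCoord_le c (γ s)).trans_lt (lt_of_le_of_lt ?_ hK2)
      gcongr
      · exact (hn s hs).le
      · exact (hrball (hd s hs)).2.2.le
    have hclose : dist (((t, posCoord c (γ 1), posCoord c (γ 0)),
        (restrictCurve _ hQ, restrictCurve _ hP)) : (ℝ × E × E) × C(I, E) × C(I, E →L[ℝ] ℝ))
        ((0, u, u), (constCurve E u, 0)) < ε := by
      simp only [Prod.dist_eq, max_lt_iff]
      refine ⟨⟨by simpa using ht1, hpos 1 (by simp), hpos 0 (by simp)⟩, ?_, ?_⟩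
      · exact (ContinuousMap.dist_lt_iff hε).2 fun s ↦ hpos s s.2
      · exact (ContinuousMap.dist_lt_iff hε).2 fun s ↦ hmom s s.2
    have heq := (hball hclose).1 h0
    intro s hs
    refine ⟨hsrc s hs, ?_, ?_⟩
    · simp only at heq ⊢
      rw [heq, extendCurve_restrictCurve hQ hs]
    · simp only at heq ⊢
      rw [heq, extendCurve_restrictCurve hP hs]

end PathLength

end

noncomputable section

set_option linter.unusedSectionVars false

/-! ### Parameters whose low energy path belongs to a local family. -/

section RegularPoints

open Filter Topology

variable {E : Type*} [NormedAddCommGroup E] [NormedSpace ℝ E] [FiniteDimensional ℝ E]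
  {M : Type*} [MetricSpace M] [ChartedSpace E M] [IsManifold 𝓘(ℝ, E) ∞ M]
  [RiemannianBundle (fun x : M ↦ TangentSpace 𝓘(ℝ, E) x)]
  [IsContMDiffRiemannianBundle 𝓘(ℝ, E) ∞ E (fun x : M ↦ TangentSpace 𝓘(ℝ, E) x)]
  {V : M → ℝ} (hV : ContMDiff 𝓘(ℝ, E) 𝓘(ℝ, ℝ) ∞ V)

/-- The coordinates of the parameters `(t, x, y)` in the chart at `c`. -/
def chartParam (E : Type*) [NormedAddCommGroup E] [NormedSpace ℝ E] {M : Type*}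
    [TopologicalSpace M] [ChartedSpace E M] (c : M) (z : ℝ × M × M) : ℝ × E × E :=
  (z.1, extChartAt 𝓘(ℝ, E) c z.2.1, extChartAt 𝓘(ℝ, E) c z.2.2)

/-- The path with coordinates `ψ` over the chart at `c`. -/
def familyPath (c : M) (ψ : ℝ × E × E → C(unitInterval, E) × C(unitInterval, E →L[ℝ] ℝ)) (z : ℝ × M × M) (s : ℝ) :
    CotangentBundle E M :=
  ofCoord c (extendCurve (ψ (chartParam E c z)).1 s) (extendCurve (ψ (chartParam E c z)).2 s)

/-- The parameters at which the family `ψ` describes the unique low energy path. -/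
structure IsRegularFor (V : M → ℝ) (c : M) (ψ : ℝ × E × E → C(unitInterval, E) × C(unitInterval, E →L[ℝ] ℝ))
    (k : E ≃L[ℝ] (E →L[ℝ] ℝ)) (κ μ : ℝ) (z : ℝ × M × M) : Prop where
  left : z.2.1 ∈ (chartAt E c).source
  right : z.2.2 ∈ (chartAt E c).source
  contDiffAt : ContDiffAt ℝ ∞ ψ (chartParam E c z)
  mem : ∀ s, tripleCurve E _ (z.1, ψ (chartParam E c z)) s ∈ coordDomain E c
  solution : ∀ᶠ w in 𝓝 (chartParam E c z),
    boundaryValueMap (coordVelocity c) (coordForce V c) (k : E →L[ℝ] E →L[ℝ] ℝ) (w, ψ w) = 0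
  unique : ∀ γ : ℝ → CotangentBundle E M,
    IsClassicalPath (scaledHamiltonian E V z.1) 1 γ → (γ 0).proj = z.2.2 → ‖(γ 0).2‖ < κ →
      ∀ s ∈ Icc (0 : ℝ) 1, (γ s).proj ∈ (chartAt E c).source ∧
        posCoord c (γ s) = extendCurve (ψ (z.1, posCoord c (γ 1), posCoord c (γ 0))).1 s ∧
        momCoord c (γ s) = extendCurve (ψ (z.1, posCoord c (γ 1), posCoord c (γ 0))).2 s
  small : (ψ (chartParam E c z)).2 0 (sharpCoord c ((ψ (chartParam E c z)).1 0)
    ((ψ (chartParam E c z)).2 0)) < μ ^ 2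

theorem continuousAt_chartParam {c : M} {z : ℝ × M × M} (h1 : z.2.1 ∈ (chartAt E c).source)
    (h2 : z.2.2 ∈ (chartAt E c).source) : ContinuousAt (chartParam E c) z := by
  have e1 : ContinuousAt (extChartAt 𝓘(ℝ, E) c) z.2.1 :=
    continuousAt_extChartAt' (by rwa [extChartAt_source])
  have e2 : ContinuousAt (extChartAt 𝓘(ℝ, E) c) z.2.2 :=
    continuousAt_extChartAt' (by rwa [extChartAt_source])
  exact continuousAt_fst.prodMk
    ((e1.comp (f := fun z : ℝ × M × M ↦ z.2.1) (by fun_prop)).prodMk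
      (e2.comp (f := fun z : ℝ × M × M ↦ z.2.2) (by fun_prop)))

/-- The neighbourhood of `c` is independent of `μ`; only the neighbourhood of `(0, c', c')` shrinks
with it. At `(0, c', c')` the family is at rest, so by continuity its initial momentum is below `μ`
nearby. -/
theorem IsLocalSolutionFamily.exists_eventually_isRegularFor {c : M}
    {ψ : ℝ × E × E → C(unitInterval, E) × C(unitInterval, E →L[ℝ] ℝ)} {κ : ℝ} (h : IsLocalSolutionFamily V c ψ κ) :
    ∃ k, ∀ᶠ c' in 𝓝 c, ∀ μ > 0, ∀ᶠ z in 𝓝 ((0 : ℝ), c', c'), IsRegularFor V c ψ k κ μ z := by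
  obtain ⟨k, hk⟩ := h.solution
  refine ⟨k, ?_⟩
  have hsrc : ∀ᶠ x in 𝓝 c, x ∈ (chartAt E c).source :=
    (chartAt E c).open_source.mem_nhds (mem_chart_source E c)
  have hφ : ContinuousAt (chartParam E c) (0, c, c) :=
    continuousAt_chartParam (mem_chart_source E c) (mem_chart_source E c)
  have hleft : ∀ᶠ z in 𝓝 ((0 : ℝ), c, c), z.2.1 ∈ (chartAt E c).source :=
    (show ContinuousAt (fun z : ℝ × M × M ↦ z.2.1) (0, c, c) by fun_prop).eventually hsrc
  have hright : ∀ᶠ z in 𝓝 ((0 : ℝ), c, c), z.2.2 ∈ (chartAt E c).source :=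
    (show ContinuousAt (fun z : ℝ × M × M ↦ z.2.2) (0, c, c) by fun_prop).eventually hsrc
  have huniq := ((show ContinuousAt (fun z : ℝ × M × M ↦ (z.1, z.2.2)) (0, c, c) by
    fun_prop).eventually h.unique).eventually_nhds
  have hdiag : ContinuousAt (fun c' : M ↦ ((0 : ℝ), c', c')) c := by fun_prop
  filter_upwards [hsrc, hdiag.eventually hleft.eventually_nhds,
    hdiag.eventually hright.eventually_nhds,
    hdiag.eventually (hφ.eventually h.contDiffAt).eventually_nhds,
    hdiag.eventually (hφ.eventually h.mem).eventually_nhds,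
    hdiag.eventually (hφ.eventually hk.eventually_nhds).eventually_nhds,
    hdiag.eventually huniq,
    (continuousAt_extChartAt (I := 𝓘(ℝ, E)) c).eventually h.rest] with c' hc' a1 a2 a3 a4 a5 a6 a7
    μ hμ
  have hψ : ContinuousAt (fun z ↦ ψ (chartParam E c z)) (0, c', c') :=
    a3.self_of_nhds.continuousAt.comp (continuousAt_chartParam hc' hc')
  have h7 : ψ (chartParam E c (0, c', c')) = (constCurve E (extChartAt 𝓘(ℝ, E) c c'), 0) := a7
  have hK : ContinuousAt (sharpCoord c) ((ψ (chartParam E c (0, c', c'))).1 0) := by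
    rw [h7]
    exact (contDiffOn_sharpCoord c).continuousOn.continuousAt
      ((isOpen_extChartAt_target c).mem_nhds (extChartAt_mem_target hc'))
  have hp : ContinuousAt (fun z ↦ (ψ (chartParam E c z)).2 0) (0, c', c') :=
    (evalCurve (E →L[ℝ] ℝ) 0).continuous.continuousAt.comp hψ.snd
  have hq : ContinuousAt (fun z ↦ (ψ (chartParam E c z)).1 0) (0, c', c') :=
    (evalCurve E 0).continuous.continuousAt.comp hψ.fst
  have hsmall : ∀ᶠ z in 𝓝 ((0 : ℝ), c', c'), (ψ (chartParam E c z)).2 0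
      (sharpCoord c ((ψ (chartParam E c z)).1 0) ((ψ (chartParam E c z)).2 0)) < μ ^ 2 := by
    have hc : ContinuousAt (fun z ↦ (ψ (chartParam E c z)).2 0
      (sharpCoord c ((ψ (chartParam E c z)).1 0) ((ψ (chartParam E c z)).2 0))) (0, c', c') :=
      hp.clm_apply ((ContinuousAt.comp (f := fun z ↦ (ψ (chartParam E c z)).1 0)
        (x := ((0 : ℝ), c', c')) hK hq).clm_apply hp)
    refine hc.eventually (gt_mem_nhds ?_)
    simp only [h7]
    simpa using pow_pos hμ 2
  filter_upwards [a1, a2, a3, a4, a5, a6, hsmall] with z b1 b2 b3 b4 b5 b6 b7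
  exact ⟨b1, b2, b3, b4, b5, b6, b7⟩

variable {c : M} {ψ : ℝ × E × E → C(unitInterval, E) × C(unitInterval, E →L[ℝ] ℝ)} {k : E ≃L[ℝ] (E →L[ℝ] ℝ)}
  {κ μ : ℝ} {z : ℝ × M × M}

include hV

theorem IsRegularFor.familyPath_mem (h : IsRegularFor V c ψ k κ μ z) (hμ : 0 < μ) :
    familyPath c ψ z ∈ lowEnergyPaths (scaledHamiltonian E V z.1) 1 z.2.1 z.2.2 μ := by
  obtain ⟨t, x, y⟩ := z
  set Z := ψ (chartParam E c (t, x, y)) with hZ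
  have hmem : ∀ s, tripleCurve E _ (t, Z) s ∈ coordDomain E c := h.mem
  have htgt : ∀ s, extendCurve Z.1 s ∈ (extChartAt 𝓘(ℝ, E) c).target := fun s ↦ by
    have := hmem (projIcc 0 1 zero_le_one s)
    rwa [tripleCurve_apply] at this
  obtain ⟨hx, hq, hp⟩ := (boundaryValueMap_eq_zero_iff k t (extChartAt 𝓘(ℝ, E) c x)
    (extChartAt 𝓘(ℝ, E) c y) Z.1 Z.2).1 h.solution.self_of_nhds
  have hy : Z.1 0 = extChartAt 𝓘(ℝ, E) c y := by simpa using hq 0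
  have hpos : ∀ s, posCoord c (familyPath c ψ (t, x, y) s) = extendCurve Z.1 s :=
    fun s ↦ posCoord_ofCoord (htgt s) _
  have hmom : ∀ s, momCoord c (familyPath c ψ (t, x, y) s) = extendCurve Z.2 s :=
    fun s ↦ momCoord_ofCoord (htgt s) _
  have hproj : ∀ s, (familyPath c ψ (t, x, y) s).proj ∈ (chartAt E c).source :=
    fun s ↦ symm_mem_chart_source (htgt s)
  have e0 : extendCurve Z.1 0 = Z.1 0 := extendCurve_coe Z.1 0
  have e0' : extendCurve Z.2 0 = Z.2 0 := extendCurve_coe Z.2 0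
  have e1 : extendCurve Z.1 1 = Z.1 1 := extendCurve_coe Z.1 1
  refine ⟨isClassicalPath_of_isCoordSolutionAt hV ?_ fun s hs ↦ ⟨c, hproj s, ?_, ?_⟩, ?_, ?_, ?_⟩
  · exact (continuousOn_extChartAt_symm (I := 𝓘(ℝ, E)) c).comp
      (continuous_extendCurve Z.1).continuousOn fun s _ ↦ htgt s
  · simp only [hpos, hmom]
    have := hasDerivWithinAt_of_eq_primitive hq hs
    rwa [extendCurve_superpos (Z := Z) (contDiffOn_coordVelocity c).continuousOn hmem] at this
  · simp only [hpos, hmom]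
    have := hasDerivWithinAt_of_eq_primitive hp hs
    rwa [extendCurve_superpos (Z := Z) (contDiffOn_coordForce hV c).continuousOn hmem] at this
  · change (extChartAt 𝓘(ℝ, E) c).symm (extendCurve Z.1 0) = y
    rw [e0, hy, extChartAt_symm_apply h.right]
  · change (extChartAt 𝓘(ℝ, E) c).symm (extendCurve Z.1 1) = x
    rw [e1, hx, extChartAt_symm_apply h.left]
  · have hn := norm_sq_eq_sharpCoord (hproj 0)
    rw [hpos, hmom, e0, e0'] at hn
    have hs := h.small
    rw [← hZ, ← hn] at hs
    exact lt_of_pow_lt_pow_left₀ 2 hμ.le hs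

omit hV in
theorem IsRegularFor.coords_eq (h : IsRegularFor V c ψ k κ μ z) (hμ : μ ≤ κ)
    {γ : ℝ → CotangentBundle E M}
    (hγ : γ ∈ lowEnergyPaths (scaledHamiltonian E V z.1) 1 z.2.1 z.2.2 μ)
    {s : ℝ} (hs : s ∈ Icc (0 : ℝ) 1) : (γ s).proj ∈ (chartAt E c).source ∧
        posCoord c (γ s) = extendCurve (ψ (chartParam E c z)).1 s ∧
        momCoord c (γ s) = extendCurve (ψ (chartParam E c z)).2 s := by
  obtain ⟨h1, h2, h3, h4⟩ := hγ
  have := h.unique γ h1 h2 (h4.trans_le hμ) s hs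
  simp only [posCoord, h2, h3] at this
  exact this

theorem IsRegularFor.hasUniqueLowEnergyPath (h : IsRegularFor V c ψ k κ μ z) (hμ : 0 < μ)
    (hμκ : μ ≤ κ) : HasUniqueLowEnergyPath (scaledHamiltonian E V z.1) 1 z.2.1 z.2.2 μ := by
  refine ⟨_, h.familyPath_mem hV hμ, fun γ hγ s hs ↦ ?_⟩
  obtain ⟨h1, h2, h3⟩ := h.coords_eq hμκ hγ hs
  obtain ⟨h1', h2', h3'⟩ := h.coords_eq hμκ (h.familyPath_mem hV hμ) hs
  exact coords_injOn h1 h1' (h2.trans h2'.symm) (h3.trans h3'.symm)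

/-- The chosen path agrees with any other only on [0, 1]. Expressing the action by momenta removes
the derivative of the base curve, so agreement there suffices. -/
theorem HasUniqueLowEnergyPath.scaledAction_eq {t : ℝ} {x y : M}
    (h : HasUniqueLowEnergyPath (scaledHamiltonian E V t) 1 x y μ) {γ : ℝ → CotangentBundle E M}
    (hγ : γ ∈ lowEnergyPaths (scaledHamiltonian E V t) 1 x y μ) :
    scaledAction E V μ t x y
      = ∫ s in (0 : ℝ)..1, (‖(γ s).2‖ ^ 2 / 2 - t ^ 2 * V (γ s).proj) := by
  have hne : (lowEnergyPaths (scaledHamiltonian E V t) 1 x y μ).Nonempty := ⟨γ, hγ⟩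
  rw [scaledAction, dif_pos hne, hne.some_mem.1.action_eq hV one_pos]
  refine intervalIntegral.integral_congr fun s hs ↦ ?_
  rw [uIcc_of_le zero_le_one] at hs
  obtain ⟨γ₀, -, hu⟩ := h
  have e : hne.some s = γ s := (hu _ hne.some_mem hs).trans (hu γ hγ hs).symm
  exact congrArg (fun w : CotangentBundle E M ↦ ‖w.2‖ ^ 2 / 2 - t ^ 2 * V w.proj) e

/-- The Lagrangian in canonical coordinates. -/
def coordLagrangian (V : M → ℝ) (c : M) (z : ℝ × E × (E →L[ℝ] ℝ)) : ℝ :=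
  z.2.2 (coordVelocity c z) - coordHamiltonian V c z

theorem contDiffOn_coordLagrangian :
    ContDiffOn ℝ ∞ (coordLagrangian (E := E) V c) (coordDomain E c) :=
  ContDiffOn.sub (ContDiffOn.clm_apply (contDiff_snd.comp contDiff_snd).contDiffOn
    (contDiffOn_coordVelocity c)) (contDiffOn_coordHamiltonian hV c)

theorem IsRegularFor.scaledAction_eq (h : IsRegularFor V c ψ k κ μ z) (hμ : 0 < μ)
    (hμκ : μ ≤ κ) : scaledAction E V μ z.1 z.2.1 z.2.2
      = curveAction (coordLagrangian V c) (z.1, ψ (chartParam E c z)) := by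
  rw [(h.hasUniqueLowEnergyPath hV hμ hμκ).scaledAction_eq hV (h.familyPath_mem hV hμ),
    curveAction_eq_integral (contDiffOn_coordLagrangian hV).continuousOn h.mem]
  refine intervalIntegral.integral_congr fun s hs ↦ ?_
  rw [uIcc_of_le zero_le_one] at hs
  obtain ⟨h1, h2, h3⟩ := h.coords_eq hμκ (h.familyPath_mem hV hμ) hs
  have hn := norm_sq_eq_sharpCoord h1
  rw [← h2, ← h3]
  rw [coordLagrangian, coordHamiltonian_eq V (posCoord_mem_target h1), hn, Function.comp_apply,
    coordVelocity]
  simp only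
  rw [posCoord, extChartAt_symm_apply h1]
  ring

end RegularPoints

end

noncomputable section

set_option linter.unusedSectionVars false

/-! ### Smoothness and differentials of the action; the uniform tube. -/

section RegularPoints

open Filter Topology

variable {E : Type*} [NormedAddCommGroup E] [NormedSpace ℝ E] [FiniteDimensional ℝ E]
  {M : Type*} [MetricSpace M] [ChartedSpace E M] [IsManifold 𝓘(ℝ, E) ∞ M]
  [RiemannianBundle (fun x : M ↦ TangentSpace 𝓘(ℝ, E) x)]
  [IsContMDiffRiemannianBundle 𝓘(ℝ, E) ∞ E (fun x : M ↦ TangentSpace 𝓘(ℝ, E) x)]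

/-- A function on `M` is differentiated in coordinates. -/
theorem hasMFDerivAt_of_hasFDerivAt_coord {f : M → ℝ} {W : E → ℝ} {c : M}
    {ζ : CotangentBundle E M} (hζ : ζ.proj ∈ (chartAt E c).source)
    (hf : ∀ᶠ x in 𝓝 ζ.proj, f x = W (extChartAt 𝓘(ℝ, E) c x))
    (hW : HasFDerivAt W (momCoord c ζ) (posCoord c ζ)) :
    HasMFDerivAt 𝓘(ℝ, E) 𝓘(ℝ, ℝ) f ζ.proj ζ.2 := by
  set x := ζ.proj with hx
  have hxs : x ∈ (chartAt E x).source := mem_chart_source E x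
  have hcont : ContinuousAt f x := by
    have h1 : ContinuousAt (fun x ↦ W (extChartAt 𝓘(ℝ, E) c x)) x :=
      ContinuousAt.comp (f := extChartAt 𝓘(ℝ, E) c) (g := W) hW.continuousAt
        (continuousAt_extChartAt' (by rwa [extChartAt_source]))
    exact h1.congr (hf.mono fun _ h ↦ h.symm)
  refine ⟨hcont, ?_⟩
  have hτ : HasFDerivAt (transitionMap E c x) (fderiv ℝ (transitionMap E c x)
      (extChartAt 𝓘(ℝ, E) x x)) (extChartAt 𝓘(ℝ, E) x x) :=
    ((contDiffAt_transitionMap hζ hxs).differentiableAt (by simp)).hasFDerivAt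
  have hW' : HasFDerivAt W (momCoord c ζ) (transitionMap E c x (extChartAt 𝓘(ℝ, E) x x)) := by
    rw [transitionMap_apply hxs]; exact hW
  have h1 := (hW'.comp _ hτ).hasFDerivWithinAt (s := range 𝓘(ℝ, E))
  have h2 : momCoord c ζ ∘L fderiv ℝ (transitionMap E c x) (extChartAt 𝓘(ℝ, E) x x)
      = momCoord x ζ := (momCoord_change hζ hxs).symm
  rw [h2] at h1
  have h3 : ∀ a : E, momCoord x ζ a = ζ.2 a := fun a ↦ congrArg ζ.2 (tangent_symmL_self x a)
  have h4 := h1.congr_fderiv (g' := (ζ.2 : E →L[ℝ] ℝ)) (ContinuousLinearMap.ext h3)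
  refine h4.congr_of_eventuallyEq ?_ ?_
  · refine nhdsWithin_le_nhds ?_
    have hc := (continuousAt_extChartAt_symm (I := 𝓘(ℝ, E)) x)
    have hc' : Tendsto (extChartAt 𝓘(ℝ, E) x).symm (𝓝 (extChartAt 𝓘(ℝ, E) x x)) (𝓝 x) := by
      have := hc.tendsto
      rwa [extChartAt_symm_apply hxs] at this
    filter_upwards [hc'.eventually hf] with u hu using hu
  · have := hf.self_of_nhds
    simp only [writtenInExtChartAt, Function.comp_apply, extChartAt_symm_apply hxs]
    rw [transitionMap_apply hxs, ← this]
    rfl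

variable {V : M → ℝ} (hV : ContMDiff 𝓘(ℝ, E) 𝓘(ℝ, ℝ) ∞ V)

variable (E) in
/-- The parameters with a unique low energy path, near which the action is smooth with first
variation given by the momenta at the end points. -/
structure IsRegularPoint (V : M → ℝ) (μ : ℝ) (z : ℝ × M × M) : Prop where
  unique : HasUniqueLowEnergyPath (scaledHamiltonian E V z.1) 1 z.2.1 z.2.2 μ
  contMDiffAt : ContMDiffAt (𝓘(ℝ, ℝ).prod (𝓘(ℝ, E).prod 𝓘(ℝ, E))) 𝓘(ℝ, ℝ) ∞
    (fun z : ℝ × M × M ↦ scaledAction E V μ z.1 z.2.1 z.2.2) z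
  hasMFDerivAt_left : ∀ γ ∈ lowEnergyPaths (scaledHamiltonian E V z.1) 1 z.2.1 z.2.2 μ,
    HasMFDerivAt 𝓘(ℝ, E) 𝓘(ℝ, ℝ) (fun x ↦ scaledAction E V μ z.1 x z.2.2) (γ 1).proj (γ 1).2
  hasMFDerivAt_right : ∀ γ ∈ lowEnergyPaths (scaledHamiltonian E V z.1) 1 z.2.1 z.2.2 μ,
    HasMFDerivAt 𝓘(ℝ, E) 𝓘(ℝ, ℝ) (fun y ↦ -scaledAction E V μ z.1 z.2.1 y) (γ 0).proj (γ 0).2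

theorem contMDiffAt_chartParam {c : M} {z : ℝ × M × M} (h1 : z.2.1 ∈ (chartAt E c).source)
    (h2 : z.2.2 ∈ (chartAt E c).source) :
    ContMDiffAt (𝓘(ℝ, ℝ).prod (𝓘(ℝ, E).prod 𝓘(ℝ, E))) 𝓘(ℝ, ℝ × E × E) ∞ (chartParam E c) z := by
  have e1 : ContMDiffAt 𝓘(ℝ, E) 𝓘(ℝ, E) ∞ (extChartAt 𝓘(ℝ, E) c) z.2.1 := contMDiffAt_extChartAt' h1
  have e2 : ContMDiffAt 𝓘(ℝ, E) 𝓘(ℝ, E) ∞ (extChartAt 𝓘(ℝ, E) c) z.2.2 := contMDiffAt_extChartAt' h2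
  exact contMDiffAt_fst.prodMk_space
    ((e1.comp z (contMDiffAt_fst.comp z contMDiffAt_snd)).prodMk_space
      (e2.comp z (contMDiffAt_snd.comp z contMDiffAt_snd)))

include hV

/-- Near `z` the action is, in coordinates, the smooth functional `curveAction` composed with `ψ`;
restricting the first variation formula to one end point gives each differential. -/
theorem isRegularPoint_of_eventually_isRegularFor {c : M}
    {ψ : ℝ × E × E → C(unitInterval, E) × C(unitInterval, E →L[ℝ] ℝ)} {k : E ≃L[ℝ] (E →L[ℝ] ℝ)}
    {κ μ : ℝ} {z : ℝ × M × M} (hμ : 0 < μ) (hμκ : μ ≤ κ)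
    (h : ∀ᶠ z' in 𝓝 z, IsRegularFor V c ψ k κ μ z') : IsRegularPoint E V μ z := by
  have hz := h.self_of_nhds
  have hΦ : ∀ᶠ z' in 𝓝 z, scaledAction E V μ z'.1 z'.2.1 z'.2.2
      = curveAction (coordLagrangian V c) (z'.1, ψ (chartParam E c z')) :=
    h.mono fun z' hz' ↦ hz'.scaledAction_eq hV hμ hμκ
  have hL : ContDiffAt ℝ ∞ (curveAction (coordLagrangian V c)) (z.1, ψ (chartParam E c z)) :=
    (contDiffOn_curveAction (isOpen_coordDomain c)
      (contDiffOn_coordLagrangian hV)).contDiffAt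
        (((isOpen_curves_mem (isOpen_coordDomain c)).preimage
          (tripleCurve E (E →L[ℝ] ℝ)).continuous).mem_nhds hz.mem)
  have hpair : ContDiffAt ℝ ∞ (fun w : ℝ × E × E ↦ (w.1, ψ w)) (chartParam E c z) :=
    contDiffAt_fst.prodMk hz.contDiffAt
  have hW : ContDiffAt ℝ ∞ (curveAction (coordLagrangian V c) ∘ fun w : ℝ × E × E ↦ (w.1, ψ w))
      (chartParam E c z) := ContDiffAt.comp _ hL hpair
  have hvar : HasFDerivAt (fun v : E × E ↦ curveAction (coordLagrangian V c) (z.1, ψ (z.1, v)))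
      (((ψ (chartParam E c z)).2 1).comp (.fst ℝ E E)
        - ((ψ (chartParam E c z)).2 0).comp (.snd ℝ E E)) (chartParam E c z).2 := by
    refine hasFDerivAt_curveAction (isOpen_coordDomain c) (contDiffOn_coordVelocity c)
      (contDiffOn_coordForce hV c) (contDiffOn_coordHamiltonian hV c)
      (fun w hw a β ↦ fderiv_coordHamiltonian_apply hV hw a β) k (t := z.1)
      (ψ := fun v ↦ ψ (z.1, v)) (v := (chartParam E c z).2) ?_ hz.mem ?_
    · exact (hz.contDiffAt.differentiableAt (by simp)).comp (chartParam E c z).2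
        ((differentiableAt_const _).prodMk differentiableAt_id)
    · have hc : ContinuousAt (fun v : E × E ↦ (z.1, v)) (chartParam E c z).2 := by fun_prop
      exact hc.eventually hz.solution
  refine ⟨hz.hasUniqueLowEnergyPath hV hμ hμκ, ?_, fun γ hγ ↦ ?_, fun γ hγ ↦ ?_⟩
  · exact (hW.contMDiffAt.comp z (contMDiffAt_chartParam hz.left hz.right)).congr_of_eventuallyEq hΦ
  · obtain ⟨h1, h2, h3⟩ := hz.coords_eq hμκ hγ (right_mem_Icc.2 zero_le_one)
    have hp : (γ 1).proj = z.2.1 := hγ.2.2.1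
    refine hasMFDerivAt_of_hasFDerivAt_coord (c := c) h1
      (W := fun u ↦ curveAction (coordLagrangian V c)
        (z.1, ψ (z.1, u, extChartAt 𝓘(ℝ, E) c z.2.2))) ?_ ?_
    · have hc : ContinuousAt (fun x : M ↦ (z.1, x, z.2.2)) z.2.1 := by fun_prop
      rw [hp]
      exact hc.eventually hΦ
    · have hu : posCoord c (γ 1) = (chartParam E c z).2.1 := by rw [posCoord, hp]; rfl
      rw [hu, h3]
      have h4 := HasFDerivAt.comp (f := fun u : E ↦ (u, extChartAt 𝓘(ℝ, E) c z.2.2))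
        (chartParam E c z).2.1 hvar (hasFDerivAt_prodMk_left _ _)
      refine h4.congr_fderiv (ContinuousLinearMap.ext fun a ↦ ?_)
      rw [show (1 : ℝ) = ((1 : unitInterval) : ℝ) from rfl, extendCurve_coe]
      simp
  · obtain ⟨h1, h2, h3⟩ := hz.coords_eq hμκ hγ (left_mem_Icc.2 zero_le_one)
    have hp : (γ 0).proj = z.2.2 := hγ.2.1
    refine hasMFDerivAt_of_hasFDerivAt_coord (c := c) h1
      (W := fun u ↦ -curveAction (coordLagrangian V c)
        (z.1, ψ (z.1, extChartAt 𝓘(ℝ, E) c z.2.1, u))) ?_ ?_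
    · have hc : ContinuousAt (fun y : M ↦ (z.1, z.2.1, y)) z.2.2 := by fun_prop
      rw [hp]
      exact (hc.eventually hΦ).mono fun y hy ↦ congrArg Neg.neg hy
    · have hu : posCoord c (γ 0) = (chartParam E c z).2.2 := by rw [posCoord, hp]; rfl
      rw [hu, h3]
      have h4 := (HasFDerivAt.comp (f := fun u : E ↦ (extChartAt 𝓘(ℝ, E) c z.2.1, u))
        (chartParam E c z).2.2 hvar (hasFDerivAt_prodMk_right _ _)).neg
      refine h4.congr_fderiv (ContinuousLinearMap.ext fun a ↦ ?_)
      rw [show (0 : ℝ) = ((0 : unitInterval) : ℝ) from rfl, extendCurve_coe]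
      simp

variable [IsRiemannianManifold 𝓘(ℝ, E) M] [CompactSpace M]

/-- Each point of `M` has a neighbourhood with its own momentum bound, and finitely many cover `M`.
Allowing every `μ` up to the bound permits taking the minimum. -/
theorem exists_forall_eventually_isRegularPoint :
    ∃ κ > 0, ∀ c : M, ∀ μ ∈ Ioc 0 κ, ∀ᶠ z in 𝓝 ((0 : ℝ), c, c), IsRegularPoint E V μ z := by
  obtain ⟨C, hC⟩ := isCompact_univ.exists_bound_of_continuousOn hV.continuous.continuousOn
  have key : ∃ κ > 0, ∀ c ∈ (univ : Set M), ∀ μ ∈ Ioc 0 κ,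
      ∀ᶠ z in 𝓝 ((0 : ℝ), c, c), IsRegularPoint E V μ z := by
    refine isCompact_univ.induction_on (p := fun s ↦ ∃ κ > 0, ∀ c ∈ s, ∀ μ ∈ Ioc 0 κ,
      ∀ᶠ z in 𝓝 ((0 : ℝ), c, c), IsRegularPoint E V μ z) ⟨1, one_pos, by simp⟩ ?_ ?_ ?_
    · rintro s t hst ⟨κ, hκ, h⟩
      exact ⟨κ, hκ, fun c hc ↦ h c (hst hc)⟩
    · rintro s t ⟨κ, hκ, h⟩ ⟨κ', hκ', h'⟩
      refine ⟨min κ κ', lt_min hκ hκ', fun c hc μ hμ ↦ ?_⟩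
      rcases hc with hc | hc
      · exact h c hc μ ⟨hμ.1, hμ.2.trans (min_le_left _ _)⟩
      · exact h' c hc μ ⟨hμ.1, hμ.2.trans (min_le_right _ _)⟩
    · intro c _
      obtain ⟨ψ, κ, hψ⟩ := exists_isLocalSolutionFamily (E := E) hV (fun x ↦ hC x (mem_univ x)) c
      obtain ⟨k, hk⟩ := hψ.exists_eventually_isRegularFor
      refine ⟨_, nhdsWithin_le_nhds hk, κ, hψ.pos, fun c' hc' μ hμ ↦ ?_⟩
      filter_upwards [(hc' μ hμ.1).eventually_nhds] with z hz
      exact isRegularPoint_of_eventually_isRegularFor hV hμ.1 hμ.2 hz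
  simpa using key

/-- The regular parameters contain an open neighbourhood of the compact set `{0} × diagonal`, hence
a product neighbourhood. -/
theorem exists_tube_isRegularPoint :
    ∃ μ > 0, ∃ t₀ > 0, ∃ N : Set (M × M), IsOpen N ∧ diagonal M ⊆ N ∧
      ∀ t ∈ Ioo (-t₀) t₀, ∀ x y, (x, y) ∈ N → IsRegularPoint E V μ (t, x, y) := by
  obtain ⟨κ, hκ, h⟩ := exists_forall_eventually_isRegularPoint (E := E) hV
  obtain ⟨S, hS, hSo, hSm⟩ : ∃ S ⊆ {z : ℝ × M × M | IsRegularPoint E V κ z}, IsOpen S ∧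
      ∀ c : M, ((0 : ℝ), c, c) ∈ S :=
    ⟨interior _, interior_subset, isOpen_interior, fun c ↦
      mem_interior_iff_mem_nhds.2 (h c κ ⟨hκ, le_rfl⟩)⟩
  have hdiag : IsCompact (diagonal M) := isCompact_diagonal
  obtain ⟨u, N, hu, hN, h0, hNd, huN⟩ := generalized_tube_lemma
    (isCompact_singleton (x := (0 : ℝ))) hdiag hSo (by
      rintro ⟨t, x, y⟩ ⟨ht, hxy⟩
      obtain rfl : t = 0 := ht
      obtain rfl : x = y := hxy
      exact hSm x)
  obtain ⟨t₀, ht₀, hball⟩ := Metric.isOpen_iff.1 hu 0 (h0 rfl)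
  refine ⟨κ, hκ, t₀, ht₀, N, hN, hNd, fun t ht x y hxy ↦ hS (huN ⟨hball ?_, hxy⟩)⟩
  rw [Real.ball_eq_Ioo, zero_sub, zero_add]
  exact ht

end RegularPoints

end

noncomputable section

set_option linter.unusedSectionVars false

/-! ### Free motions: the eikonal equation and local minimality. -/

section LocalDistance

open Filter Topology Manifold
open scoped Uniformity

variable {E : Type*} [NormedAddCommGroup E] [NormedSpace ℝ E] [FiniteDimensional ℝ E]
  {M : Type*} [MetricSpace M] [ChartedSpace E M] [IsManifold 𝓘(ℝ, E) ∞ M]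
  [RiemannianBundle (fun x : M ↦ TangentSpace 𝓘(ℝ, E) x)]
  [IsContMDiffRiemannianBundle 𝓘(ℝ, E) ∞ E (fun x : M ↦ TangentSpace 𝓘(ℝ, E) x)]
  {V : M → ℝ} (hV : ContMDiff 𝓘(ℝ, E) 𝓘(ℝ, ℝ) ∞ V)

include hV

theorem IsClassicalPath.norm_eq {T : ℝ} {γ : ℝ → CotangentBundle E M}
    (hγ : IsClassicalPath (scaledHamiltonian E V 0) T γ) {s : ℝ} (hs : s ∈ Icc 0 T) :
    ‖(γ s).2‖ = ‖(γ 0).2‖ := by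
  have := hγ.norm_sq_eq hV hs
  refine (pow_left_inj₀ (ContinuousLinearMap.opNorm_nonneg _)
    (ContinuousLinearMap.opNorm_nonneg _) two_ne_zero).1 ?_
  exact this.trans (by ring)

theorem HasUniqueLowEnergyPath.scaledAction_zero_eq {μ : ℝ} {x y : M}
    (h : HasUniqueLowEnergyPath (scaledHamiltonian E V 0) 1 x y μ) {γ : ℝ → CotangentBundle E M}
    (hγ : γ ∈ lowEnergyPaths (scaledHamiltonian E V 0) 1 x y μ) :
    scaledAction E V μ 0 x y = ‖(γ 0).2‖ ^ 2 / 2 := by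
  rw [h.scaledAction_eq hV hγ]
  have : ∀ s ∈ uIcc (0 : ℝ) 1, ‖(γ s).2‖ ^ 2 / 2 - 0 ^ 2 * V (γ s).proj = ‖(γ 0).2‖ ^ 2 / 2 :=
    fun s hs ↦ by
      rw [uIcc_of_le zero_le_one] at hs
      rw [hγ.1.norm_eq hV hs]
      simp
  rw [intervalIntegral.integral_congr this]
  simp

theorem isClassicalPath_rest (T : ℝ) (y : M) :
    IsClassicalPath (scaledHamiltonian E V 0) T (fun _ ↦ ⟨y, 0⟩) := by
  refine isClassicalPath_of_isCoordSolutionAt hV continuousOn_const fun s _ ↦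
    ⟨y, mem_chart_source E y, ?_, ?_⟩
  all_goals
    have h0 : momCoord (E := E) y (⟨y, 0⟩ : CotangentBundle E M) = 0 :=
      ContinuousLinearMap.zero_comp _
    simp only [h0]
  · rw [coordVelocity_rest hV]
    exact hasDerivWithinAt_const _ _ _
  · rw [coordForce_rest hV (posCoord_mem_target (mem_chart_source E y))]
    exact hasDerivWithinAt_const _ _ _

/-- The eikonal equation: the differential is the final momentum, whose norm equals that of the
initial momentum because the speed is constant. -/
theorem IsRegularPoint.exists_hasMFDerivAt {μ : ℝ} {x y : M}
    (h : IsRegularPoint E V μ (0, x, y)) :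
    ∃ ξ : TangentSpace 𝓘(ℝ, E) x →L[ℝ] ℝ,
      HasMFDerivAt 𝓘(ℝ, E) 𝓘(ℝ, ℝ) (fun x ↦ scaledAction E V μ 0 x y) x ξ ∧
        scaledAction E V μ 0 x y = ‖ξ‖ ^ 2 / 2 := by
  obtain ⟨γ, hγ, -⟩ := h.unique
  have h1 := h.hasMFDerivAt_left γ hγ
  have h2 := h.unique.scaledAction_zero_eq hV hγ
  rw [← hγ.1.norm_eq hV (right_mem_Icc.2 zero_le_one)] at h2
  obtain rfl : (γ 1).proj = x := hγ.2.2.1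
  exact ⟨(γ 1).2, h1, h2⟩

theorem IsRegularPoint.scaledAction_self {μ : ℝ} (hμ : 0 < μ) {y : M}
    (h : IsRegularPoint E V μ (0, y, y)) : scaledAction E V μ 0 y y = 0 := by
  have hn : ‖(0 : TangentSpace 𝓘(ℝ, E) y →L[ℝ] ℝ)‖ = 0 := ContinuousLinearMap.opNorm_zero
  rw [h.unique.scaledAction_zero_eq hV (γ := fun _ ↦ ⟨y, 0⟩)
    ⟨isClassicalPath_rest hV 1 y, rfl, rfl, hn.trans_lt hμ⟩, hn]
  simp

variable [IsRiemannianManifold 𝓘(ℝ, E) M]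

/-- The square root of twice the action is bounded by the length of paths. -/
theorem scaledAction_lt_of_pathELength_lt {μ : ℝ} (hμ : 0 < μ) {y : M} {r : ℝ}
    (hreg : ∀ x, dist y x < r → IsRegularPoint E V μ (0, x, y)) {η : ℝ → M}
    (hη : ContMDiff 𝓘(ℝ, ℝ) 𝓘(ℝ, E) 1 η) (h0 : η 0 = y) {ρ : ℝ} (hρ : ρ ≤ r)
    (hlen : pathELength 𝓘(ℝ, E) η 0 1 < ENNReal.ofReal ρ) {ε : ℝ} (hε : 0 < ε) :
    √(2 * scaledAction E V μ 0 (η 1) y) ≤ ρ + ε := by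
  have hball : ∀ s ∈ Icc (0 : ℝ) 1, dist y (η s) < r := fun s hs ↦ by
    have h1 : edist y (η s) < ENNReal.ofReal ρ := by
      rw [‹IsRiemannianManifold 𝓘(ℝ, E) M›.out]
      exact ((riemannianEDist_le_pathELength hη.contMDiffOn h0 rfl hs.1).trans
        (pathELength_mono le_rfl hs.2)).trans_lt hlen
    rw [edist_dist, ENNReal.ofReal_lt_ofReal_iff_of_nonneg dist_nonneg] at h1
    exact h1.trans_le hρ
  have hρ0 : 0 ≤ ρ := by
    by_contra! h
    simp [ENNReal.ofReal_of_nonpos h.le] at hlen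
  set W : M → ℝ := fun x ↦ scaledAction E V μ 0 x y with hW
  have hsmooth : ∀ s ∈ Icc (0 : ℝ) 1, ContDiffAt ℝ 1 (fun s ↦ W (η s)) s := fun s hs ↦ by
    have h1 := ((hreg _ (hball s hs)).contMDiffAt).of_le
      (show (1 : WithTop ℕ∞) ≤ ∞ from ENat.LEInfty.out)
    have h2 : ContMDiffAt 𝓘(ℝ, ℝ) (𝓘(ℝ, ℝ).prod (𝓘(ℝ, E).prod 𝓘(ℝ, E))) 1
      (fun s ↦ ((0 : ℝ), η s, y)) s :=
      contMDiffAt_const.prodMk ((hη s).prodMk contMDiffAt_const)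
    exact (h1.comp s h2).contDiffAt
  have hnonneg : ∀ s ∈ Icc (0 : ℝ) 1, 0 ≤ W (η s) := fun s hs ↦ by
    obtain ⟨ξ, -, hξ⟩ := (hreg _ (hball s hs)).exists_hasMFDerivAt hV
    change 0 ≤ scaledAction E V μ 0 (η s) y
    rw [hξ]; positivity
  -- The square root is not differentiable where the action vanishes, as it does at `y`; adding `ε ^
  -- 2` regularizes it.
  set f : ℝ → ℝ := fun s ↦ √(2 * W (η s) + ε ^ 2) with hf
  have hpos : ∀ s ∈ Icc (0 : ℝ) 1, 0 < 2 * W (η s) + ε ^ 2 := fun s hs ↦ by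
    have := hnonneg s hs
    positivity
  have hfd : ContDiffOn ℝ 1 f (Icc 0 1) := fun s hs ↦ by
    refine ContDiffAt.contDiffWithinAt ?_
    exact ((contDiffAt_const.mul (hsmooth s hs)).add contDiffAt_const).sqrt (hpos s hs).ne'
  -- The eikonal equation gives `‖ξ‖ = √(2 W) ≤ f`, so `|f'| = |ξ(η')| / f ≤ ‖η'‖`.
  have hbound : ∀ s ∈ Icc (0 : ℝ) 1, ‖deriv f s‖ₑ ≤ ‖mfderiv 𝓘(ℝ, ℝ) 𝓘(ℝ, E) η s 1‖ₑ :=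
    fun s hs ↦ by
    obtain ⟨ξ, hξ, hξW⟩ := (hreg _ (hball s hs)).exists_hasMFDerivAt hV
    have d1 : HasMFDerivAt 𝓘(ℝ, ℝ) 𝓘(ℝ, E) η s (mfderiv 𝓘(ℝ, ℝ) 𝓘(ℝ, E) η s) :=
      ((hη s).mdifferentiableAt one_ne_zero).hasMFDerivAt
    have d2 : HasDerivAt (fun s ↦ W (η s)) (ξ (mfderiv 𝓘(ℝ, ℝ) 𝓘(ℝ, E) η s 1)) s := by
      have h : HasFDerivAt (fun s ↦ W (η s))
        (ξ.comp (mfderiv 𝓘(ℝ, ℝ) 𝓘(ℝ, E) η s) : ℝ →L[ℝ] ℝ) s := (hξ.comp s d1).hasFDerivAt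
      exact h.hasDerivAt
    have d3 : HasDerivAt f (2 * (ξ (mfderiv 𝓘(ℝ, ℝ) 𝓘(ℝ, E) η s 1))
        / (2 * √(2 * W (η s) + ε ^ 2))) s :=
      ((d2.const_mul 2).add_const _).sqrt (hpos s hs).ne'
    have h1 : |ξ (mfderiv 𝓘(ℝ, ℝ) 𝓘(ℝ, E) η s 1)|
        ≤ ‖ξ‖ * ‖mfderiv 𝓘(ℝ, ℝ) 𝓘(ℝ, E) η s 1‖ := ξ.le_opNorm _
    have h2 : ‖ξ‖ ≤ √(2 * W (η s) + ε ^ 2) := by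
      refine Real.le_sqrt_of_sq_le ?_
      have : W (η s) = ‖ξ‖ ^ 2 / 2 := hξW
      rw [this]
      nlinarith
    have h3 : 0 < √(2 * W (η s) + ε ^ 2) := Real.sqrt_pos.2 (hpos s hs)
    rw [← ofReal_norm, ← ofReal_norm]
    refine ENNReal.ofReal_le_ofReal ?_
    rw [d3.deriv, Real.norm_eq_abs, abs_div, abs_mul, abs_mul, abs_two, abs_of_pos h3,
      mul_div_mul_left _ _ two_ne_zero, div_le_iff₀ h3]
    refine h1.trans ?_
    rw [mul_comm]
    exact mul_le_mul_of_nonneg_left h2 (norm_nonneg _)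
  have hmain : ‖f 1 - f 0‖ₑ < ENNReal.ofReal ρ := by
    refine ((enorm_sub_le_lintegral_deriv_of_contDiffOn_Icc hfd zero_le_one).trans ?_).trans_lt hlen
    rw [pathELength_eq_lintegral_mfderiv_Icc]
    exact setLIntegral_mono' measurableSet_Icc hbound
  have hf0 : f 0 = ε := by
    have h00 : W (η 0) = 0 := by
      rw [h0]
      refine (hreg y ?_).scaledAction_self hV hμ
      have := hball 0 (by simp)
      rwa [h0] at this
    simp only [hf, h00]
    rw [mul_zero, zero_add, Real.sqrt_sq hε.le]
  rw [← ofReal_norm, ENNReal.ofReal_lt_ofReal_iff_of_nonneg (norm_nonneg _), hf0,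
    Real.norm_eq_abs, abs_lt] at hmain
  calc √(2 * W (η 1)) ≤ f 1 := Real.sqrt_le_sqrt (by nlinarith)
    _ ≤ ρ + ε := by linarith

/-- The path runs for unit time at constant speed `‖(γ 0).2‖`, which is therefore its length. -/
theorem dist_le_of_mem_lowEnergyPaths {μ : ℝ} {x y : M} {γ : ℝ → CotangentBundle E M}
    (hγ : γ ∈ lowEnergyPaths (scaledHamiltonian E V 0) 1 x y μ) : dist x y ≤ ‖(γ 0).2‖ := by
  have h := hγ.1.dist_le hV one_pos (fun s hs ↦ (hγ.1.norm_eq hV hs).le)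
    (right_mem_Icc.2 zero_le_one)
  have e : dist (γ 0).proj (γ 1).proj = dist x y := by rw [hγ.2.1, hγ.2.2.1, dist_comm]
  rw [← e]
  exact h.trans_eq (mul_one _)

/-- Short free motions are minimal. -/
theorem norm_eq_dist_of_mem_lowEnergyPaths {μ : ℝ} (hμ : 0 < μ) {y : M} {r : ℝ}
    (hreg : ∀ x, dist y x < r → IsRegularPoint E V μ (0, x, y)) {x : M} (hx : dist y x < r)
    {γ : ℝ → CotangentBundle E M}
    (hγ : γ ∈ lowEnergyPaths (scaledHamiltonian E V 0) 1 x y μ) : ‖(γ 0).2‖ = dist x y := by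
  refine le_antisymm ?_ (dist_le_of_mem_lowEnergyPaths hV hγ)
  have hn : ‖(γ 0).2‖ = √(2 * scaledAction E V μ 0 x y) := by
    rw [(hreg x hx).unique.scaledAction_zero_eq hV hγ, mul_div_cancel₀ _ two_ne_zero,
      Real.sqrt_sq (ContinuousLinearMap.opNorm_nonneg _)]
  rw [hn, dist_comm]
  -- For `ρ'` above the distance, a curve of length below some `ρ < min ρ' r` bounds `√(2Φ)` by `ρ +
  -- ε`, with `ε = ρ' - ρ`.
  refine le_of_forall_gt_imp_ge_of_dense fun ρ' hρ' ↦ ?_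
  obtain ⟨ρ, hρ1, hρ2⟩ := exists_between (lt_min hρ' hx)
  have h1 : riemannianEDist 𝓘(ℝ, E) y x < ENNReal.ofReal ρ := by
    rw [← ‹IsRiemannianManifold 𝓘(ℝ, E) M›.out, edist_dist]
    exact (ENNReal.ofReal_lt_ofReal_iff_of_nonneg dist_nonneg).2 hρ1
  obtain ⟨η, h0, h1, hη, hlen, -⟩ := exists_lt_locally_constant_of_riemannianEDist_lt h1 zero_lt_one
  have := scaledAction_lt_of_pathELength_lt hV hμ hreg hη h0
    (hρ2.le.trans (min_le_right _ _)) hlen (ε := ρ' - ρ)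
    (sub_pos.2 (hρ2.trans_le (min_le_left _ _)))
  rw [h1] at this
  linarith

/-- A scale below which the distance is realized by free motions. -/
theorem exists_radius_isRegularPoint [CompactSpace M] :
    ∃ μ > 0, ∃ r > 0, r ≤ μ ∧ ∀ x y : M, dist x y < r → IsRegularPoint E V μ (0, x, y) := by
  obtain ⟨μ, hμ, t₀, ht₀, N, hN, hNd, hreg⟩ := exists_tube_isRegularPoint (E := E) hV
  -- By compactness a neighbourhood of the diagonal contains all pairs at distance below some
  -- positive number.
  have : N ∈ 𝓤 M := by
    rw [← nhdsSet_diagonal_eq_uniformity]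
    exact hN.mem_nhdsSet.2 hNd
  obtain ⟨r, hr, hrN⟩ := Metric.mem_uniformity_dist.1 this
  refine ⟨μ, hμ, min r μ, lt_min hr hμ, min_le_right _ _, fun x y hxy ↦ ?_⟩
  exact hreg 0 ⟨neg_lt_zero.2 ht₀, ht₀⟩ x y (hrN (hxy.trans_le (min_le_left _ _)))

end LocalDistance

end

noncomputable section

set_option linter.unusedSectionVars false

/-! ### Intermediate points; reparametrization and gluing of paths. -/

section MinimalMotions

open Filter Topology Manifold

variable {E : Type*} [NormedAddCommGroup E] [NormedSpace ℝ E] [FiniteDimensional ℝ E]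
  {M : Type*} [MetricSpace M] [ChartedSpace E M] [IsManifold 𝓘(ℝ, E) ∞ M]
  [RiemannianBundle (fun x : M ↦ TangentSpace 𝓘(ℝ, E) x)]

variable (E) in
/-- A compact Riemannian manifold contains intermediate points. -/
theorem exists_dist_eq_and_dist_eq_sub [IsContMDiffRiemannianBundle 𝓘(ℝ, E) ∞ E
      (fun x : M ↦ TangentSpace 𝓘(ℝ, E) x)]
    [IsRiemannianManifold 𝓘(ℝ, E) M] [CompactSpace M] (x y : M)
    {a : ℝ} (ha : a ∈ Icc 0 (dist y x)) : ∃ z, dist y z = a ∧ dist z x = dist y x - a := by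
  -- A nearly minimal curve crosses the sphere of radius `a` about `y`. Compactness of the sphere
  -- then lets the error tend to 0.
  have key : ∀ ε > 0, ∃ z, dist y z = a ∧ dist z x < dist y x - a + ε := fun ε hε ↦ by
    have h1 : riemannianEDist 𝓘(ℝ, E) y x < ENNReal.ofReal (dist y x + ε) := by
      rw [← ‹IsRiemannianManifold 𝓘(ℝ, E) M›.out, edist_dist]
      exact (ENNReal.ofReal_lt_ofReal_iff_of_nonneg dist_nonneg).2 (by linarith)
    obtain ⟨η, h0, h1, hη, hlen, -⟩ :=
      exists_lt_locally_constant_of_riemannianEDist_lt h1 zero_lt_one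
    have hcont : ContinuousOn (fun s ↦ dist y (η s)) (Icc 0 1) :=
      (continuous_const.dist hη.continuous).continuousOn
    obtain ⟨s, hs, hsa⟩ := intermediate_value_Icc zero_le_one hcont
      (show a ∈ Icc (dist y (η 0)) (dist y (η 1)) by rwa [h0, h1, dist_self])
    refine ⟨η s, hsa, ?_⟩
    have h2 : edist y (η s) + edist (η s) x < ENNReal.ofReal (dist y x + ε) := by
      refine lt_of_le_of_lt ?_ hlen
      rw [← pathELength_add hs.1 hs.2, ‹IsRiemannianManifold 𝓘(ℝ, E) M›.out,
        ‹IsRiemannianManifold 𝓘(ℝ, E) M›.out]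
      exact add_le_add (riemannianEDist_le_pathELength hη.contMDiffOn h0 rfl hs.1)
        (riemannianEDist_le_pathELength hη.contMDiffOn rfl h1 hs.2)
    rw [edist_dist, edist_dist, ← ENNReal.ofReal_add dist_nonneg dist_nonneg,
      ENNReal.ofReal_lt_ofReal_iff_of_nonneg (by positivity)] at h2
    simp only at hsa
    linarith
  have hS : IsCompact {z | dist y z = a} :=
    (isClosed_eq (continuous_const.dist continuous_id) continuous_const).isCompact
  obtain ⟨z₁, hz₁, -⟩ := key 1 one_pos
  obtain ⟨z, hz, hmin⟩ := hS.exists_isMinOn ⟨z₁, hz₁⟩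
    (continuous_id.dist continuous_const : Continuous fun z : M ↦ dist z x).continuousOn
  refine ⟨z, hz, le_antisymm ?_ ?_⟩
  · refine le_of_forall_pos_lt_add fun ε hε ↦ ?_
    obtain ⟨z', hz', hlt⟩ := key ε hε
    exact (hmin hz').trans_lt hlt
  · have h1 := dist_triangle y z x
    have h2 : dist y z = a := hz
    linarith

/-- Multiplication of momenta by a number. -/
def smulMomentum (b : ℝ) (z : CotangentBundle E M) : CotangentBundle E M := ⟨z.proj, b • z.2⟩

theorem momCoord_smulMomentum (c : M) (b : ℝ) (z : CotangentBundle E M) :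
    momCoord c (smulMomentum b z) = b • momCoord c z := by
  ext a; rfl

theorem norm_smulMomentum {b : ℝ} (hb : 0 ≤ b) (z : CotangentBundle E M) :
    ‖(smulMomentum b z).2‖ = b * ‖z.2‖ := by
  have key : ∀ {F : Type _} [NormedAddCommGroup F] [NormedSpace ℝ F] (ξ : F →L[ℝ] ℝ),
      ‖b • ξ‖ = b * ‖ξ‖ := fun ξ ↦ by rw [norm_smul, Real.norm_of_nonneg hb]
  exact key (F := TangentSpace 𝓘(ℝ, E) z.proj) z.2

variable [IsContMDiffRiemannianBundle 𝓘(ℝ, E) ∞ E (fun x : M ↦ TangentSpace 𝓘(ℝ, E) x)]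
  {V : M → ℝ} (hV : ContMDiff 𝓘(ℝ, E) 𝓘(ℝ, ℝ) ∞ V)

include hV

/-- Affine reparametrization of classical paths. -/
theorem IsClassicalPath.comp_affine {t T T' a b : ℝ} {γ : ℝ → CotangentBundle E M}
    (hγ : IsClassicalPath (scaledHamiltonian E V t) T γ) (ha : 0 ≤ a) (hb : 0 ≤ b)
    (hT : a + b * T' ≤ T) :
    IsClassicalPath (scaledHamiltonian E V (b * t)) T'
      (fun s ↦ smulMomentum b (γ (a + b * s))) := by
  have hmaps : MapsTo (fun s ↦ a + b * s) (Icc 0 T') (Icc 0 T) := fun s hs ↦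
    ⟨add_nonneg ha (mul_nonneg hb hs.1),
      (add_le_add_right (mul_le_mul_of_nonneg_left hs.2 hb) a).trans hT⟩
  refine isClassicalPath_of_isCoordSolutionAt hV
    (hγ.continuousOn.comp (by fun_prop) hmaps) fun s hs ↦ ?_
  have hc := mem_chart_source E (γ (a + b * s)).proj
  set c := (γ (a + b * s)).proj
  have h := hγ.isCoordSolutionAt hV (hmaps hs) hc
  have hd : HasDerivWithinAt (fun s ↦ a + b * s) b (Icc 0 T') s := by
    simpa using (((hasDerivAt_id s).const_mul b).const_add a).hasDerivWithinAt
  refine ⟨c, hc, ?_, ?_⟩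
  · rw [momCoord_smulMomentum, coordVelocity_smul]
    exact h.pos.scomp s hd hmaps
  · simp only [momCoord_smulMomentum]
    have e := coordForce_smul hV b t (posCoord_mem_target hc) (momCoord c (γ (a + b * s)))
    refine ((h.mom.scomp s hd hmaps).const_smul b).congr_deriv ?_
    rw [smul_smul, ← pow_two]
    exact e.symm

theorem IsClassicalPath.comp_add {t T T' a : ℝ} {γ : ℝ → CotangentBundle E M}
    (hγ : IsClassicalPath (scaledHamiltonian E V t) T γ) (ha : 0 ≤ a) (hT : a + T' ≤ T) :
    IsClassicalPath (scaledHamiltonian E V t) T' (fun s ↦ γ (a + s)) := by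
  have h := hγ.comp_affine hV ha zero_le_one (T' := T') (by rwa [one_mul])
  have e : ∀ z : CotangentBundle E M, smulMomentum 1 z = z := fun z ↦ by
    simp [smulMomentum]
  simpa only [one_mul, e] using h

/-- Concatenation of classical paths. -/
theorem IsClassicalPath.append {t T₁ T₂ : ℝ} {γ γ' : ℝ → CotangentBundle E M}
    (hγ : IsClassicalPath (scaledHamiltonian E V t) T₁ γ)
    (hγ' : IsClassicalPath (scaledHamiltonian E V t) T₂ γ') (hT₁ : 0 ≤ T₁) (hT₂ : 0 ≤ T₂)
    (h : γ T₁ = γ' 0) :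
    IsClassicalPath (scaledHamiltonian E V t) (T₁ + T₂)
      (fun s ↦ if s ≤ T₁ then γ s else γ' (s - T₁)) := by
  set τ : ℝ → CotangentBundle E M := fun s ↦ if s ≤ T₁ then γ s else γ' (s - T₁) with hτ
  have e1 : EqOn τ γ (Icc 0 T₁) := fun s hs ↦ if_pos hs.2
  have e2 : EqOn τ (fun s ↦ γ' (s - T₁)) (Icc T₁ (T₁ + T₂)) := fun s hs ↦ by
    rcases hs.1.eq_or_lt with rfl | hlt
    · simp [hτ, h]
    · exact if_neg hlt.not_ge
  have hU : Icc 0 (T₁ + T₂) = Icc 0 T₁ ∪ Icc T₁ (T₁ + T₂) :=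
    (Icc_union_Icc_eq_Icc hT₁ (by linarith)).symm
  have hmaps : MapsTo (fun s ↦ s - T₁) (Icc T₁ (T₁ + T₂)) (Icc 0 T₂) := fun s hs ↦
    ⟨sub_nonneg.2 hs.1, by linarith [hs.2]⟩
  refine isClassicalPath_of_isCoordSolutionAt hV ?_ fun s hs ↦
    ⟨(τ s).proj, mem_chart_source E _, ?_⟩
  · rw [hU]
    refine ContinuousOn.union_of_isClosed ?_ ?_ isClosed_Icc isClosed_Icc
    · exact hγ.continuousOn.congr fun s hs ↦ congrArg TotalSpace.proj (e1 hs)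
    · exact (hγ'.continuousOn.comp (by fun_prop : ContinuousOn (fun s ↦ s - T₁) _) hmaps).congr
        fun s hs ↦ congrArg TotalSpace.proj (e2 hs)
  set c := (τ s).proj with hc
  have hsrc : (τ s).proj ∈ (chartAt E c).source := mem_chart_source E _
  have k1 : s ∈ Icc 0 T₁ → IsCoordSolutionAt V t T₁ γ c s := fun h1 ↦
    hγ.isCoordSolutionAt hV h1 (by rw [← e1 h1]; exact hsrc)
  have k2 : s ∈ Icc T₁ (T₁ + T₂) → IsCoordSolutionAt V t T₂ γ' c (s - T₁) := fun h2 ↦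
    hγ'.isCoordSolutionAt hV (hmaps h2) (by
      have := e2 h2
      simp only at this
      rw [← this]; exact hsrc)
  have hd : HasDerivWithinAt (fun s ↦ s - T₁) 1 (Icc T₁ (T₁ + T₂)) s :=
    ((hasDerivAt_id s).sub_const T₁).hasDerivWithinAt
  constructor
  · rw [hU]
    -- On each closed piece the path is a translate of a solution. The condition is vacuous on a
    -- piece that does not contain `s`; at `s = T₁` both sides hold with the same derivative.
    refine HasDerivWithinAt.union ?_ ?_
    · by_cases h1 : s ∈ Icc 0 T₁
      · rw [e1 h1]
        exact (k1 h1).pos.congr (fun r hr ↦ congrArg (posCoord c) (e1 hr))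
          (congrArg (posCoord c) (e1 h1))
      · exact HasFDerivWithinAt.of_notMem_closure (by rwa [isClosed_Icc.closure_eq])
    · by_cases h2 : s ∈ Icc T₁ (T₁ + T₂)
      · rw [e2 h2]
        have h3 := ((k2 h2).pos.scomp s hd hmaps).congr_deriv (one_smul _ _)
        exact h3.congr (fun r hr ↦ congrArg (posCoord c) (e2 hr)) (congrArg (posCoord c) (e2 h2))
      · exact HasFDerivWithinAt.of_notMem_closure (by rwa [isClosed_Icc.closure_eq])
  · rw [hU]
    refine HasDerivWithinAt.union ?_ ?_
    · by_cases h1 : s ∈ Icc 0 T₁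
      · rw [e1 h1]
        exact (k1 h1).mom.congr (fun r hr ↦ congrArg (momCoord c) (e1 hr))
          (congrArg (momCoord c) (e1 h1))
      · exact HasFDerivWithinAt.of_notMem_closure (by rwa [isClosed_Icc.closure_eq])
    · by_cases h2 : s ∈ Icc T₁ (T₁ + T₂)
      · rw [e2 h2]
        have h3 := ((k2 h2).mom.scomp s hd hmaps).congr_deriv (one_smul _ _)
        exact h3.congr (fun r hr ↦ congrArg (momCoord c) (e2 hr)) (congrArg (momCoord c) (e2 h2))
      · exact HasFDerivWithinAt.of_notMem_closure (by rwa [isClosed_Icc.closure_eq])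

omit hV

/-- Covectors that are the derivatives of functions whose difference has a local minimum. -/
theorem cotangent_eq_of_isLocalMin {f g : M → ℝ} {ζ ζ' : CotangentBundle E M}
    (h : ζ.proj = ζ'.proj) (hf : HasMFDerivAt 𝓘(ℝ, E) 𝓘(ℝ, ℝ) f ζ.proj ζ.2)
    (hg : HasMFDerivAt 𝓘(ℝ, E) 𝓘(ℝ, ℝ) g ζ'.proj ζ'.2)
    (hmin : IsLocalMin (fun x ↦ f x - g x) ζ.proj) : ζ = ζ' := by
  obtain ⟨x, ξ⟩ := ζ
  obtain ⟨x', ξ'⟩ := ζ'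
  obtain rfl : x = x' := h
  have e : ∀ (f : M → ℝ) (ξ : E →L[ℝ] ℝ),
      HasMFDerivAt 𝓘(ℝ, E) 𝓘(ℝ, ℝ) f x ξ →
      HasFDerivAt (fun u ↦ f ((extChartAt 𝓘(ℝ, E) x).symm u)) ξ
        (extChartAt 𝓘(ℝ, E) x x) := fun f ξ h ↦ by
    have h2 : HasFDerivWithinAt (fun u ↦ f ((extChartAt 𝓘(ℝ, E) x).symm u)) ξ
        (range 𝓘(ℝ, E)) (extChartAt 𝓘(ℝ, E) x x) := h.2
    rwa [ModelWithCorners.range_eq_univ, hasFDerivWithinAt_univ] at h2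
  have h1 := (e f ξ hf).sub (e g ξ' hg)
  have hxs := extChartAt_symm_apply (E := E) (mem_chart_source E x)
  have h2 : IsLocalMin (fun u ↦ f ((extChartAt 𝓘(ℝ, E) x).symm u)
      - g ((extChartAt 𝓘(ℝ, E) x).symm u)) (extChartAt 𝓘(ℝ, E) x x) := by
    have hc := (continuousAt_extChartAt_symm (I := 𝓘(ℝ, E)) x).tendsto
    rw [hxs] at hc
    filter_upwards [hc.eventually hmin] with u hu
    rwa [hxs]
  have h3 := h2.hasFDerivAt_eq_zero h1
  exact congrArg (TotalSpace.mk x) (sub_eq_zero.1 h3)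

end MinimalMotions

end

noncomputable section

set_option linter.unusedSectionVars false

/-! ### Global existence of minimal geodesics. -/

section MinimalMotions

open Filter Topology

variable {E : Type*} [NormedAddCommGroup E] [NormedSpace ℝ E] [FiniteDimensional ℝ E]
  {M : Type*} [MetricSpace M] [ChartedSpace E M] [IsManifold 𝓘(ℝ, E) ∞ M]
  [RiemannianBundle (fun x : M ↦ TangentSpace 𝓘(ℝ, E) x)]
  [IsContMDiffRiemannianBundle 𝓘(ℝ, E) ∞ E (fun x : M ↦ TangentSpace 𝓘(ℝ, E) x)]
  [IsRiemannianManifold 𝓘(ℝ, E) M]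
  {V : M → ℝ} (hV : ContMDiff 𝓘(ℝ, E) 𝓘(ℝ, ℝ) ∞ V)

include hV

section Radius

variable {μ r : ℝ} (hμ : 0 < μ)
  (hreg : ∀ x y : M, dist x y < r → IsRegularPoint E V μ (0, x, y))

include hμ hreg

theorem exists_short_motion {x y : M} (hxy : dist x y < r) :
    ∃ γ ∈ lowEnergyPaths (scaledHamiltonian E V 0) 1 x y μ, ‖(γ 0).2‖ = dist x y := by
  obtain ⟨γ, hγ, -⟩ := (hreg x y hxy).unique
  exact ⟨γ, hγ, norm_eq_dist_of_mem_lowEnergyPaths hV hμ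
    (fun x' hx' ↦ hreg x' y (by rwa [dist_comm])) (by rwa [dist_comm]) hγ⟩

theorem scaledAction_zero_eq_of_dist_lt {x y : M} (hxy : dist x y < r) :
    scaledAction E V μ 0 x y = dist x y ^ 2 / 2 := by
  obtain ⟨γ, hγ, hn⟩ := exists_short_motion hV hμ hreg hxy
  rw [(hreg x y hxy).unique.scaledAction_zero_eq hV hγ, hn]

/-- A minimal concatenation of two short motions has no corner. -/
theorem eq_of_two_mul_le_dist {δ : ℝ} (hδ0 : 0 ≤ δ) (hδ : δ < r) {w z x : M} (hwz : dist z w ≤ δ)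
    (hzx : dist x z ≤ δ) (hwx : 2 * δ ≤ dist x w) {γ₁ γ₂ : ℝ → CotangentBundle E M}
    (h₁ : γ₁ ∈ lowEnergyPaths (scaledHamiltonian E V 0) 1 z w μ)
    (h₂ : γ₂ ∈ lowEnergyPaths (scaledHamiltonian E V 0) 1 x z μ) : γ₁ 1 = γ₂ 0 := by
  -- The final momentum of `γ₁` is the differential of Φ(0, ·, w), and the initial momentum of `γ₂`
  -- is that of -Φ(0, x, ·). It remains to see that `z` minimizes the sum of the two actions.
  refine cotangent_eq_of_isLocalMin (h₁.2.2.1.trans h₂.2.1.symm)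
    ((hreg z w (hwz.trans_lt hδ)).hasMFDerivAt_left γ₁ h₁)
    ((hreg x z (hzx.trans_lt hδ)).hasMFDerivAt_right γ₂ h₂) ?_
  rw [h₁.2.2.1]
  have c1 : ContinuousAt (fun z' ↦ dist z' w) z := by fun_prop
  have c2 : ContinuousAt (fun z' ↦ dist x z') z := by fun_prop
  filter_upwards [c1.eventually (gt_mem_nhds (hwz.trans_lt hδ)),
    c2.eventually (gt_mem_nhds (hzx.trans_lt hδ))] with z' h1 h2
  rw [scaledAction_zero_eq_of_dist_lt hV hμ hreg h1, scaledAction_zero_eq_of_dist_lt hV hμ hreg h2,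
    scaledAction_zero_eq_of_dist_lt hV hμ hreg (hwz.trans_lt hδ),
    scaledAction_zero_eq_of_dist_lt hV hμ hreg (hzx.trans_lt hδ)]
  have h3 := dist_triangle x z' w
  have h4 : dist z w ^ 2 ≤ δ ^ 2 := by gcongr
  have h5 : dist x z ^ 2 ≤ δ ^ 2 := by gcongr
  have h6 : (2 * δ) ^ 2 ≤ (dist x z' + dist z' w) ^ 2 := by
    gcongr
    exact hwx.trans h3
  -- If `a + b ≥ 2δ`, then `a² + b² ≥ (a + b)² / 2 ≥ 2δ²`, an upper bound for the value at `z`.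
  nlinarith [sq_nonneg (dist x z' - dist z' w)]

/-- Induction on the number of segments of length `δ`. A motion of time `k + 1` reaches an
intermediate point `z` at distance `δ` from `x`. Its position `w` one unit of time earlier satisfies
`dist y w ≤ k δ`, hence `dist x w ≥ 2 δ`, so the short motion from `z` to `x` continues it without a
corner. The bound `r ≤ μ` makes the last segment a low energy path. -/
theorem exists_motion_of_dist_eq_mul [CompactSpace M] (hrμ : r ≤ μ) {δ : ℝ} (hδ0 : 0 ≤ δ)
    (hδ : δ < r) (k : ℕ) : ∀ x y : M, dist y x = (k + 1) * δ →
      ∃ γ : ℝ → CotangentBundle E M, IsClassicalPath (scaledHamiltonian E V 0) (k + 1) γ ∧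
        (γ 0).proj = y ∧ (γ (k + 1)).proj = x ∧ ‖(γ 0).2‖ = δ := by
  induction k with
  | zero =>
    intro x y hxy
    have hd : dist x y = δ := by rw [dist_comm, hxy]; simp
    obtain ⟨γ, hγ, hn⟩ := exists_short_motion hV hμ hreg (x := x) (y := y) (hd.trans_lt hδ)
    rw [Nat.cast_zero, zero_add]
    exact ⟨γ, hγ.1, hγ.2.1, hγ.2.2.1, hn.trans hd⟩
  | succ k ih =>
    intro x y hxy
    push_cast at hxy ⊢
    obtain ⟨z, hyz, hzx⟩ := exists_dist_eq_and_dist_eq_sub E x y (a := (k + 1) * δ)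
      ⟨by positivity, by rw [hxy]; nlinarith⟩
    obtain ⟨γ, hγ, hγ0, hγ1, hγn⟩ := ih z y hyz
    have hxz : dist x z = δ := by rw [dist_comm, hzx, hxy]; ring
    obtain ⟨γ₂, hγ₂, hn₂⟩ := exists_short_motion hV hμ hreg (hxz.trans_lt hδ)
    have hk : (k : ℝ) ∈ Icc (0 : ℝ) (k + 1) := ⟨by positivity, by linarith⟩
    have hn0 : ‖(γ (k + 0)).2‖ = δ := by
      rw [congrArg (fun s : ℝ ↦ ‖(γ s).2‖) (add_zero (k : ℝ)), hγ.norm_eq hV hk, hγn]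
    have hγ₁ : (fun s ↦ γ (k + s)) ∈
        lowEnergyPaths (scaledHamiltonian E V 0) 1 z (γ k).proj μ := by
      refine ⟨hγ.comp_add hV hk.1 le_rfl, by simp, hγ1, ?_⟩
      exact hn0.trans_lt (hδ.trans_le hrμ)
    have hn₁ : dist z (γ k).proj ≤ δ :=
      (dist_le_of_mem_lowEnergyPaths hV hγ₁).trans hn0.le
    have hyw : dist y (γ k).proj ≤ δ * k := by
      rw [← hγ0]
      exact hγ.dist_le hV (by positivity) (fun s hs ↦ (hγ.norm_eq hV hs).trans_le hγn.le) hk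
    have hxw : 2 * δ ≤ dist x (γ k).proj := by
      have := dist_triangle_right y x (γ k).proj
      rw [hxy] at this
      linarith
    have hglue := eq_of_two_mul_le_dist hV hμ hreg hδ0 hδ hn₁ hxz.le hxw hγ₁ hγ₂
    refine ⟨_, hγ.append hV hγ₂.1 (by positivity) zero_le_one hglue, ?_, ?_, ?_⟩
    · rw [if_pos (by positivity), hγ0]
    · rw [if_neg (by linarith), add_sub_cancel_left, hγ₂.2.2.1]
    · rw [if_pos (by positivity), hγn]

end Radius

variable [CompactSpace M]

/-- Any two points of a compact Riemannian manifold are joined by a minimal free motion. -/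
theorem exists_minimal_motion (x y : M) :
    ∃ γ : ℝ → CotangentBundle E M, IsClassicalPath (scaledHamiltonian E V 0) 1 γ ∧
      (γ 0).proj = y ∧ (γ 1).proj = x ∧ ‖(γ 0).2‖ = dist x y := by
  obtain ⟨μ, hμ, r, hr, hrμ, hreg⟩ := exists_radius_isRegularPoint (E := E) hV
  obtain ⟨k, hk⟩ := exists_nat_gt (dist y x / r)
  have hk1 : (0 : ℝ) < k + 1 := by positivity
  have hδ : dist y x / (k + 1) < r := by
    rw [div_lt_iff₀ hr] at hk
    rw [div_lt_iff₀ hk1]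
    nlinarith
  obtain ⟨γ, hγ, hγ0, hγ1, hγn⟩ := exists_motion_of_dist_eq_mul hV hμ hreg hrμ
    (by positivity) hδ k x y (by field_simp)
  -- Running the motion `k + 1` times faster brings it to unit time and multiplies the momentum by
  -- `k + 1`, giving `dist y x`. The parameter `t = 0` is unchanged.
  have h := hγ.comp_affine hV le_rfl hk1.le (T' := 1) (by simp)
  rw [mul_zero] at h
  refine ⟨_, h, ?_, ?_, ?_⟩
  · simpa [smulMomentum] using hγ0
  · simpa [smulMomentum] using hγ1
  · rw [norm_smulMomentum hk1.le, zero_add, mul_zero, hγn, dist_comm]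
    field_simp

/-- The scaled action at the time `0` is half the squared distance. -/
theorem HasUniqueLowEnergyPath.scaledAction_zero_eq_dist {μ : ℝ} {x y : M}
    (h : HasUniqueLowEnergyPath (scaledHamiltonian E V 0) 1 x y μ) :
    scaledAction E V μ 0 x y = dist x y ^ 2 / 2 := by
  obtain ⟨γ, hγ, hγ0, hγ1, hγn⟩ := exists_minimal_motion hV x y
  obtain ⟨γ', hγ', -⟩ := id h
  -- The admissible path is at least as long as the distance and has momentum below `μ`, so the
  -- minimal motion satisfies the bound too, however small `μ` is.
  have hlt : ‖(γ 0).2‖ < μ := hγn.trans_lt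
    ((dist_le_of_mem_lowEnergyPaths hV hγ').trans_lt hγ'.2.2.2)
  rw [HasUniqueLowEnergyPath.scaledAction_zero_eq hV h ⟨hγ, hγ0, hγ1, hlt⟩, hγn]

end MinimalMotions

end

noncomputable section

set_option linter.unusedSectionVars false

/-! ### Taylor's formula with a smooth integral remainder. -/

section TaylorRemainder

open Filter Topology

variable {X : Type*} [NormedAddCommGroup X] [NormedSpace ℝ X]

/-- The integrand is a smooth function along the curve `s ↦ (s, s t, x)`, which depends on `(t, x)`
in an affine way. Smoothness of superposition operators thus replaces repeated differentiation under
the integral. -/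
theorem contDiffOn_remainder_integral {D : Set (ℝ × X)} (hD : IsOpen D) {F : ℝ × X → ℝ}
    (hF : ContDiffOn ℝ ∞ F D) (hstar : ∀ z ∈ D, ∀ s ∈ Icc (0 : ℝ) 1, (s * z.1, z.2) ∈ D) :
    ContDiffOn ℝ ∞ (fun z ↦ ∫ s in (0 : ℝ)..1, (1 - s) * F (s * z.1, z.2)) D := by
  let timeCurve : C(unitInterval, ℝ) := ⟨fun s ↦ s, continuous_subtype_val⟩
  let c : ℝ × X → C(unitInterval, ℝ × ℝ × X) := fun z ↦
    (ContinuousLinearMap.inl ℝ ℝ (ℝ × X)).compLeftContinuous ℝ unitInterval timeCurve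
    + ((ContinuousLinearMap.inr ℝ ℝ (ℝ × X)) ∘L .inl ℝ ℝ X).compLeftContinuous ℝ unitInterval
        (z.1 • timeCurve)
    + ((ContinuousLinearMap.inr ℝ ℝ (ℝ × X)) ∘L .inr ℝ ℝ X).compLeftContinuous ℝ unitInterval
        (constCurve X z.2)
  have hc : ContDiff ℝ ∞ c := by fun_prop
  have hcs : ∀ z (s : unitInterval), c z s = ((s : ℝ), (s : ℝ) * z.1, z.2) := fun z s ↦ by
    simp [c, timeCurve, mul_comm]
  let f : ℝ × ℝ × X → ℝ := fun p ↦ (1 - p.1) * F p.2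
  have hU : IsOpen {p : ℝ × ℝ × X | p.2 ∈ D} := hD.preimage continuous_snd
  have hf : ContDiffOn ℝ ∞ f {p | p.2 ∈ D} :=
    ContDiffOn.mul (by fun_prop) (hF.comp contDiff_snd.contDiffOn fun _ h ↦ h)
  have hmem : ∀ z ∈ D, ∀ s, c z s ∈ {p : ℝ × ℝ × X | p.2 ∈ D} := fun z hz s ↦ by
    rw [hcs]
    exact hstar z hz s s.2
  have key := (evalCurve ℝ 1 ∘L curvePrimitive ℝ).contDiff.comp_contDiffOn
    ((contDiffOn_superpos (K := unitInterval) hU hf).comp hc.contDiffOn hmem)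
  refine key.congr fun z hz ↦ ?_
  change _ = ∫ s in (0 : ℝ)..1, extendCurve (superpos f (c z)) s
  refine intervalIntegral.integral_congr fun s hs ↦ ?_
  rw [uIcc_of_le zero_le_one] at hs
  rw [extendCurve_of_mem _ hs, superpos_apply_of_continuousOn hf.continuousOn (hmem z hz), hcs]

/-- Derivatives with respect to the first variable. -/
theorem exists_contDiffOn_deriv_fst {D : Set (ℝ × X)} (hD : IsOpen D) {G : ℝ × X → ℝ}
    (hG : ContDiffOn ℝ ∞ G D) : ∃ F : ℝ × X → ℝ, ContDiffOn ℝ ∞ F D ∧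
      ∀ z ∈ D, HasDerivAt (fun τ ↦ G (τ, z.2)) (F z) z.1 := by
  refine ⟨fun z ↦ fderiv ℝ G z (1, 0), ?_, fun z hz ↦ ?_⟩
  · exact ((contDiffOn_infty_iff_fderiv_of_isOpen hD).1 hG).2.clm_apply contDiffOn_const
  · have h1 : HasFDerivAt G (fderiv ℝ G z) z :=
      ((hG.contDiffAt (hD.mem_nhds hz)).differentiableAt (by simp)).hasFDerivAt
    have h2 : HasDerivAt (fun τ ↦ (τ, z.2)) ((1 : ℝ), (0 : X)) z.1 :=
      (hasDerivAt_id z.1).prodMk (hasDerivAt_const _ _)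
    exact HasFDerivAt.comp_hasDerivAt (f := fun τ ↦ (τ, z.2)) z.1 h1 h2

theorem exists_contDiffOn_iteratedDeriv_two_fst {D : Set (ℝ × X)} (hD : IsOpen D) {G : ℝ × X → ℝ}
    (hG : ContDiffOn ℝ ∞ G D) : ∃ F : ℝ × X → ℝ, ContDiffOn ℝ ∞ F D ∧
      ∀ z ∈ D, iteratedDeriv 2 (fun τ ↦ G (τ, z.2)) z.1 = F z := by
  obtain ⟨F₁, hF₁, h₁⟩ := exists_contDiffOn_deriv_fst hD hG
  obtain ⟨F₂, hF₂, h₂⟩ := exists_contDiffOn_deriv_fst hD hF₁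
  refine ⟨F₂, hF₂, fun z hz ↦ ?_⟩
  rw [iteratedDeriv_succ, iteratedDeriv_one]
  have hc : ContinuousAt (fun τ ↦ (τ, z.2)) z.1 := by fun_prop
  have he : deriv (fun τ ↦ G (τ, z.2)) =ᶠ[𝓝 z.1] fun τ ↦ F₁ (τ, z.2) := by
    filter_upwards [hc.eventually (hD.mem_nhds hz)] with τ hτ using (h₁ _ hτ).deriv
  rw [he.deriv_eq]
  exact (h₂ z hz).deriv

/-- The remainder of the second order Taylor formula depends smoothly on parameters. -/
theorem contDiffOn_remainder {D : Set (ℝ × X)} (hD : IsOpen D) {G : ℝ × X → ℝ}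
    (hG : ContDiffOn ℝ ∞ G D) (hstar : ∀ z ∈ D, ∀ s ∈ Icc (0 : ℝ) 1, (s * z.1, z.2) ∈ D) :
    ContDiffOn ℝ ∞ (fun z ↦ ∫ s in (0 : ℝ)..1,
      (1 - s) * iteratedDeriv 2 (fun τ ↦ G (τ, z.2)) (s * z.1)) D := by
  obtain ⟨F, hF, h⟩ := exists_contDiffOn_iteratedDeriv_two_fst hD hG
  refine (contDiffOn_remainder_integral hD hF hstar).congr fun z hz ↦ ?_
  refine intervalIntegral.integral_congr fun s hs ↦ ?_
  rw [uIcc_of_le zero_le_one] at hs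
  exact congrArg ((1 - s) * ·) (h _ (hstar z hz s hs))

/-- The second order Taylor formula for even functions. -/
theorem eq_add_sq_mul_remainder_of_even {f : ℝ → ℝ} {t₀ : ℝ} (hf : ContDiffOn ℝ ∞ f (Ioo (-t₀) t₀))
    (heven : ∀ t, f (-t) = f t) {t : ℝ} (ht : t ∈ Ioo (-t₀) t₀) :
    f t = f 0 + t ^ 2 * ∫ s in (0 : ℝ)..1, (1 - s) * iteratedDeriv 2 f (s * t) := by
  have h1 : ContDiffOn ℝ ∞ (deriv f) (Ioo (-t₀) t₀) :=
    ((contDiffOn_infty_iff_deriv_of_isOpen isOpen_Ioo).1 hf).2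
  have h2 : ContDiffOn ℝ ∞ (deriv (deriv f)) (Ioo (-t₀) t₀) :=
    ((contDiffOn_infty_iff_deriv_of_isOpen isOpen_Ioo).1 h1).2
  have hmem : ∀ s ∈ Icc (0 : ℝ) 1, s * t ∈ Ioo (-t₀) t₀ := fun s hs ↦ by
    rw [mem_Ioo, ← abs_lt] at ht ⊢
    rw [abs_mul, abs_of_nonneg hs.1]
    exact (mul_le_of_le_one_left (abs_nonneg t) hs.2).trans_lt ht
  have hd : ∀ {g : ℝ → ℝ}, ContDiffOn ℝ ∞ g (Ioo (-t₀) t₀) → ∀ s ∈ Icc (0 : ℝ) 1,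
      HasDerivAt (fun s ↦ g (s * t)) (deriv g (s * t) * t) s := fun {g} hg s hs ↦ by
    have h3 := ((hg.contDiffAt (isOpen_Ioo.mem_nhds (hmem s hs))).differentiableAt
      (by simp)).hasDerivAt
    exact h3.comp s (hasDerivAt_mul_const t)
  -- Evenness removes the linear term of the Taylor formula.
  have h0 : deriv f 0 = 0 := by
    have h3 : deriv (fun x ↦ f (-x)) 0 = -deriv f (-0) := deriv_comp_neg f 0
    rw [neg_zero, funext heven] at h3
    linarith
  -- This primitive of the integrand comes from integration by parts. Its increment over [0, 1] is
  -- `f t - f 0 - t * deriv f 0`.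
  have hint : ∀ s ∈ uIcc (0 : ℝ) 1, HasDerivAt
      (fun s ↦ (1 - s) * (deriv f (s * t) * t) + f (s * t))
      ((1 - s) * (deriv (deriv f) (s * t) * t * t)) s := fun s hs ↦ by
    rw [uIcc_of_le zero_le_one] at hs
    have h3 := (((hasDerivAt_id s).const_sub 1).mul ((hd h1 s hs).mul_const t)).add (hd hf s hs)
    refine h3.congr_deriv ?_
    simp only [id]
    ring
  have hcont : ContinuousOn (fun s ↦ (1 - s) * (deriv (deriv f) (s * t) * t * t))
      (uIcc (0 : ℝ) 1) := by
    rw [uIcc_of_le zero_le_one]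
    have h3 : ContinuousOn (fun s ↦ deriv (deriv f) (s * t)) (Icc 0 1) :=
      h2.continuousOn.comp (by fun_prop) hmem
    fun_prop
  have hftc := intervalIntegral.integral_eq_sub_of_hasDerivAt hint hcont.intervalIntegrable
  have heq : ∫ s in (0 : ℝ)..1, (1 - s) * (deriv (deriv f) (s * t) * t * t)
      = t ^ 2 * ∫ s in (0 : ℝ)..1, (1 - s) * iteratedDeriv 2 f (s * t) := by
    rw [← intervalIntegral.integral_const_mul]
    refine intervalIntegral.integral_congr fun s _ ↦ ?_
    simp only [iteratedDeriv_succ, iteratedDeriv_zero]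
    ring
  rw [← heq, hftc]
  simp [h0]

end TaylorRemainder

/-! ### Evenness of the scaled action and smoothness of its remainder. -/

section ScaledAction

open Filter Topology

variable {E : Type*} [NormedAddCommGroup E] [NormedSpace ℝ E]
  {M : Type*} [TopologicalSpace M] [ChartedSpace E M] [IsManifold 𝓘(ℝ, E) ∞ M]
  [RiemannianBundle (fun x : M ↦ TangentSpace 𝓘(ℝ, E) x)]
  {V : M → ℝ}

/-- Only `t ^ 2` enters the Hamiltonian and the potential. The sets of paths for `t` and `-t` are
therefore equal, and so are the paths chosen from them. -/
theorem scaledAction_neg (V : M → ℝ) (μ t : ℝ) (x y : M) :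
    scaledAction E V μ (-t) x y = scaledAction E V μ t x y := by
  have h : scaledHamiltonian E V (-t) = scaledHamiltonian E V t := by
    simp [scaledHamiltonian]
  simp only [scaledAction, neg_sq]
  rw [h]

/-- Charts are taken only in `x` and `y`, so they commute with the derivatives in `t`, and the
domain is star-shaped in `t` about 0. This reduces the claim to `contDiffOn_remainder`. -/
theorem contMDiffOn_scaledActionRemainder {μ t₀ : ℝ} {N : Set (M × M)} (hN : IsOpen N)
    (h : ContMDiffOn (𝓘(ℝ, ℝ).prod (𝓘(ℝ, E).prod 𝓘(ℝ, E))) 𝓘(ℝ, ℝ) ∞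
        (fun z : ℝ × M × M ↦ scaledAction E V μ z.1 z.2.1 z.2.2) (Ioo (-t₀) t₀ ×ˢ N)) :
    ContMDiffOn (𝓘(ℝ, ℝ).prod (𝓘(ℝ, E).prod 𝓘(ℝ, E))) 𝓘(ℝ, ℝ) ∞
      (fun z : ℝ × M × M ↦ scaledActionRemainder E V μ z.1 z.2.1 z.2.2) (Ioo (-t₀) t₀ ×ˢ N) := by
  rintro ⟨t, x, y⟩ ⟨ht, hxy⟩
  refine ContMDiffAt.contMDiffWithinAt ?_
  set U : Set (E × E) := (extChartAt 𝓘(ℝ, E) x).target ×ˢ (extChartAt 𝓘(ℝ, E) y).target with hU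
  set σ : E × E → M × M :=
    fun w ↦ ((extChartAt 𝓘(ℝ, E) x).symm w.1, (extChartAt 𝓘(ℝ, E) y).symm w.2) with hσ
  have hσs : ContMDiffOn 𝓘(ℝ, E × E) (𝓘(ℝ, E).prod 𝓘(ℝ, E)) ∞ σ U := by
    have e1 : ContMDiffOn 𝓘(ℝ, E × E) 𝓘(ℝ, E) ∞
        (fun w : E × E ↦ (extChartAt 𝓘(ℝ, E) x).symm w.1) U :=
      (contMDiffOn_extChartAt_symm x).comp contDiff_fst.contMDiff.contMDiffOn fun w hw ↦ hw.1
    have e2 : ContMDiffOn 𝓘(ℝ, E × E) 𝓘(ℝ, E) ∞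
        (fun w : E × E ↦ (extChartAt 𝓘(ℝ, E) y).symm w.2) U :=
      (contMDiffOn_extChartAt_symm y).comp contDiff_snd.contMDiff.contMDiffOn fun w hw ↦ hw.2
    exact e1.prodMk e2
  have hUo : IsOpen (U ∩ σ ⁻¹' N) := hσs.continuousOn.isOpen_inter_preimage
    ((isOpen_extChartAt_target x).prod (isOpen_extChartAt_target y)) hN
  have hDo : IsOpen (Ioo (-t₀) t₀ ×ˢ (U ∩ σ ⁻¹' N)) := isOpen_Ioo.prod hUo
  set G : ℝ × E × E → ℝ := fun z ↦ scaledAction E V μ z.1 (σ z.2).1 (σ z.2).2 with hG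
  have hGs : ContDiffOn ℝ ∞ G (Ioo (-t₀) t₀ ×ˢ (U ∩ σ ⁻¹' N)) := by
    have e1 : ContMDiffOn 𝓘(ℝ, ℝ × E × E) (𝓘(ℝ, ℝ).prod (𝓘(ℝ, E).prod 𝓘(ℝ, E))) ∞
        (fun z : ℝ × E × E ↦ (z.1, σ z.2)) (Ioo (-t₀) t₀ ×ˢ (U ∩ σ ⁻¹' N)) :=
      contDiff_fst.contMDiff.contMDiffOn.prodMk
        (hσs.comp contDiff_snd.contMDiff.contMDiffOn fun z hz ↦ hz.2.1)
    exact (h.comp e1 fun z hz ↦ ⟨hz.1, hz.2.2⟩).contDiffOn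
  have hR := contDiffOn_remainder hDo hGs fun z hz s hs ↦ by
    refine ⟨?_, hz.2⟩
    have h1 := hz.1
    rw [mem_Ioo, ← abs_lt] at h1 ⊢
    rw [abs_mul, abs_of_nonneg hs.1]
    exact (mul_le_of_le_one_left (abs_nonneg _) hs.2).trans_lt h1
  set P : ℝ × M × M → ℝ × E × E :=
    fun z ↦ (z.1, extChartAt 𝓘(ℝ, E) x z.2.1, extChartAt 𝓘(ℝ, E) y z.2.2) with hP
  have hx : (extChartAt 𝓘(ℝ, E) x).symm (extChartAt 𝓘(ℝ, E) x x) = x :=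
    extChartAt_to_inv x
  have hy : (extChartAt 𝓘(ℝ, E) y).symm (extChartAt 𝓘(ℝ, E) y y) = y :=
    extChartAt_to_inv y
  have hPmem : P (t, x, y) ∈ Ioo (-t₀) t₀ ×ˢ (U ∩ σ ⁻¹' N) := by
    refine ⟨ht, ⟨mem_extChartAt_target x, mem_extChartAt_target y⟩, ?_⟩
    simp only [hσ, hP, mem_preimage, hx, hy]
    exact hxy
  have hPs : ContMDiffAt (𝓘(ℝ, ℝ).prod (𝓘(ℝ, E).prod 𝓘(ℝ, E))) 𝓘(ℝ, ℝ × E × E) ∞ P (t, x, y) := by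
    have e1 : ContMDiffAt 𝓘(ℝ, E) 𝓘(ℝ, E) ∞ (extChartAt 𝓘(ℝ, E) x) x := contMDiffAt_extChartAt
    have e2 : ContMDiffAt 𝓘(ℝ, E) 𝓘(ℝ, E) ∞ (extChartAt 𝓘(ℝ, E) y) y := contMDiffAt_extChartAt
    exact contMDiffAt_fst.prodMk_space
      ((e1.comp (t, x, y) (contMDiffAt_fst.comp _ contMDiffAt_snd)).prodMk_space
        (e2.comp (t, x, y) (contMDiffAt_snd.comp _ contMDiffAt_snd)))
  refine (((hR.contDiffAt (hDo.mem_nhds hPmem)).contMDiffAt).comp (t, x, y) hPs).congr_of_eventuallyEq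
    ?_
  have n1 : ∀ᶠ z : ℝ × M × M in 𝓝 (t, x, y), z.2.1 ∈ (extChartAt 𝓘(ℝ, E) x).source :=
    (show ContinuousAt (fun z : ℝ × M × M ↦ z.2.1) (t, x, y) by fun_prop).eventually
      (extChartAt_source_mem_nhds x)
  have n2 : ∀ᶠ z : ℝ × M × M in 𝓝 (t, x, y), z.2.2 ∈ (extChartAt 𝓘(ℝ, E) y).source :=
    (show ContinuousAt (fun z : ℝ × M × M ↦ z.2.2) (t, x, y) by fun_prop).eventually
      (extChartAt_source_mem_nhds y)
  filter_upwards [n1, n2] with z h1 h2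
  simp only [Function.comp_apply, hG, hσ, hP, (extChartAt 𝓘(ℝ, E) x).left_inv h1,
    (extChartAt 𝓘(ℝ, E) y).left_inv h2]
  rfl

end ScaledAction

end

/-! ### The theorem. -/

theorem theorem4p9
    {E : Type*} [NormedAddCommGroup E] [NormedSpace ℝ E] [FiniteDimensional ℝ E]
    {M : Type*} [MetricSpace M] [CompactSpace M] [ConnectedSpace M]
    [ChartedSpace E M] [IsManifold 𝓘(ℝ, E) ∞ M]
    [RiemannianBundle (fun x : M ↦ TangentSpace 𝓘(ℝ, E) x)]
    [IsContMDiffRiemannianBundle 𝓘(ℝ, E) ∞ E (fun x : M ↦ TangentSpace 𝓘(ℝ, E) x)]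
    [IsRiemannianManifold 𝓘(ℝ, E) M]
    (V : M → ℝ) (hV : ContMDiff 𝓘(ℝ, E) 𝓘(ℝ, ℝ) ∞ V) :
    (∃ (t₀ : ℝ) (N : Set (M × M)) (μ : ℝ), IsLowEnergyDomain E V t₀ N μ ∧
      ContMDiffOn (𝓘(ℝ, ℝ).prod (𝓘(ℝ, E).prod 𝓘(ℝ, E))) 𝓘(ℝ, ℝ) ∞
        (fun z : ℝ × M × M ↦ scaledAction E V μ z.1 z.2.1 z.2.2) (Ioo (-t₀) t₀ ×ˢ N)) ∧
    (∀ (t₀ : ℝ) (N : Set (M × M)) (μ : ℝ), IsLowEnergyDomain E V t₀ N μ →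
      ContMDiffOn (𝓘(ℝ, ℝ).prod (𝓘(ℝ, E).prod 𝓘(ℝ, E))) 𝓘(ℝ, ℝ) ∞
        (fun z : ℝ × M × M ↦ scaledAction E V μ z.1 z.2.1 z.2.2) (Ioo (-t₀) t₀ ×ˢ N) →
      ContMDiffOn (𝓘(ℝ, ℝ).prod (𝓘(ℝ, E).prod 𝓘(ℝ, E))) 𝓘(ℝ, ℝ) ∞
        (fun z : ℝ × M × M ↦ scaledActionRemainder E V μ z.1 z.2.1 z.2.2)
        (Ioo (-t₀) t₀ ×ˢ N) ∧
      ∀ t ∈ Ioo (-t₀) t₀, ∀ x y : M, (x, y) ∈ N →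
        scaledAction E V μ t x y
          = dist x y ^ 2 / 2 + t ^ 2 * scaledActionRemainder E V μ t x y) := by
  refine ⟨?_, fun t₀ N μ hdom hΦ ↦
    ⟨contMDiffOn_scaledActionRemainder hdom.isOpen hΦ, fun t ht x y hxy ↦ ?_⟩⟩
  · obtain ⟨μ, -, t₀, ht₀, N, hN, hNd, hreg⟩ := exists_tube_isRegularPoint (E := E) hV
    refine ⟨t₀, N, μ, ⟨ht₀, hN, hNd, fun t ht x y hxy ↦ (hreg t ht x y hxy).unique⟩, ?_⟩
    rintro ⟨t, x, y⟩ ⟨ht, hxy⟩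
    exact (hreg t ht x y hxy).contMDiffAt.contMDiffWithinAt
  · have h0 : (0 : ℝ) ∈ Ioo (-t₀) t₀ := ⟨neg_lt_zero.2 hdom.pos, hdom.pos⟩
    have hs : ContDiffOn ℝ ∞ (fun τ ↦ scaledAction E V μ τ x y) (Ioo (-t₀) t₀) := by
      have h1 : ContMDiffOn 𝓘(ℝ, ℝ) (𝓘(ℝ, ℝ).prod (𝓘(ℝ, E).prod 𝓘(ℝ, E))) ∞
          (fun τ : ℝ ↦ (τ, x, y)) (Ioo (-t₀) t₀) :=
        (contMDiff_id.prodMk contMDiff_const).contMDiffOn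
      exact (hΦ.comp h1 fun τ hτ ↦ ⟨hτ, hxy⟩).contDiffOn
    rw [eq_add_sq_mul_remainder_of_even hs (fun t ↦ scaledAction_neg V μ t x y) ht,
      (hdom.unique 0 h0 x y hxy).scaledAction_zero_eq_dist hV]
    rfl
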